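/- **Setting.** Let $(\mathcal A,\tau)$ be a $W^*$-probability space: $\mathcal A\subseteq B(H)$ is a von Neumann algebra on a complex Hilbert space and $\tau:\mathcal A\to\mathbb C$ is a tracial, faithful, normal state. Let $L^2(\mathcal A,\tau)$ be the completion of $\mathcal A$ for $\langle a,b\rangle=\tau(b^*a)$, and view $\mathcal A$ as a von Neumann algebra on $L^2(\mathcal A,\tau)$ acting by left multiplication. Let $\mathcal A^{\mathrm{op}}$ be the opposite algebra with its induced trace $\tau^{\mathrm{op}}$, $\mathcal A\otimes\mathcal A^{\mathrm{op}}$ the algebraic tensor product with its algebra structure, $(a\otimes b)^{\mathrm{flip}}=b\otimes a$ (extended linearly), and $\tau\bar\otimes\tau^{\mathrm{op}}$ the tensor product trace on the von Neumann algebra tensor product $\mathcal A\bar\otimes\mathcal A^{\mathrm{op}}$, acting on $L^2(\mathcal A,\tau)\otimes_2L^2(\mathcal A^{\mathrm{op}},\tau^{\mathrm{op}})$. * *Divided differences.* For $f\in C^k(\mathbb R)$, $f^{[0]}=f$ and $f^{[k]}:\mathbb R^{k+1}\to\mathbb C$ is the continuous extension of $$f^{[k]}(\lambda_1,\dots,\lambda_{k+1})=\frac{f^{[k-1]}(\lambda_1,\dots,\lambda_k)-f^{[k-1]}(\lambda_1,\dots,\lambda_{k-1},\lambda_{k+1})}{\lambda_k-\lambda_{k+1}}\qquad(\lambda_1,\dots,\lambda_{k+1}\text{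 distinct}).$$ * *Integral projective decompositions.* For Polish spaces $\Omega_1,\dots,\Omega_n$ and $\varphi:\Omega_1\times\cdots\times\Omega_n\to\mathbb C$, an $\ell^\infty$-integral projective decomposition (IPD) of $\varphi$ consists of a $\sigma$-finite measure space $(\Sigma,\rho)$ and product measurable functions $\varphi_j:\Omega_j\times\Sigma\to\mathbb C$, with $\varphi_j(\cdot,\sigma)$ bounded for every $\sigma$, such that $\int_\Sigma\prod_j\|\varphi_j(\cdot,\sigma)\|_\infty\,\rho(d\sigma)<\infty$ and $\varphi(\omega)=\int_\Sigma\prod_j\varphi_j(\omega_j,\sigma)\,\rho(d\sigma)$ for all $\omega$. The infimum of $\int_\Sigma\prod_j\|\varphi_j(\cdot,\sigma)\|_\infty\,d\rho$ over all IPDs of $\varphi$ ($\infty$ if there are none) is the integral projective tensor norm of $\varphi$. * *The space $\mathcal C^{[2]}(\mathbb R)$* is the set of $f\in C^2(\mathbb R)$ (complex-valued) such that, for every $r>0$, $\sup_{[-r,r]}|f|$ and the integral projective tensor norms of $f^{[1]}|_{[-r,r]^2}$ and $f^{[2]}|_{[-r,r]^3}$ are finite. * *Functional calculus.* For a self-adjoint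 bounded operator $a$ with projection-valued spectral measure $P^a$ on $\sigma(a)$ and bounded Borel $\psi:\sigma(a)\to\mathbb C$, $\psi(a)=\int\psi\,dP^a$; write $\varphi_j(a,\sigma)=\varphi_j(\cdot,\sigma)(a)$. * *Pointwise Pettis integrals.* If $(\Sigma,\rho)$ is a measure space and $K$ is a Hilbert space, then $F:\Sigma\to B(K)$ is pointwise Pettis integrable with integral $T=\int_\Sigma F\,d\rho\in B(K)$ if for all $h_1,h_2\in K$ the function $\langle F(\cdot)h_1,h_2\rangle$ is measurable and $\rho$-integrable with integral $\langle Th_1,h_2\rangle$. * *Multiple operator integrals (MOIs).* For self-adjoint $a_1,\dots,a_{k+1}\in B(K)$, bounded operators $b_1,\dots,b_k$ on $K$ and $\varphi:\sigma(a_1)\times\cdots\times\sigma(a_{k+1})\to\mathbb C$ that has an IPD, $$(I^{a_1,\dots,a_{k+1}}\varphi)[b_1,\dots,b_k]=\int_\Sigma\varphi_1(a_1,\sigma)\,b_1\cdots\varphi_k(a_k,\sigma)\,b_k\,\varphi_{k+1}(a_{k+1},\sigma)\,\rho(d\sigma)$$ is a pointwise Pettis integral; it does not depend on the IPD $(\Sigma,\rho,\varphi_1,\dots,\varphi_{k+1})$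 of $\varphi$. If $\mu$ is a Borel complex measure on a Polish space $\Lambda$ and $\varphi:\sigma(a_1)\times\Lambda\times\sigma(a_2)\to\mathbb C$ has an IPD, put $$\int_{\sigma(a_2)}\int_\Lambda\int_{\sigma(a_1)}\varphi(\lambda_1,\lambda_2,\lambda_3)\,P^{a_1}(d\lambda_1)\,b_1\,\mu(d\lambda_2)\,b_2\,P^{a_2}(d\lambda_3):=(I^{a_1,a_2}\varphi^\mu)[b_1b_2],\qquad\varphi^\mu(\lambda_1,\lambda_3)=\int_\Lambda\varphi(\lambda_1,\lambda_2,\lambda_3)\,\mu(d\lambda_2).$$ * *The element $\Delta_{u,v}f(m)$.* For $f\in\mathcal C^{[2]}(\mathbb R)$, self-adjoint $m\in\mathcal A$ and $u,v\in\mathcal A\otimes\mathcal A^{\mathrm{op}}$, it is the unique element of $\mathcal A$ such that, for all $a\in\mathcal A$, $$\tau\big(a\,\Delta_{u,v}f(m)\big)=(\tau\bar\otimes\tau^{\mathrm{op}})\Big((a\otimes1)\,\big(I^{m\otimes1,\,1\otimes m,\,m\otimes1}f^{[2]}\big)\big[uv^{\mathrm{flip}}+vu^{\mathrm{flip}},\,1\otimes1\big]\Big).$$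 * *The map $\mathcal M_\tau$.* $\mathcal M_\tau:\mathcal A\otimes\mathcal A^{\mathrm{op}}\otimes\mathcal A\to\mathcal A$ is the linear map with $\mathcal M_\tau(a\otimes b\otimes c)=a\,\tau(b)\,c$; below, $\cdot$ is the multiplication of $\mathcal A\otimes\mathcal A^{\mathrm{op}}\otimes\mathcal A$, and for $u=\sum_ia_i\otimes b_i\in\mathcal A\otimes\mathcal A^{\mathrm{op}}$ we write $u\otimes1=\sum_ia_i\otimes b_i\otimes1$ and $1\otimes u=\sum_i1\otimes a_i\otimes b_i$. **Theorem.** Let $f\in\mathcal C^{[2]}(\mathbb R)$ and let $m\in\mathcal A$ be self-adjoint. (1) Let $(\Sigma,\rho,\varphi_1,\varphi_2,\varphi_3)$ be any $\ell^\infty$-IPD of $f^{[2]}$ on $\sigma(m)^3$. Then, for all $u,v\in\mathcal A\otimes\mathcal A^{\mathrm{op}}$, $$\begin{aligned}\Delta_{u,v}f(m)=\int_\Sigma\mathcal M_\tau\Big(&(1\otimes v)\cdot\big(\varphi_1(m,\sigma)\otimes\varphi_2(m,\sigma)\otimes\varphi_3(m,\sigma)\big)\cdot(u\otimes1)\\&+(1\otimes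 u)\cdot\big(\varphi_1(m,\sigma)\otimes\varphi_2(m,\sigma)\otimes\varphi_3(m,\sigma)\big)\cdot(v\otimes1)\Big)\,\rho(d\sigma),\end{aligned}$$ where the integrand is pointwise Pettis integrable and the integral is a pointwise Pettis integral in $\mathcal A\subseteq B(L^2(\mathcal A,\tau))$. (2) For all $a,b,c,d\in\mathcal A$, $\mu(d\lambda)=\tau(b\,P^m(d\lambda)\,c)$ and $\nu(d\lambda)=\tau(d\,P^m(d\lambda)\,a)$ are Borel complex measures on $\sigma(m)$, and $$\begin{aligned}\Delta_{a\otimes b,\,c\otimes d}f(m)={}&\int_{\sigma(m)}\int_{\sigma(m)}\int_{\sigma(m)}f^{[2]}(\lambda_1,\lambda_2,\lambda_3)\,P^m(d\lambda_1)\,a\,\mu(d\lambda_2)\,d\,P^m(d\lambda_3)\\&+\int_{\sigma(m)}\int_{\sigma(m)}\int_{\sigma(m)}f^{[2]}(\lambda_1,\lambda_2,\lambda_3)\,P^m(d\lambda_1)\,c\,\nu(d\lambda_2)\,b\,P^m(d\lambda_3).\end{aligned}$$ -/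

import Mathlib

open MeasureTheory MulOpposite
open scoped ComplexOrder TensorProduct InnerProductSpace ENNReal CompactlySupported Topology

universe u w

namespace FreeIto

/-! ### Divided differences -/

/-- The recursive formula
`f^{[k]}(x_1,…,x_{k+1}) = (f^{[k-1]}(x_1,…,x_k) - f^{[k-1]}(x_1,…,x_{k-1},x_{k+1})) / (x_k - x_{k+1})`,
which is meaningful at tuples with pairwise distinct entries. -/
noncomputable def divDiffDistinct (f : ℝ → ℂ) : (k : ℕ) → (Fin (k + 1) → ℝ) → ℂ
  | 0, x => f (x 0)
  | k + 1, x =>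
      (divDiffDistinct f k ((Fin.last (k + 1)).removeNth x)
        - divDiffDistinct f k ((Fin.last k).castSucc.removeNth x))
        / ((x (Fin.last k).castSucc - x (Fin.last (k + 1)) : ℝ) : ℂ)

/-- The `k`-th divided difference `f^{[k]} : ℝ^{k+1} → ℂ` of a `C^k` function `f`: the extension by
continuity (limits along tuples with pairwise distinct entries) of the recursive formula. -/
noncomputable def divDiff (f : ℝ → ℂ) (k : ℕ) : (Fin (k + 1) → ℝ) → ℂ :=
  extendFrom {x | Function.Injective x} (divDiffDistinct f k)

/-! ### Integral projective decompositions and the space `𝒞^{[k]}(ℝ)` -/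

/-- An `ℓ^∞`-integral projective decomposition `(S, ρ, φ_1, …, φ_n)` of a function
`φ : Ω_1 × ⋯ × Ω_n → ℂ`: a `σ`-finite measure space `(S, ρ)` and product measurable functions
`φ_j : Ω_j × S → ℂ`, bounded in the first variable, with
`∫_S ‖φ_1(·,s)‖_∞ ⋯ ‖φ_n(·,s)‖_∞ ρ(ds) < ∞` and
`φ(ω) = ∫_S φ_1(ω_1,s) ⋯ φ_n(ω_n,s) ρ(ds)` for all `ω`. -/
structure IPD {n : ℕ} {Ω : Fin n → Type*} [∀ j, MeasurableSpace (Ω j)]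
    (φ : (∀ j, Ω j) → ℂ) where
  S : Type w
  [mS : MeasurableSpace S]
  ρ : Measure S
  [sigmaFinite : SigmaFinite ρ]
  comp : ∀ j, Ω j → S → ℂ
  measurable_comp : ∀ j, Measurable (Function.uncurry (comp j))
  bounded_comp : ∀ j s, ∃ C : ℝ, ∀ ω, ‖comp j ω s‖ ≤ C
  lintegral_lt_top : ∫⁻ s, ∏ j, (⨆ ω, ‖comp j ω s‖ₑ) ∂ρ < ∞
  eq_integral : ∀ ω, φ ω = ∫ s, ∏ j, comp j (ω j) s ∂ρ

attribute [instance] IPD.mS IPD.sigmaFinite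

/-- The integral projective tensor norm of `φ`: the infimum of
`∫_S ‖φ_1(·,s)‖_∞ ⋯ ‖φ_n(·,s)‖_∞ ρ(ds)` over all decompositions of `φ` (`∞` if there is none). -/
noncomputable def iptpNorm {n : ℕ} {Ω : Fin n → Type*} [∀ j, MeasurableSpace (Ω j)]
    (φ : (∀ j, Ω j) → ℂ) : ℝ≥0∞ :=
  ⨅ D : IPD.{0} φ, ∫⁻ s, ∏ j, (⨆ ω, ‖D.comp j ω s‖ₑ) ∂D.ρ

/-- `‖f^{[j]}‖_{r,j+1}`: the supremum norm on `[-r,r]` for `j = 0`, and the integral projective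
tensor norm of the restriction of `f^{[j]}` to `[-r,r]^{j+1}` for `j ≥ 1`. -/
noncomputable def divDiffNorm (f : ℝ → ℂ) (r : ℝ) : ℕ → ℝ≥0∞
  | 0 => ⨆ x : Set.Icc (-r) r, ‖f x‖ₑ
  | j + 1 => iptpNorm (Ω := fun _ : Fin (j + 2) => Set.Icc (-r) r)
      (fun x => divDiff f (j + 1) (fun i => (x i : ℝ)))

/-- The space `𝒞^{[k]}(ℝ)` of `C^k` functions `f : ℝ → ℂ` with
`∑_{j ≤ k} ‖f^{[j]}‖_{r,j+1} < ∞` for every `r > 0`. -/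
def SuperC (k : ℕ) : Set (ℝ → ℂ) :=
  {f | ContDiff ℝ k f ∧ ∀ r : ℝ, 0 < r → ∑ j ∈ Finset.range (k + 1), divDiffNorm f r j < ∞}

section Operators

variable {H : Type*} [NormedAddCommGroup H] [InnerProductSpace ℂ H] [CompleteSpace H]

/-! ### Pointwise Pettis integrals -/

/-- `F : S → B(H)` is pointwise Pettis integrable with integral `T`. -/
def IsPettisIntegral {S : Type*} [MeasurableSpace S] (ρ : Measure S) (F : S → H →L[ℂ] H)
    (T : H →L[ℂ] H) : Prop :=
  ∀ h₁ h₂ : H, Measurable (fun s => ⟪h₂, F s h₁⟫_ℂ) ∧ Integrable (fun s => ⟪h₂, F s h₁⟫_ℂ) ρ ∧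
    ⟪h₂, T h₁⟫_ℂ = ∫ s, ⟪h₂, F s h₁⟫_ℂ ∂ρ

open Classical in
/-- The pointwise Pettis integral `∫_S F dρ` (and `0` if `F` is not pointwise Pettis integrable). -/
noncomputable def pettisIntegral {S : Type*} [MeasurableSpace S] (ρ : Measure S)
    (F : S → H →L[ℂ] H) : H →L[ℂ] H :=
  if h : ∃ T, IsPettisIntegral ρ F T then h.choose else 0

/-! ### Bounded Borel functional calculus and spectral measures -/

/-- The positive functional `g ↦ ⟨g(a) h, h⟩` on the (compactly supported) continuous functions on
the spectrum of a self-adjoint operator `a`. -/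
noncomputable def spectralFunctional (a : H →L[ℂ] H) (ha : IsSelfAdjoint a) (h : H) :
    C_c(spectrum ℝ a, ℝ) →ₚ[ℝ] ℝ :=
  PositiveLinearMap.mk₀
    { toFun := fun g => (⟪h, cfcHom ha g.toContinuousMap h⟫_ℂ).re
      map_add' := fun g₁ g₂ => by
        have : (g₁ + g₂).toContinuousMap = g₁.toContinuousMap + g₂.toContinuousMap := rfl
        rw [this, map_add]
        simp
      map_smul' := fun c g => by
        have : (c • g).toContinuousMap = c • g.toContinuousMap := rfl
        rw [this, map_smul]
        simp [inner_smul_right_eq_smul] }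
    (fun g hg => by
      have h0 : (0 : H →L[ℂ] H) ≤ cfcHom ha g.toContinuousMap :=
        cfcHom_nonneg_iff ha |>.2 (fun x => hg x)
      have := ((ContinuousLinearMap.nonneg_iff_isPositive _).1 h0).re_inner_nonneg_right h
      simpa using this)

open Classical in
/-- The scalar spectral measure `P^a_{h,h}` of a self-adjoint operator `a` on its spectrum: the
(Riesz–Markov–Kakutani) measure `μ` with `∫ g dμ = ⟨g(a) h, h⟩` for all continuous `g`. -/
noncomputable def spectralMeasure (a : H →L[ℂ] H) (h : H) : Measure (spectrum ℝ a) :=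
  if ha : IsSelfAdjoint a then RealRMK.rieszMeasure (spectralFunctional a ha h) else 0

open Classical in
/-- Bounded Borel functional calculus of a self-adjoint operator `a`: for bounded Borel
`φ : σ(a) → ℂ`, the unique operator `φ(a) = ∫ φ dP^a` with `⟨φ(a) h, h⟩ = ∫ φ dP^a_{h,h}`
for all `h`. -/
noncomputable def borelFC (a : H →L[ℂ] H) (φ : spectrum ℝ a → ℂ) : H →L[ℂ] H :=
  if h : ∃ T : H →L[ℂ] H, ∀ x : H, ⟪x, T x⟫_ℂ = ∫ l, φ l ∂(spectralMeasure a x)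
  then h.choose else 0

open Classical in
/-- The bounded Borel functional calculus of an element of a von Neumann algebra `M`, as an element
of `M` (where `φ(m)` always lies). -/
noncomputable def borelFCMem {M : VonNeumannAlgebra H} (m : M)
    (φ : spectrum ℝ (m : H →L[ℂ] H) → ℂ) : M :=
  if h : borelFC (m : H →L[ℂ] H) φ ∈ M then ⟨borelFC (m : H →L[ℂ] H) φ, h⟩ else 0

/-- The projection-valued spectral measure `P^m(B) = 1_B(m) ∈ M`. -/
noncomputable def specProj {M : VonNeumannAlgebra H} (m : M)
    (B : Set (spectrum ℝ (m : H →L[ℂ] H))) : M :=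
  borelFCMem m (B.indicator 1)

/-! ### Multiple operator integrals -/

/-- The integrand `s ↦ φ_1(a_1,s) b_1 ⋯ φ_k(a_k,s) b_k φ_{k+1}(a_{k+1},s)`. -/
noncomputable def moiIntegrand {k : ℕ} (a : Fin (k + 1) → H →L[ℂ] H)
    {φ : (∀ j, spectrum ℝ (a j)) → ℂ} (D : IPD.{w} φ) (b : Fin k → H →L[ℂ] H) (s : D.S) :
    H →L[ℂ] H :=
  (List.ofFn fun j : Fin k =>
    borelFC (a j.castSucc) (fun l => D.comp j.castSucc l s) * b j).prod
    * borelFC (a (Fin.last k)) (fun l => D.comp (Fin.last k) l s)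

open Classical in
/-- The multiple operator integral
`(I^a φ)[b] = ∫ ⋯ ∫ φ(λ) P^{a_1}(dλ_1) b_1 ⋯ P^{a_k}(dλ_k) b_k P^{a_{k+1}}(dλ_{k+1})`, computed from
an (any) integral projective decomposition of `φ`. -/
noncomputable def moi {k : ℕ} (a : Fin (k + 1) → H →L[ℂ] H)
    (φ : (∀ j, spectrum ℝ (a j)) → ℂ) (b : Fin k → H →L[ℂ] H) : H →L[ℂ] H :=
  if h : Nonempty (IPD.{0} φ) then pettisIntegral h.some.ρ (moiIntegrand a h.some b) else 0

/-- The triple multiple operator integral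
`∫∫∫ φ(λ_1,λ_2,λ_3) P^{a_1}(dλ_1) b_1 μ(dλ_2) b_2 P^{a_2}(dλ_3)` with a scalar complex measure `μ`
in the middle slot, i.e. `(I^{a_1,a_2} φ^μ)[b_1 b_2]` with
`φ^μ(λ_1,λ_3) = ∫ φ(λ_1,λ_2,λ_3) μ(dλ_2)`. -/
noncomputable def tripleMOI {Λ : Type*} [MeasurableSpace Λ] (a₁ a₂ : H →L[ℂ] H)
    (φ : spectrum ℝ a₁ → Λ → spectrum ℝ a₂ → ℂ) (b₁ : H →L[ℂ] H) (μ : ComplexMeasure Λ)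
    (b₂ : H →L[ℂ] H) : H →L[ℂ] H :=
  moi ![a₁, a₂]
    (fun x => μ.integral (fun l => φ (x 0) l (x 1)) (ContinuousLinearMap.mul ℝ ℂ))
    ![b₁ * b₂]

end Operators

/-! ### Algebraic tensor products -/

section Algebraic

variable {A : Type*} [Ring A] [Algebra ℂ A]

/-- The algebraic tensor product `A ⊗ A^op`. -/
abbrev BiTensor (A : Type*) [Ring A] [Algebra ℂ A] : Type _ := A ⊗[ℂ] Aᵐᵒᵖ

/-- The algebraic tensor product `A ⊗ A^op ⊗ A`. -/
abbrev TriTensor (A : Type*) [Ring A] [Algebra ℂ A] : Type _ := A ⊗[ℂ] (Aᵐᵒᵖ ⊗[ℂ] A)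

/-- `a ⊗ b ∈ A ⊗ A^op`. -/
def pureTensor (a b : A) : BiTensor A := a ⊗ₜ[ℂ] op b

/-- The linear map `(a ⊗ b)^flip = b ⊗ a` on `A ⊗ A^op`. -/
noncomputable def flip : BiTensor A →ₗ[ℂ] BiTensor A :=
  (TensorProduct.map (opLinearEquiv ℂ).symm.toLinearMap (opLinearEquiv ℂ).toLinearMap) ∘ₗ
    (TensorProduct.comm ℂ A Aᵐᵒᵖ).toLinearMap

/-- `u ↦ u ⊗ 1`, i.e. `a ⊗ b ↦ a ⊗ b ⊗ 1`. -/
noncomputable def tensorOne : BiTensor A →ₗ[ℂ] TriTensor A :=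
  TensorProduct.map LinearMap.id ((TensorProduct.mk ℂ Aᵐᵒᵖ A).flip 1)

/-- `v ↦ 1 ⊗ v`, i.e. `a ⊗ b ↦ 1 ⊗ a ⊗ b`. -/
noncomputable def oneTensor : BiTensor A →ₗ[ℂ] TriTensor A :=
  (TensorProduct.mk ℂ A (Aᵐᵒᵖ ⊗[ℂ] A) 1) ∘ₗ
    TensorProduct.map (opLinearEquiv ℂ).toLinearMap (opLinearEquiv ℂ).symm.toLinearMap

/-- `ℳ_τ(a ⊗ b ⊗ c) = a τ(b) c = τ(b) a c`. -/
noncomputable def trMul (τ : A →ₗ[ℂ] ℂ) : TriTensor A →ₗ[ℂ] A :=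
  LinearMap.mul' ℂ A ∘ₗ
    TensorProduct.map LinearMap.id
      ((TensorProduct.lid ℂ A).toLinearMap ∘ₗ
        TensorProduct.map (τ ∘ₗ (opLinearEquiv ℂ).symm.toLinearMap) LinearMap.id)

/-- `ℳ_τ((1 ⊗ v) · (x ⊗ y ⊗ z) · (u ⊗ 1) + (1 ⊗ u) · (x ⊗ y ⊗ z) · (v ⊗ 1))`, with the
multiplication of `A ⊗ A^op ⊗ A`. -/
noncomputable def trMulSymm (τ : A →ₗ[ℂ] ℂ) (u v : BiTensor A) (x y z : A) : A :=
  trMul τ (oneTensor v * (x ⊗ₜ[ℂ] (op y ⊗ₜ[ℂ] z)) * tensorOne u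
    + oneTensor u * (x ⊗ₜ[ℂ] (op y ⊗ₜ[ℂ] z)) * tensorOne v)

theorem trMulSymm_pureTensor (τ : A →ₗ[ℂ] ℂ) (a b c d x y z : A) :
    trMulSymm τ (pureTensor a b) (pureTensor c d) x y z
      = τ (b * y * c) • (x * a * d * z) + τ (d * y * a) • (x * c * b * z) := by
  simp [trMulSymm, trMul, oneTensor, tensorOne, pureTensor, mul_assoc]

end Algebraic

/-! ### `W*`-probability spaces and their standard representation -/

section VonNeumann

variable {H : Type*} [NormedAddCommGroup H] [InnerProductSpace ℂ H] [CompleteSpace H]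

instance instIsClosedVN (M : VonNeumannAlgebra H) : IsClosed (M : Set (H →L[ℂ] H)) := by
  rw [← M.centralizer_centralizer]
  exact Set.isClosed_centralizer _

instance instSMulMemClassVN : SMulMemClass (VonNeumannAlgebra H) ℂ (H →L[ℂ] H) where
  smul_mem {s} c _ hx := s.toStarSubalgebra.smul_mem hx c

noncomputable instance instCStarAlgebraVN (M : VonNeumannAlgebra H) : CStarAlgebra M :=
  StarSubalgebra.cstarAlgebra M

/-- The order of `M` induced by the order of `B(H)` is the order of `M` as a `C*`-algebra. -/
instance instStarOrderedRingVN (M : VonNeumannAlgebra H) : StarOrderedRing M := by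
  refine StarOrderedRing.of_nonneg_iff' (fun {x y} hxy z => ?_) (fun x => ⟨fun hx => ?_, ?_⟩)
  · exact add_le_add_right (α := H →L[ℂ] H) hxy z
  · have hx' : 0 ≤ (x : H →L[ℂ] H) := hx
    have hs : CFC.sqrt (x : H →L[ℂ] H) ∈ M := by
      rw [← SetLike.mem_coe, ← M.centralizer_centralizer, Set.mem_centralizer_iff]
      intro y hy
      have hc : Commute (x : H →L[ℂ] H) y := hy x x.2
      have := hc.cfcₙ_nnreal NNReal.sqrt
      exact this.symm
    refine ⟨⟨_, hs⟩, Subtype.ext ?_⟩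
    have hsa : star (CFC.sqrt (x : H →L[ℂ] H)) = CFC.sqrt (x : H →L[ℂ] H) :=
      (IsSelfAdjoint.of_nonneg (CFC.sqrt_nonneg _)).star_eq
    change (x : H →L[ℂ] H) = star (CFC.sqrt (x : H →L[ℂ] H)) * CFC.sqrt (x : H →L[ℂ] H)
    rw [hsa, CFC.sqrt_mul_sqrt_self _ hx']
  · rintro ⟨s, rfl⟩
    exact star_mul_self_nonneg (s : H →L[ℂ] H)

/-- A trace on a von Neumann algebra `M ⊆ B(H)`: a tracial faithful normal state. Normality, i.e.
`σ`-weak continuity, is expressed through the form of the `σ`-weakly continuous functionals,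
`a ↦ ∑ₙ ⟨a hₙ, kₙ⟩` with `∑ₙ ‖hₙ‖² < ∞` and `∑ₙ ‖kₙ‖² < ∞`. A pair `(M, τ)` is a
`W*`-probability space. -/
structure VNTrace (M : VonNeumannAlgebra H) where
  toLinearMap : M →ₗ[ℂ] ℂ
  map_one : toLinearMap 1 = 1
  map_star_mul_self_nonneg : ∀ a, 0 ≤ toLinearMap (star a * a)
  map_mul_comm : ∀ a b, toLinearMap (a * b) = toLinearMap (b * a)
  faithful : ∀ a, toLinearMap (star a * a) = 0 → a = 0
  normal : ∃ h k : ℕ → H, (Summable fun n => ‖h n‖ ^ 2) ∧ (Summable fun n => ‖k n‖ ^ 2) ∧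
    ∀ a : M, HasSum (fun n => ⟪k n, (a : H →L[ℂ] H) (h n)⟫_ℂ) (toLinearMap a)

namespace VNTrace

variable {M : VonNeumannAlgebra H} (τ : VNTrace M)

/-- `τ` as a positive functional on `M`. -/
noncomputable def pos : M →ₚ[ℂ] ℂ :=
  PositiveLinearMap.mk₀ τ.toLinearMap (fun x hx => by
    obtain ⟨s, rfl⟩ := CStarAlgebra.nonneg_iff_eq_star_mul_self.1 hx
    exact τ.map_star_mul_self_nonneg s)

/-- The induced trace `τ^op` on `M^op`, as a positive functional. -/
noncomputable def posOp : (M)ᵐᵒᵖ →ₚ[ℂ] ℂ :=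
  PositiveLinearMap.mk₀ (τ.toLinearMap ∘ₗ (opLinearEquiv ℂ).symm.toLinearMap) (fun x hx => by
    obtain ⟨s, hs⟩ := CStarAlgebra.nonneg_iff_eq_star_mul_self.1 (unop_nonneg.2 hx)
    have : (τ.toLinearMap ∘ₗ (opLinearEquiv ℂ).symm.toLinearMap) x
        = τ.toLinearMap (unop x) := rfl
    rw [this, hs]
    exact τ.map_star_mul_self_nonneg s)

/-- `L²(M, τ)`: the completion of `M` for `⟨a, b⟩ = τ(b^* a)`. -/
abbrev L2 : Type _ := τ.pos.GNS

/-- `L²(M^op, τ^op)`. -/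
abbrev L2op : Type _ := τ.posOp.GNS

/-- The standard representation of `M` on `L²(M, τ)` by left multiplication. -/
noncomputable abbrev rep (a : M) : τ.L2 →L[ℂ] τ.L2 := τ.pos.gnsStarAlgHom a

/-- The standard representation of `M^op` on `L²(M^op, τ^op)` by left multiplication in `M^op`. -/
noncomputable abbrev repOp (b : (M)ᵐᵒᵖ) : τ.L2op →L[ℂ] τ.L2op := τ.posOp.gnsStarAlgHom b

/-- The Hilbert space tensor product `L²(M, τ) ⊗₂ L²(M^op, τ^op)`, on which the von Neumann algebra
tensor product `M ⊗̄ M^op` acts. -/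
abbrev L2tensor : Type _ := UniformSpace.Completion (τ.L2 ⊗[ℂ] τ.L2op)

/-- The operator `(h ⊗ k) ↦ a h ⊗ b k` on `L²(M, τ) ⊗₂ L²(M^op, τ^op)`. -/
noncomputable def opTensor (a : M) (b : (M)ᵐᵒᵖ) : τ.L2tensor →L[ℂ] τ.L2tensor :=
  (TensorProduct.mapL (τ.rep a) (τ.repOp b)).completion

theorem opTensor_coe (a : M) (b : (M)ᵐᵒᵖ) (x : τ.L2 ⊗[ℂ] τ.L2op) :
    τ.opTensor a b (x : τ.L2tensor)
      = ((TensorProduct.mapL (τ.rep a) (τ.repOp b) x : τ.L2 ⊗[ℂ] τ.L2op) : τ.L2tensor) := by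
  simp [opTensor]

theorem clm_ext {X Y : τ.L2tensor →L[ℂ] τ.L2tensor}
    (h : ∀ x : τ.L2 ⊗[ℂ] τ.L2op, X (x : τ.L2tensor) = Y (x : τ.L2tensor)) : X = Y := by
  ext z
  induction z using UniformSpace.Completion.induction_on with
  | hp => exact isClosed_eq X.continuous Y.continuous
  | ih x => exact h x

/-- The inclusion `M ⊗ M^op ⊆ M ⊗̄ M^op ⊆ B(L²(M, τ) ⊗₂ L²(M^op, τ^op))`. -/
noncomputable def tensorRep : BiTensor M →ₗ[ℂ] (τ.L2tensor →L[ℂ] τ.L2tensor) :=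
  TensorProduct.lift (LinearMap.mk₂ ℂ τ.opTensor
    (fun a a' b => τ.clm_ext fun x => by
      simp [opTensor_coe, rep, repOp, TensorProduct.mapL_add_left, UniformSpace.Completion.coe_add,
        -TensorProduct.mapL_apply, -PositiveLinearMap.gnsStarAlgHom_apply])
    (fun c a b => τ.clm_ext fun x => by
      simp [opTensor_coe, rep, repOp, TensorProduct.mapL_smul_left,
        UniformSpace.Completion.coe_smul,
        -TensorProduct.mapL_apply, -PositiveLinearMap.gnsStarAlgHom_apply])
    (fun a b b' => τ.clm_ext fun x => by
      simp [opTensor_coe, rep, repOp, TensorProduct.mapL_add_right, UniformSpace.Completion.coe_add,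
        -TensorProduct.mapL_apply, -PositiveLinearMap.gnsStarAlgHom_apply])
    (fun c a b => τ.clm_ext fun x => by
      simp [opTensor_coe, rep, repOp, TensorProduct.mapL_smul_right,
        UniformSpace.Completion.coe_smul,
        -TensorProduct.mapL_apply, -PositiveLinearMap.gnsStarAlgHom_apply]))

/-- The tensor product trace `τ ⊗̄ τ^op` on `M ⊗̄ M^op`: the vector state of `1 ⊗ 1`. -/
noncomputable def tensorTrace (X : τ.L2tensor →L[ℂ] τ.L2tensor) : ℂ :=
  let e : τ.L2tensor :=
    (((τ.pos.toPreGNS 1 : τ.pos.PreGNS) : τ.L2) ⊗ₜ[ℂ]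
      ((τ.posOp.toPreGNS 1 : τ.posOp.PreGNS) : τ.L2op) : τ.L2 ⊗[ℂ] τ.L2op)
  ⟪e, X e⟫_ℂ

/-! ### The element `Δ_{u,v} f(m)` -/

/-- `X` satisfies the equation that determines `Δ_{u,v} f(m)`: for all `a ∈ M`,
`τ(a X) = (τ ⊗̄ τ^op)((a ⊗ 1) (I^{m ⊗ 1, 1 ⊗ m, m ⊗ 1} f^{[2]})[u v^flip + v u^flip, 1 ⊗ 1])`. -/
def IsDelta (f : ℝ → ℂ) (m : M) (u v : BiTensor M) (X : M) : Prop :=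
  ∀ a : M, τ.toLinearMap (a * X) =
    τ.tensorTrace (τ.tensorRep (pureTensor a 1) *
      moi ![τ.tensorRep (pureTensor m 1), τ.tensorRep (pureTensor 1 m),
          τ.tensorRep (pureTensor m 1)]
        (fun l => divDiff f 2 (fun j => (l j : ℝ)))
        ![τ.tensorRep (u * flip v + v * flip u), τ.tensorRep (pureTensor 1 1)])

open Classical in
/-- `Δ_{u,v} f(m)`, for `f ∈ 𝒞^{[2]}(ℝ)`, `m ∈ M` self-adjoint and `u, v ∈ M ⊗ M^op`: the unique
element of `M` satisfying the determining equation. -/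
noncomputable def delta (f : ℝ → ℂ) (m : M) (u v : BiTensor M) : M :=
  if h : ∃ X, τ.IsDelta f m u v X then h.choose else 0

end VNTrace
end VonNeumann
end FreeIto

/-! For `u = a ⊗ b` and `v = c ⊗ d` the integrand of (1) is `τ(b φ₂(m,σ) c) φ₁(m,σ) a d φ₃(m,σ)`
plus the term with `u` and `v` exchanged: the middle factor enters only through a scalar. Absorbing
that scalar into `φ₃` leaves a double operator integral whose symbol `(λ₁, λ₃) ↦ ∫ f^[2](λ₁, λ₂, λ₃)
τ(b P^m(dλ₂) c)` depends on `f^[2]` alone (`IsTriple.integral_weight`). So (2) follows from (1), and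
both rest on the fact that a double operator integral depends only on its symbol
(`IsDecomp.integral_eq`).

For that fact, note that against a rank one operator the integral is, by Fubini, an iterated
functional calculus of the symbol (`integral_inner_mul_inner`), and finite rank operators follow by
linearity. A general `b` is replaced by `b Pₙ`, where `Pₙ` projects onto finite-dimensional
subspaces that exhaust the separable set of vectors occurring in the integrand; dominated
convergence then lets `n → ∞`.

For (1), `Δ` is fixed by a trace identity on `L² ⊗₂ L²`, where the operator integral is computed
from some decomposition over the spectra of `m ⊗ 1` and `1 ⊗ m`. The maps `a ↦ a ⊗ 1`, `b ↦ 1 ⊗ b`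
and the standard representation intertwine the bounded Borel calculi, by normality (`map_bfcM`), and
are injective, by faithfulness, so they preserve spectra (`spectrum_map_eq`); the decomposition is
thus one over `σ(m)³`. Traciality rewrites the integrand as `τ(a ℳ_τ(…))` (`trace_integrand`),
normality moves `τ` through the Pettis integral (`VNTrace.trace_pettis`), and faithfulness
identifies `Δ` with the integral for this one decomposition. Independence of the decomposition gives
all others.

The functional calculus is built from scalar spectral measures, and its properties spread from
continuous functions to all bounded Borel functions through bounded pointwise limits. The suprema `s
↦ ‖φ_j(·,s)‖_∞` need not be measurable, so every domination argument goes through a measurable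
minorant with the same lower integral (`exists_integrable_majorant`). -/

namespace FreeIto

set_option linter.unusedSectionVars false

/-! ### Bounded Borel functions -/

section BddMeas

/-- Bounded measurable complex functions. -/
def BddMeas {X : Type*} [MeasurableSpace X] (φ : X → ℂ) : Prop :=
  Measurable φ ∧ ∃ C : ℝ, ∀ x, ‖φ x‖ ≤ C

variable {X : Type*} [MeasurableSpace X]

theorem BddMeas.add {φ ψ : X → ℂ} (hφ : BddMeas φ) (hψ : BddMeas ψ) : BddMeas (φ + ψ) := by
  obtain ⟨h1, C, hC⟩ := hφ
  obtain ⟨h2, D, hD⟩ := hψ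
  exact ⟨h1.add h2, C + D, fun x => (norm_add_le _ _).trans (add_le_add (hC x) (hD x))⟩

theorem BddMeas.mul {φ ψ : X → ℂ} (hφ : BddMeas φ) (hψ : BddMeas ψ) : BddMeas (φ * ψ) := by
  obtain ⟨h1, C, hC⟩ := hφ
  obtain ⟨h2, D, hD⟩ := hψ
  refine ⟨h1.mul h2, C * D, fun x => ?_⟩
  rw [Pi.mul_apply, norm_mul]
  exact mul_le_mul (hC x) (hD x) (norm_nonneg _) ((norm_nonneg _).trans (hC x))

theorem BddMeas.smul {φ : X → ℂ} (hφ : BddMeas φ) (c : ℂ) : BddMeas (c • φ) := by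
  obtain ⟨h1, C, hC⟩ := hφ
  refine ⟨h1.const_smul c, ‖c‖ * C, fun x => ?_⟩
  rw [Pi.smul_apply, norm_smul]
  exact mul_le_mul_of_nonneg_left (hC x) (norm_nonneg _)

theorem BddMeas.star {φ : X → ℂ} (hφ : BddMeas φ) : BddMeas (star φ) := by
  obtain ⟨h1, C, hC⟩ := hφ
  exact ⟨Complex.continuous_conj.measurable.comp h1, C, fun x => by simpa using hC x⟩

theorem bddMeas_const (c : ℂ) : BddMeas (fun _ : X => c) :=
  ⟨measurable_const, ‖c‖, fun _ => le_rfl⟩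

theorem bddMeas_indicator {s : Set X} (hs : MeasurableSet s) :
    BddMeas (s.indicator (1 : X → ℂ)) :=
  ⟨measurable_one.indicator hs, 1, fun x => by
    by_cases h : x ∈ s <;> simp [h]⟩

theorem bddMeas_simpleFunc (g : SimpleFunc X ℂ) : BddMeas g := by
  obtain ⟨C, hC⟩ := g.exists_forall_norm_le
  exact ⟨g.measurable, C, hC⟩

theorem BddMeas.integrable {φ : X → ℂ} (hφ : BddMeas φ) (μ : Measure X) [IsFiniteMeasure μ] :
    Integrable φ μ := by
  obtain ⟨h1, C, hC⟩ := hφ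
  exact Integrable.of_bound h1.aestronglyMeasurable C (ae_of_all _ hC)

/-- A property of bounded measurable functions that is closed under linear combinations and bounded
pointwise limits holds for all of them as soon as it holds for indicators. -/
theorem BddMeas.induction_indicator {P : (X → ℂ) → Prop}
    (hind : ∀ s, MeasurableSet s → P (s.indicator 1))
    (hadd : ∀ f g, BddMeas f → BddMeas g → P f → P g → P (f + g))
    (hsmul : ∀ (c : ℂ) f, BddMeas f → P f → P (c • f))
    (hlim : ∀ (F : ℕ → X → ℂ) (f : X → ℂ) (C : ℝ), (∀ n, Measurable (F n)) → Measurable f →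
      (∀ n x, ‖F n x‖ ≤ C) → (∀ x, Filter.Tendsto (fun n => F n x) Filter.atTop (𝓝 (f x))) →
      (∀ n, P (F n)) → P f)
    {φ : X → ℂ} (hφ : BddMeas φ) : P φ := by
  have hsimple : ∀ g : SimpleFunc X ℂ, P g := by
    intro g
    induction g using SimpleFunc.induction with
    | const c hs =>
      rename_i s
      have := hsmul c _ (bddMeas_indicator hs) (hind s hs)
      convert this using 1
      ext x
      by_cases h : x ∈ s <;> simp [h]
    | add hd h1 h2 =>
      exact hadd _ _ (bddMeas_simpleFunc _) (bddMeas_simpleFunc _) h1 h2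
  obtain ⟨h1, C, hC⟩ := hφ
  -- `approxOn` with base value `0` is bounded by twice the norm of the target, whence the uniform
  -- bound `C + C`.
  refine hlim (fun n => SimpleFunc.approxOn φ h1 Set.univ 0 (Set.mem_univ _) n) φ (C + C)
    (fun n => SimpleFunc.measurable _) h1 (fun n x => ?_) (fun x => ?_) (fun n => hsimple _)
  · exact (SimpleFunc.norm_approxOn_zero_le h1 (Set.mem_univ _) x n).trans
      (add_le_add (hC x) (hC x))
  · exact SimpleFunc.tendsto_approxOn h1 _ (by simp)

/-- Disjointness leaves at most one nonzero term at each point, so the partial sums are eventually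
constant and never exceed `1` in norm. -/
theorem tendsto_indicator_iUnion {f : ℕ → Set X} (hf : Pairwise (Function.onFun Disjoint f))
    (x : X) :
    Filter.Tendsto (fun n => ∑ i ∈ Finset.range n, (f i).indicator (1 : X → ℂ) x) Filter.atTop
      (𝓝 ((⋃ i, f i).indicator 1 x)) := by
  by_cases hx : x ∈ ⋃ i, f i
  · obtain ⟨i, hi⟩ := Set.mem_iUnion.1 hx
    refine tendsto_const_nhds.congr' ?_
    filter_upwards [Filter.eventually_gt_atTop i] with n hn
    rw [Finset.sum_eq_single_of_mem i (Finset.mem_range.2 hn), Set.indicator_of_mem hx,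
      Set.indicator_of_mem hi]
    · intro j _ hj
      exact Set.indicator_of_notMem (fun h => Set.disjoint_left.1 (hf hj) h hi) _
  · rw [Set.indicator_of_notMem hx]
    have : ∀ i, (f i).indicator (1 : X → ℂ) x = 0 := fun i =>
      Set.indicator_of_notMem (fun h => hx (Set.mem_iUnion.2 ⟨i, h⟩)) _
    simp [this]

theorem norm_sum_indicator_le {f : ℕ → Set X} (hf : Pairwise (Function.onFun Disjoint f)) (n : ℕ)
    (x : X) : ‖∑ i ∈ Finset.range n, (f i).indicator (1 : X → ℂ) x‖ ≤ 1 := by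
  by_cases hx : ∃ i ∈ Finset.range n, x ∈ f i
  · obtain ⟨i, hi, hxi⟩ := hx
    rw [Finset.sum_eq_single_of_mem i hi, Set.indicator_of_mem hxi]
    · simp
    · intro j _ hj
      exact Set.indicator_of_notMem (fun h => Set.disjoint_left.1 (hf hj) h hxi) _
  · push Not at hx
    rw [Finset.sum_eq_zero]
    · simp
    · intro i hi
      exact Set.indicator_of_notMem (hx i hi) _

/-- A property of bounded Borel functions that is closed under linear combinations and bounded
pointwise limits holds for all of them as soon as it holds for bounded continuous functions. -/
theorem BddMeas.induction_continuous [PseudoEMetricSpace X] [BorelSpace X] {P : (X → ℂ) → Prop}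
    (hcont : ∀ g : X → ℝ, Continuous g → (∃ C, ∀ x, |g x| ≤ C) → P (fun x => (g x : ℂ)))
    (hadd : ∀ f g, BddMeas f → BddMeas g → P f → P g → P (f + g))
    (hsmul : ∀ (c : ℂ) f, BddMeas f → P f → P (c • f))
    (hlim : ∀ (F : ℕ → X → ℂ) (f : X → ℂ) (C : ℝ), (∀ n, Measurable (F n)) → Measurable f →
      (∀ n x, ‖F n x‖ ≤ C) → (∀ x, Filter.Tendsto (fun n => F n x) Filter.atTop (𝓝 (f x))) →
      (∀ n, P (F n)) → P f)
    {φ : X → ℂ} (hφ : BddMeas φ) : P φ := by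
  have hone : P 1 := by
    have := hcont (fun _ => 1) continuous_const ⟨1, by simp⟩
    convert this using 1
    ext; simp
  have hzero : P 0 := by
    have := hcont (fun _ => 0) continuous_const ⟨0, by simp⟩
    convert this using 1
    ext; simp
  -- Closed sets form a π-system generating the Borel sets, and the indicator of a closed set is the
  -- bounded limit of its thickened indicators, which are continuous.
  refine BddMeas.induction_indicator (fun s hs => ?_) hadd hsmul hlim hφ
  induction s, hs using MeasurableSpace.induction_on_inter
    (BorelSpace.measurable_eq.trans (borel_eq_generateFrom_isClosed (α := X)))
    isPiSystem_isClosed with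
  | empty =>
    rw [Set.indicator_empty]
    exact hzero
  | basic t ht =>
    have ht : IsClosed t := by simpa using ht
    obtain ⟨δ, -, hδ, hδ0⟩ := exists_seq_strictAnti_tendsto (0 : ℝ)
    have key := thickenedIndicator_tendsto_indicator_closure hδ hδ0 t
    rw [ht.closure_eq] at key
    refine hlim (fun n x => ((thickenedIndicator (hδ n) t x : ℝ) : ℂ)) _ 1 (fun n => ?_)
      (measurable_one.indicator ht.measurableSet) (fun n x => ?_) (fun x => ?_) (fun n => ?_)
    · exact (Complex.continuous_ofReal.comp (NNReal.continuous_coe.comp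
        (thickenedIndicator (hδ n) t).continuous)).measurable
    · rw [Complex.norm_real, Real.norm_of_nonneg (NNReal.coe_nonneg _)]
      exact_mod_cast thickenedIndicator_le_one (hδ n) t x
    · have h1 := tendsto_pi_nhds.1 key x
      have h2 := (Complex.continuous_ofReal.comp NNReal.continuous_coe).tendsto _ |>.comp h1
      have h3 : (Complex.ofReal ∘ NNReal.toReal) (t.indicator (fun _ => 1) x)
          = t.indicator (1 : X → ℂ) x := by
        by_cases h : x ∈ t <;> simp [h]
      rw [h3] at h2
      exact h2
    · exact hcont _ (NNReal.continuous_coe.comp (thickenedIndicator (hδ n) t).continuous)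
        ⟨1, fun x => by
          rw [abs_of_nonneg (NNReal.coe_nonneg _)]
          exact_mod_cast thickenedIndicator_le_one (hδ n) t x⟩
  | compl t ht ih =>
    have := hadd _ _ (bddMeas_const 1) ((bddMeas_indicator ht).smul (-1)) hone
      (hsmul (-1) _ (bddMeas_indicator ht) ih)
    convert this using 1
    ext x
    by_cases h : x ∈ t <;> simp [h]
  | iUnion f hd hf ih =>
    refine hlim (fun n x => ∑ i ∈ Finset.range n, (f i).indicator (1 : X → ℂ) x) _ 1 (fun n => ?_)
      (measurable_one.indicator (MeasurableSet.iUnion hf)) (norm_sum_indicator_le hd)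
      (tendsto_indicator_iUnion hd) (fun n => ?_)
    · exact Finset.measurable_sum _ fun i _ => measurable_one.indicator (hf i)
    · have : (fun x => ∑ i ∈ Finset.range n, (f i).indicator (1 : X → ℂ) x)
          = ∑ i ∈ Finset.range n, (f i).indicator (1 : X → ℂ) := by
        ext x; simp
      rw [this]
      -- Additivity of `P` is available only for bounded measurable summands, so boundedness is
      -- carried through the induction.
      suffices BddMeas (∑ i ∈ Finset.range n, (f i).indicator (1 : X → ℂ)) ∧
        P (∑ i ∈ Finset.range n, (f i).indicator (1 : X → ℂ)) from this.2
      induction n with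
      | zero => exact ⟨bddMeas_const 0, by simpa using hzero⟩
      | succ n ihn =>
        have ihn := ihn (by ext x; simp)
        rw [Finset.sum_range_succ]
        exact ⟨ihn.1.add (bddMeas_indicator (hf n)),
          hadd _ _ ihn.1 (bddMeas_indicator (hf n)) ihn.2 (ih n)⟩

end BddMeas

/-! ### Domination by functions with finite (lower) integral -/

section Domination

variable {S : Type*} [MeasurableSpace S] {ρ : Measure S}

/-- Measurable functions bounded by a possibly non-measurable function `G` with finite integral have
a common integrable majorant. -/
theorem exists_integrable_majorant {G : S → ℝ≥0∞} (hG : ∫⁻ s, G s ∂ρ < ∞) :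
    ∃ g : S → ℝ, Integrable g ρ ∧ (∀ s, 0 ≤ g s) ∧ ∀ F : S → ℝ≥0∞, Measurable F → F ≤ G →
      (∀ s, F s ≠ ∞) → ∀ᵐ s ∂ρ, (F s).toReal ≤ g s := by
  obtain ⟨g, hgm, hgG, hg⟩ := exists_measurable_le_lintegral_eq (μ := ρ) G
  have hgfin : ∫⁻ s, g s ∂ρ ≠ ∞ := by rw [← hg]; exact hG.ne
  refine ⟨fun s => (g s).toReal, integrable_toReal_of_lintegral_ne_top hgm.aemeasurable hgfin,
    fun s => ENNReal.toReal_nonneg, fun F hF hFG hFtop => ?_⟩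
  -- `max F g` is measurable and still below `G`, so its integral cannot exceed that of `g`, which
  -- already attains the lower integral. As this is finite, `max F g = g` almost everywhere.
  have h1 : ∫⁻ s, max (F s) (g s) ∂ρ ≤ ∫⁻ s, g s ∂ρ := by
    rw [← hg]
    exact lintegral_mono fun s => max_le (hFG s) (hgG s)
  have h2 : g =ᵐ[ρ] fun s => max (F s) (g s) :=
    ae_eq_of_ae_le_of_lintegral_le (ae_of_all _ fun s => le_max_right _ _) hgfin
      (hF.max hgm).aemeasurable h1
  filter_upwards [h2, ae_lt_top hgm hgfin] with s hs hs'
  exact ENNReal.toReal_mono hs'.ne (by rw [hs]; exact le_max_left _ _)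

theorem exists_integrable_norm_majorant {G : S → ℝ≥0∞} (hG : ∫⁻ s, G s ∂ρ < ∞) :
    ∃ g : S → ℝ, Integrable g ρ ∧ (∀ s, 0 ≤ g s) ∧ ∀ (F : S → ℂ) (C : ℝ≥0∞), C ≠ ∞ →
      Measurable F → (∀ s, ‖F s‖ₑ ≤ C * G s) → ∀ᵐ s ∂ρ, ‖F s‖ ≤ C.toReal * g s := by
  obtain ⟨g, hg, hg0, h⟩ := exists_integrable_majorant hG
  refine ⟨g, hg, hg0, fun F C hC hF hFG => ?_⟩
  -- The majorant is applied to `C⁻¹ ‖F‖`, which makes sense only for `C ≠ 0`; for `C = 0` the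
  -- function `F` vanishes.
  rcases eq_or_ne C 0 with rfl | hC0
  · refine ae_of_all _ fun s => ?_
    have := hFG s
    simp only [zero_mul, nonpos_iff_eq_zero, enorm_eq_zero] at this
    simp [this]
  · have hpos : 0 < C.toReal := ENNReal.toReal_pos hC0 hC
    have := h (fun s => C⁻¹ * ‖F s‖ₑ) (hF.enorm.const_mul _) (fun s => ?_)
      (fun s => ENNReal.mul_ne_top (ENNReal.inv_ne_top.2 hC0) enorm_ne_top)
    · filter_upwards [this] with s hs
      rw [ENNReal.toReal_mul, ENNReal.toReal_inv, toReal_enorm] at hs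
      rwa [inv_mul_le_iff₀ hpos] at hs
    · exact (ENNReal.inv_mul_le_iff hC0 hC).2 (hFG s)

theorem integrable_of_enorm_le {G : S → ℝ≥0∞} (hG : ∫⁻ s, G s ∂ρ < ∞) {F : S → ℂ} {C : ℝ≥0∞}
    (hC : C ≠ ∞) (hF : Measurable F) (hFG : ∀ s, ‖F s‖ₑ ≤ C * G s) : Integrable F ρ := by
  refine ⟨hF.aestronglyMeasurable, ?_⟩
  refine (lintegral_mono hFG).trans_lt ?_
  rw [lintegral_const_mul' _ _ hC]
  exact ENNReal.mul_lt_top hC.lt_top hG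

end Domination

/-! ### Operators from bounded forms -/

section Forms

variable {H : Type*} [NormedAddCommGroup H] [InnerProductSpace ℂ H]

/-- By homogeneity both vectors may be normalised, and then the hypothesis reads `C * (1 + 1)`. -/
theorem norm_sesq_le_of_quad {B : H → H → ℂ} {C : ℝ}
    (hsl : ∀ (c : ℂ) x y, B (c • x) y = starRingEnd ℂ c * B x y)
    (hsr : ∀ (c : ℂ) x y, B x (c • y) = c * B x y)
    (hB : ∀ x y, ‖B x y‖ ≤ C * (‖x‖ ^ 2 + ‖y‖ ^ 2)) (x y : H) :
    ‖B x y‖ ≤ 2 * C * ‖x‖ * ‖y‖ := by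
  by_cases hx : x = 0
  · subst hx
    have := hsl 0 0 y
    simp only [smul_zero, map_zero, zero_mul] at this
    simp [this]
  by_cases hy : y = 0
  · subst hy
    have := hsr 0 x 0
    simp only [smul_zero, zero_mul] at this
    simp [this]
  have hx' : 0 < ‖x‖ := norm_pos_iff.2 hx
  have hy' : 0 < ‖y‖ := norm_pos_iff.2 hy
  have h := hB (((‖x‖⁻¹ : ℝ) : ℂ) • x) (((‖y‖⁻¹ : ℝ) : ℂ) • y)
  rw [hsl, hsr, norm_smul, norm_smul] at h
  simp only [norm_mul, Complex.conj_ofReal, Complex.norm_real, norm_inv, norm_norm] at h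
  rw [inv_mul_cancel₀ hx'.ne', inv_mul_cancel₀ hy'.ne'] at h
  have h3 : ‖B x y‖ = ‖x‖ * ‖y‖ * (‖x‖⁻¹ * (‖y‖⁻¹ * ‖B x y‖)) := by field_simp
  rw [h3]
  calc _ ≤ ‖x‖ * ‖y‖ * (C * (1 ^ 2 + 1 ^ 2)) := by gcongr
    _ = _ := by ring

variable [CompleteSpace H]

theorem exists_clm_of_sesq {B : H → H → ℂ} {C : ℝ}
    (hal : ∀ x x' y, B (x + x') y = B x y + B x' y)
    (har : ∀ x y y', B x (y + y') = B x y + B x y')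
    (hsl : ∀ (c : ℂ) x y, B (c • x) y = starRingEnd ℂ c * B x y)
    (hsr : ∀ (c : ℂ) x y, B x (c • y) = c * B x y)
    (hB : ∀ x y, ‖B x y‖ ≤ C * ‖x‖ * ‖y‖) :
    ∃ T : H →L[ℂ] H, ∀ x y, ⟪x, T y⟫_ℂ = B x y := by
  let L : H →L⋆[ℂ] H →L[ℂ] ℂ := LinearMap.mkContinuous₂
    (LinearMap.mk₂'ₛₗ (starRingEnd ℂ) (RingHom.id ℂ) B hal hsl har hsr) C hB
  -- The Riesz representation of the form puts the operator in the first slot of the inner product;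
  -- the adjoint moves it to the second.
  refine ⟨ContinuousLinearMap.adjoint (InnerProductSpace.continuousLinearMapOfBilin L),
    fun x y => ?_⟩
  rw [ContinuousLinearMap.adjoint_inner_right,
    InnerProductSpace.continuousLinearMapOfBilin_apply]
  rfl

theorem inner_polarization (T : H →L[ℂ] H) (y x : H) :
    ⟪y, T x⟫_ℂ = (⟪x + y, T (x + y)⟫_ℂ - ⟪x - y, T (x - y)⟫_ℂ
      + Complex.I * ⟪x + Complex.I • y, T (x + Complex.I • y)⟫_ℂ
      - Complex.I * ⟪x - Complex.I • y, T (x - Complex.I • y)⟫_ℂ) / 4 := by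
  simp only [map_add, map_sub, map_smul, inner_add_left, inner_add_right, inner_sub_left,
    inner_sub_right, inner_smul_left, inner_smul_right, Complex.conj_I]
  ring_nf
  simp only [Complex.I_sq]
  ring

theorem clm_ext_quad {T U : H →L[ℂ] H} (h : ∀ x, ⟪x, T x⟫_ℂ = ⟪x, U x⟫_ℂ) : T = U := by
  refine ContinuousLinearMap.ext fun x => ext_inner_left ℂ fun y => ?_
  rw [inner_polarization T, inner_polarization U, h, h, h, h]

/-- Quadratic forms that converge pointwise and are uniformly bounded converge to the form of a
bounded operator. -/
theorem exists_clm_of_tendsto_quad {T : ℕ → H →L[ℂ] H} {q : H → ℂ} {C : ℝ}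
    (hq : ∀ x, Filter.Tendsto (fun n => ⟪x, T n x⟫_ℂ) Filter.atTop (𝓝 (q x)))
    (hC : ∀ n x, ‖⟪x, T n x⟫_ℂ‖ ≤ C * ‖x‖ ^ 2) :
    ∃ U : H →L[ℂ] H, ∀ x, ⟪x, U x⟫_ℂ = q x := by
  -- Polarization of `q`. Its sesquilinearity is inherited from the forms of the `T n` by uniqueness
  -- of limits.
  let B : H → H → ℂ := fun y x => (q (x + y) - q (x - y) + Complex.I * q (x + Complex.I • y)
      - Complex.I * q (x - Complex.I • y)) / 4
  have hlim : ∀ y x, Filter.Tendsto (fun n => ⟪y, T n x⟫_ℂ) Filter.atTop (𝓝 (B y x)) := by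
    intro y x
    simp_rw [fun n => inner_polarization (T n) y x]
    exact ((((hq _).sub (hq _)).add ((hq _).const_mul _)).sub ((hq _).const_mul _)).div_const _
  have hbd : ∀ n y x, ‖⟪y, T n x⟫_ℂ‖ ≤ C * (‖y‖ ^ 2 + ‖x‖ ^ 2) := by
    intro n y x
    rw [inner_polarization, norm_div]
    have e1 := parallelogram_law_with_norm ℂ x y
    have e2 := parallelogram_law_with_norm ℂ x (Complex.I • y)
    have e3 : ‖Complex.I • y‖ = ‖y‖ := by simp [norm_smul]
    rw [e3] at e2
    have t : ‖⟪x + y, T n (x + y)⟫_ℂ - ⟪x - y, T n (x - y)⟫_ℂ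
      + Complex.I * ⟪x + Complex.I • y, T n (x + Complex.I • y)⟫_ℂ
      - Complex.I * ⟪x - Complex.I • y, T n (x - Complex.I • y)⟫_ℂ‖ ≤
      C * ‖x + y‖ ^ 2 + C * ‖x - y‖ ^ 2 + C * ‖x + Complex.I • y‖ ^ 2
        + C * ‖x - Complex.I • y‖ ^ 2 := by
      refine (norm_sub_le _ _).trans (add_le_add ((norm_add_le _ _).trans (add_le_add
        ((norm_sub_le _ _).trans (add_le_add (hC _ _) (hC _ _))) ?_)) ?_)
      · rw [norm_mul, Complex.norm_I, one_mul]; exact hC _ _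
      · rw [norm_mul, Complex.norm_I, one_mul]; exact hC _ _
    have h4 : ‖(4 : ℂ)‖ = 4 := by norm_num
    rw [h4, div_le_iff₀ (by norm_num)]
    refine t.trans (le_of_eq ?_)
    -- The two parallelogram laws turn the four squared norms into `4 * (‖x‖ ^ 2 + ‖y‖ ^ 2)`, which
    -- cancels the denominator of the polarization.
    linear_combination C * e1 + C * e2
  obtain ⟨U, hU⟩ := exists_clm_of_sesq (B := B) (C := 2 * C)
    (fun x x' y => tendsto_nhds_unique (hlim _ _)
      (by simpa only [inner_add_left] using (hlim x y).add (hlim x' y)))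
    (fun x y y' => tendsto_nhds_unique (hlim _ _)
      (by simpa only [map_add, inner_add_right] using (hlim x y).add (hlim x y')))
    (fun c x y => tendsto_nhds_unique (hlim _ _)
      (by simpa only [inner_smul_left] using (hlim x y).const_mul _))
    (fun c x y => tendsto_nhds_unique (hlim _ _)
      (by simpa only [map_smul, inner_smul_right] using (hlim x y).const_mul _))
    (fun x y => by
      refine le_of_tendsto (hlim x y).norm (Filter.Eventually.of_forall fun n => ?_)
      exact norm_sesq_le_of_quad (B := fun x y => ⟪x, T n y⟫_ℂ)
        (fun c x y => inner_smul_left _ _ _)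
        (fun c x y => by simp) (hbd n) x y)
  refine ⟨U, fun x => ?_⟩
  have h := hlim x x
  rw [← hU] at h
  exact tendsto_nhds_unique h (hq x)

end Forms

/-! ### Spectral theorem for bounded Borel functions -/

section Spectral

variable {H : Type*} [NormedAddCommGroup H] [InnerProductSpace ℂ H] [CompleteSpace H]

instance isFiniteMeasure_spectralMeasure (a : H →L[ℂ] H) (x : H) :
    IsFiniteMeasure (spectralMeasure a x) := by
  unfold spectralMeasure
  split_ifs <;> infer_instance

theorem integral_spectralMeasure_continuous {a : H →L[ℂ] H} (ha : IsSelfAdjoint a) (x : H)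
    (g : C(spectrum ℝ a, ℝ)) :
    ∫ l, (g l : ℂ) ∂(spectralMeasure a x) = ⟪x, cfcHom ha g x⟫_ℂ := by
  have h1 : ∫ l, g l ∂(spectralMeasure a x) = (⟪x, cfcHom ha g x⟫_ℂ).re := by
    have := RealRMK.integral_rieszMeasure (spectralFunctional a ha x)
      ⟨g, HasCompactSupport.of_compactSpace g⟩
    rw [spectralMeasure, dif_pos ha]
    exact this
  rw [integral_complex_ofReal, h1]
  have h2 : IsSelfAdjoint (cfcHom ha g) := cfcHom_predicate ha g
  exact (ContinuousLinearMap.isSelfAdjoint_iff_isSymmetric.1 h2).coe_re_inner_self_apply x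

theorem exists_borelFC {a : H →L[ℂ] H} (ha : IsSelfAdjoint a) {φ : spectrum ℝ a → ℂ}
    (hφ : BddMeas φ) :
    ∃ T : H →L[ℂ] H, ∀ x : H, ⟪x, T x⟫_ℂ = ∫ l, φ l ∂(spectralMeasure a x) := by
  have hmass : ∀ x : H, (spectralMeasure a x).real Set.univ = ‖x‖ ^ 2 := by
    intro x
    have := integral_spectralMeasure_continuous ha x 1
    simp only [ContinuousMap.one_apply, Complex.ofReal_one, integral_const, map_one,
      one_apply_eq_self, inner_self_eq_norm_sq_to_K] at this
    rw [← Complex.ofReal_inj]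
    simpa using this
  refine BddMeas.induction_continuous
      (P := fun φ => ∃ T : H →L[ℂ] H, ∀ x : H, ⟪x, T x⟫_ℂ = ∫ l, φ l ∂(spectralMeasure a x)) ?_ ?_ ?_ ?_ hφ
  · intro g hg _
    exact ⟨cfcHom ha ⟨g, hg⟩, fun x => (integral_spectralMeasure_continuous ha x ⟨g, hg⟩).symm⟩
  · intro f g hf hg ihf ihg
    obtain ⟨T, hT⟩ := ihf
    obtain ⟨U, hU⟩ := ihg
    refine ⟨T + U, fun x => ?_⟩
    rw [add_apply, inner_add_right, hT, hU]
    exact (integral_add (hf.integrable _) (hg.integrable _)).symm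
  · intro c f hf ih
    obtain ⟨T, hT⟩ := ih
    refine ⟨c • T, fun x => ?_⟩
    rw [smul_apply, inner_smul_right, hT]
    exact (integral_smul c f).symm
  · intro F f C hF hf hC hlim ih
    choose T hT using ih
    refine exists_clm_of_tendsto_quad (T := T) (C := C) (fun x => ?_) (fun n x => ?_)
    · simp_rw [hT]
      exact tendsto_integral_of_dominated_convergence (fun _ => C)
        (fun n => (hF n).aestronglyMeasurable) (integrable_const _)
        (fun n => ae_of_all _ (hC n)) (ae_of_all _ hlim)
    · rw [hT, ← hmass]
      exact norm_integral_le_of_norm_le_const (ae_of_all _ (hC n))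

/-- The bounded Borel functional calculus for functions on the real line. -/
noncomputable def bfc (a : H →L[ℂ] H) (φ : ℝ → ℂ) : H →L[ℂ] H :=
  borelFC a (fun l => φ l)

theorem BddMeas.comp_val {s : Set ℝ} {φ : ℝ → ℂ} (hφ : BddMeas φ) :
    BddMeas (fun l : s => φ l) := by
  obtain ⟨h, C, hC⟩ := hφ
  exact ⟨h.comp measurable_subtype_coe, C, fun l => hC l⟩

theorem bfc_congr {a : H →L[ℂ] H} {φ ψ : ℝ → ℂ} (h : Set.EqOn φ ψ (spectrum ℝ a)) :
    bfc a φ = bfc a ψ := by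
  unfold bfc
  congr 1
  ext l
  exact h l.2

variable {a : H →L[ℂ] H} (ha : IsSelfAdjoint a)
include ha

theorem inner_bfc_self {φ : ℝ → ℂ} (hφ : BddMeas φ) (x : H) :
    ⟪x, bfc a φ x⟫_ℂ = ∫ l, φ l ∂(spectralMeasure a x) := by
  have h := exists_borelFC ha (hφ.comp_val (s := spectrum ℝ a))
  unfold bfc borelFC
  rw [dif_pos h]
  exact h.choose_spec x

theorem bfc_ofReal {g : ℝ → ℝ} (hg : Continuous g) (hb : ∃ C, ∀ x, |g x| ≤ C) :
    bfc a (fun x => (g x : ℂ)) = cfc g a := by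
  refine clm_ext_quad fun x => ?_
  have hm : BddMeas (fun x => (g x : ℂ)) := by
    obtain ⟨C, hC⟩ := hb
    exact ⟨(Complex.continuous_ofReal.comp hg).measurable, C, fun x => by simpa using hC x⟩
  rw [inner_bfc_self ha hm, cfc_apply g a ha hg.continuousOn,
    ← integral_spectralMeasure_continuous]
  rfl

theorem bfc_add {φ ψ : ℝ → ℂ} (hφ : BddMeas φ) (hψ : BddMeas ψ) :
    bfc a (φ + ψ) = bfc a φ + bfc a ψ := by
  refine clm_ext_quad fun x => ?_
  rw [inner_bfc_self ha (hφ.add hψ), add_apply, inner_add_right,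
    inner_bfc_self ha hφ, inner_bfc_self ha hψ]
  exact integral_add (hφ.comp_val.integrable _) (hψ.comp_val.integrable _)

theorem bfc_smul (c : ℂ) {φ : ℝ → ℂ} (hφ : BddMeas φ) : bfc a (c • φ) = c • bfc a φ := by
  refine clm_ext_quad fun x => ?_
  rw [inner_bfc_self ha (hφ.smul c), smul_apply, inner_smul_right,
    inner_bfc_self ha hφ]
  exact integral_smul c _

theorem bfc_one : bfc a (fun _ => 1) = 1 := by
  have := bfc_ofReal ha (g := fun _ => 1) continuous_const ⟨1, by simp⟩
  rw [cfc_const_one ℝ a] at this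
  simpa using this

/-- Weak continuity of the calculus: dominated convergence for the scalar spectral measures, then
polarization. This is the limit step of most inductions on `φ` below. -/
theorem tendsto_inner_bfc {F : ℕ → ℝ → ℂ} {f : ℝ → ℂ} {C : ℝ} (hF : ∀ n, Measurable (F n))
    (hf : Measurable f) (hC : ∀ n x, ‖F n x‖ ≤ C)
    (hlim : ∀ x, Filter.Tendsto (fun n => F n x) Filter.atTop (𝓝 (f x))) (y x : H) :
    Filter.Tendsto (fun n => ⟪y, bfc a (F n) x⟫_ℂ) Filter.atTop (𝓝 ⟪y, bfc a f x⟫_ℂ) := by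
  have hf' : BddMeas f := ⟨hf, C, fun x =>
    le_of_tendsto (hlim x).norm (Filter.Eventually.of_forall fun n => hC n x)⟩
  have hq : ∀ z, Filter.Tendsto (fun n => ⟪z, bfc a (F n) z⟫_ℂ) Filter.atTop
      (𝓝 ⟪z, bfc a f z⟫_ℂ) := by
    intro z
    rw [inner_bfc_self ha hf']
    simp_rw [fun n => inner_bfc_self ha ⟨hF n, C, hC n⟩ z]
    exact tendsto_integral_of_dominated_convergence (fun _ => C)
      (fun n => ((hF n).comp measurable_subtype_coe).aestronglyMeasurable) (integrable_const _)
      (fun n => ae_of_all _ fun l => hC n l) (ae_of_all _ fun l => hlim l)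
  rw [inner_polarization (bfc a f) y x]
  simp_rw [fun n => inner_polarization (bfc a (F n)) y x]
  exact ((((hq _).sub (hq _)).add ((hq _).const_mul _)).sub ((hq _).const_mul _)).div_const _

theorem bfc_star {φ : ℝ → ℂ} (hφ : BddMeas φ) : bfc a (star φ) = star (bfc a φ) := by
  refine clm_ext_quad fun x => ?_
  rw [inner_bfc_self ha hφ.star, ContinuousLinearMap.star_eq_adjoint,
    ContinuousLinearMap.adjoint_inner_right, ← inner_conj_symm, inner_bfc_self ha hφ,
    ← integral_conj]
  rfl

omit ha in
theorem bddMeas_ofReal {g : ℝ → ℝ} (hg : Continuous g) (hb : ∃ C, ∀ x, |g x| ≤ C) :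
    BddMeas (fun x => (g x : ℂ)) := by
  obtain ⟨C, hC⟩ := hb
  exact ⟨(Complex.continuous_ofReal.comp hg).measurable, C, fun x => by simpa using hC x⟩

/-- Two successive extensions. With a continuous second factor, the first runs from continuous to
bounded Borel functions; then, with an arbitrary first factor, the second does. -/
theorem bfc_mul {φ ψ : ℝ → ℂ} (hφ : BddMeas φ) (hψ : BddMeas ψ) :
    bfc a (φ * ψ) = bfc a φ * bfc a ψ := by
  have key : ∀ g : ℝ → ℝ, Continuous g → (∃ C, ∀ x, |g x| ≤ C) → ∀ φ, BddMeas φ →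
      bfc a (φ * fun x => (g x : ℂ)) = bfc a φ * bfc a (fun x => (g x : ℂ)) := by
    intro g hg hb φ hφ
    have hgm := bddMeas_ofReal hg hb
    refine BddMeas.induction_continuous
      (P := fun φ => bfc a (φ * fun x => (g x : ℂ)) = bfc a φ * bfc a (fun x => (g x : ℂ))) ?_ ?_ ?_ ?_ hφ
    · intro f hf hfb
      rw [bfc_ofReal ha hg hb, bfc_ofReal ha hf hfb, ← cfc_mul f g a,
        show (fun x => f x * g x) = f * g from rfl,
        ← bfc_ofReal ha (hf.mul hg)]
      · congr 1
        ext x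
        simp
      · obtain ⟨C, hC⟩ := hb
        obtain ⟨D, hD⟩ := hfb
        refine ⟨D * C, fun x => ?_⟩
        rw [Pi.mul_apply, abs_mul]
        exact mul_le_mul (hD x) (hC x) (abs_nonneg _) ((abs_nonneg _).trans (hD x))
    · intro f h hf hh ihf ihh
      rw [add_mul, bfc_add ha (hf.mul hgm) (hh.mul hgm), ihf, ihh, bfc_add ha hf hh, add_mul]
    · intro c f hf ih
      rw [smul_mul_assoc, bfc_smul ha c (hf.mul hgm), ih, bfc_smul ha c hf, smul_mul_assoc]
    · intro F f C hF hf hC hlim ih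
      obtain ⟨D, hD⟩ := hgm.2
      refine ContinuousLinearMap.ext fun x => ext_inner_left ℂ fun y => ?_
      refine tendsto_nhds_unique (tendsto_inner_bfc ha (fun n => (hF n).mul hgm.1)
        (hf.mul hgm.1) (C := C * D) (fun n x => ?_) (fun x => (hlim x).mul_const _) y x) ?_
      · rw [Pi.mul_apply, norm_mul]
        exact mul_le_mul (hC n x) (hD x) (norm_nonneg _) ((norm_nonneg _).trans (hC n x))
      · simp_rw [ih]
        exact tendsto_inner_bfc ha hF hf hC hlim y _
  refine BddMeas.induction_continuous
      (P := fun ψ => bfc a (φ * ψ) = bfc a φ * bfc a ψ) ?_ ?_ ?_ ?_ hψ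
  · intro g hg hb
    exact key g hg hb φ hφ
  · intro f h hf hh ihf ihh
    rw [mul_add, bfc_add ha (hφ.mul hf) (hφ.mul hh), ihf, ihh, bfc_add ha hf hh, mul_add]
  · intro c f hf ih
    rw [mul_smul_comm, bfc_smul ha c (hφ.mul hf), ih, bfc_smul ha c hf, mul_smul_comm]
  · intro F f C hF hf hC hlim ih
    obtain ⟨D, hD⟩ := hφ.2
    refine ContinuousLinearMap.ext fun x => ext_inner_left ℂ fun y => ?_
    refine tendsto_nhds_unique (tendsto_inner_bfc ha (fun n => hφ.1.mul (hF n))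
      (hφ.1.mul hf) (C := D * C) (fun n x => ?_) (fun x => (hlim x).const_mul _) y x) ?_
    · rw [Pi.mul_apply, norm_mul]
      exact mul_le_mul (hD x) (hC n x) (norm_nonneg _) ((norm_nonneg _).trans (hD x))
    -- Moving `φ(a)` to the left vector as an adjoint makes weak convergence of the right factor
    -- sufficient.
    · simp_rw [ih, mul_apply_eq_comp, ← ContinuousLinearMap.adjoint_inner_left (bfc a φ)]
      exact tendsto_inner_bfc ha hF hf hC hlim _ x

/-- Multiplicativity and the star give `⟨x, (φ̄φ)(a) x⟩ = ‖φ(a) x‖²`. Both the bound by the supremum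
norm and strong continuity of the calculus come from this identity. -/
theorem norm_bfc_apply_sq {φ : ℝ → ℂ} (hφ : BddMeas φ) (x : H) :
    ‖bfc a φ x‖ ^ 2 = ∫ l, ‖φ l‖ ^ 2 ∂(spectralMeasure a x) := by
  have h1 : ⟪x, bfc a (star φ * φ) x⟫_ℂ = (‖bfc a φ x‖ ^ 2 : ℝ) := by
    rw [bfc_mul ha hφ.star hφ, bfc_star ha hφ, ContinuousLinearMap.star_eq_adjoint,
      mul_apply_eq_comp, ContinuousLinearMap.adjoint_inner_right,
      inner_self_eq_norm_sq_to_K]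
    simp
  rw [inner_bfc_self ha (hφ.star.mul hφ)] at h1
  rw [← Complex.ofReal_inj, ← h1, ← integral_complex_ofReal]
  refine integral_congr_ae (ae_of_all _ fun l => ?_)
  simp [← Complex.normSq_eq_conj_mul_self, Complex.normSq_eq_norm_sq]

theorem norm_bfc_le {φ : ℝ → ℂ} {C : ℝ} (hφ : Measurable φ) (hC : ∀ x, ‖φ x‖ ≤ C) :
    ‖bfc a φ‖ ≤ C := by
  have hC0 : 0 ≤ C := (norm_nonneg _).trans (hC 0)
  refine (bfc a φ).opNorm_le_bound hC0 fun x => ?_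
  have h1 := norm_bfc_apply_sq ha ⟨hφ, C, hC⟩ x
  have h2 := norm_bfc_apply_sq ha (bddMeas_const 1) x
  rw [bfc_one ha] at h2
  refine le_of_sq_le_sq ?_ (by positivity)
  rw [h1, mul_pow, show ‖x‖ ^ 2 = ∫ l, ‖(1 : ℂ)‖ ^ 2 ∂(spectralMeasure a x) from h2,
    ← integral_const_mul]
  refine integral_mono ?_ (integrable_const _) fun l => ?_
  · refine Integrable.of_bound ((hφ.comp measurable_subtype_coe).norm.pow_const 2).aestronglyMeasurable
      (C ^ 2) (ae_of_all _ fun l => ?_)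
    rw [norm_pow, norm_norm]
    exact pow_le_pow_left₀ (norm_nonneg _) (hC l) 2
  · simp only [norm_one, one_pow, mul_one]
    exact pow_le_pow_left₀ (norm_nonneg _) (hC l) 2

theorem enorm_bfc_le {φ : ℝ → ℂ} (hφ : BddMeas φ) : ‖bfc a φ‖ₑ ≤ ⨆ x, ‖φ x‖ₑ := by
  obtain ⟨hm, C, hC⟩ := hφ
  have hfin : (⨆ x, ‖φ x‖ₑ) ≠ ∞ := by
    refine ne_top_of_le_ne_top (ENNReal.ofReal_ne_top (r := C)) (iSup_le fun x => ?_)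
    rw [← ofReal_norm]
    exact ENNReal.ofReal_le_ofReal (hC x)
  rw [← ENNReal.ofReal_toReal hfin, ← ofReal_norm]
  refine ENNReal.ofReal_le_ofReal (norm_bfc_le ha hm fun x => ?_)
  rw [← toReal_enorm]
  exact ENNReal.toReal_mono hfin (le_iSup (fun x => ‖φ x‖ₑ) x)

/-- The isometry identity applied to `F n - f` upgrades weak to strong convergence, which strong
measurability of parametrized operators requires. -/
theorem tendsto_bfc_apply {F : ℕ → ℝ → ℂ} {f : ℝ → ℂ} {C : ℝ} (hF : ∀ n, Measurable (F n))
    (hf : Measurable f) (hC : ∀ n x, ‖F n x‖ ≤ C)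
    (hlim : ∀ x, Filter.Tendsto (fun n => F n x) Filter.atTop (𝓝 (f x))) (x : H) :
    Filter.Tendsto (fun n => bfc a (F n) x) Filter.atTop (𝓝 (bfc a f x)) := by
  have hfC : ∀ x, ‖f x‖ ≤ C := fun x =>
    le_of_tendsto (hlim x).norm (Filter.Eventually.of_forall fun n => hC n x)
  have hf' : BddMeas f := ⟨hf, C, hfC⟩
  rw [tendsto_iff_norm_sub_tendsto_zero]
  have h1 : ∀ n, ‖bfc a (F n) x - bfc a f x‖ ^ 2
      = ∫ l, ‖(F n + (-1 : ℂ) • f) l‖ ^ 2 ∂(spectralMeasure a x) := by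
    intro n
    rw [← norm_bfc_apply_sq ha (BddMeas.add ⟨hF n, C, hC n⟩ (hf'.smul (-1))),
      bfc_add ha ⟨hF n, C, hC n⟩ (hf'.smul (-1)), bfc_smul ha _ hf']
    simp [sub_eq_add_neg]
  have h2 : Filter.Tendsto (fun n => ‖bfc a (F n) x - bfc a f x‖ ^ 2) Filter.atTop (𝓝 0) := by
    simp_rw [h1]
    have : (0 : ℝ) = ∫ l : spectrum ℝ a, 0 ∂(spectralMeasure a x) := by simp
    rw [this]
    refine tendsto_integral_of_dominated_convergence (fun _ => (C + C) ^ 2) (fun n => ?_)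
      (integrable_const _) (fun n => ae_of_all _ fun l => ?_) (ae_of_all _ fun l => ?_)
    · exact ((((hF n).add (hf.const_smul (-1 : ℂ))).comp
        measurable_subtype_coe).norm.pow_const 2).aestronglyMeasurable
    · rw [norm_pow, norm_norm]
      refine pow_le_pow_left₀ (norm_nonneg _) ((norm_add_le _ _).trans (add_le_add (hC n l) ?_)) 2
      simpa using hfC l
    · have := ((hlim l).sub_const (f l)).norm.pow 2
      simpa [sub_eq_add_neg] using this
  have h3 := h2.sqrt
  simpa [Real.sqrt_sq (norm_nonneg _)] using h3

/-- Commutation holds for continuous functions and survives weak limits; through the double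
commutant theorem it places `φ(m)` in the von Neumann algebra. -/
theorem commute_bfc {b : H →L[ℂ] H} (hb : Commute a b) {φ : ℝ → ℂ} (hφ : BddMeas φ) :
    Commute (bfc a φ) b := by
  refine BddMeas.induction_continuous
      (P := fun φ => Commute (bfc a φ) b) ?_ ?_ ?_ ?_ hφ
  · intro g hg hgb
    rw [bfc_ofReal ha hg hgb]
    exact hb.cfc_real g
  · intro f g hf hg ihf ihg
    rw [bfc_add ha hf hg]
    exact ihf.add_left ihg
  · intro c f hf ih
    rw [bfc_smul ha c hf]
    exact ih.smul_left c
  · intro F f C hF hf hC hlim ih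
    refine ContinuousLinearMap.ext fun x => ext_inner_left ℂ fun y => ?_
    refine tendsto_nhds_unique (tendsto_inner_bfc ha hF hf hC hlim y (b x)) ?_
    have : ∀ n, ⟪y, bfc a (F n) (b x)⟫_ℂ = ⟪ContinuousLinearMap.adjoint b y, bfc a (F n) x⟫_ℂ := by
      intro n
      rw [ContinuousLinearMap.adjoint_inner_left]
      exact congrArg (inner ℂ y) (congrArg (fun T => T x) (ih n).eq)
    simp_rw [this, mul_apply_eq_comp, ← ContinuousLinearMap.adjoint_inner_left b]
    exact tendsto_inner_bfc ha hF hf hC hlim _ x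

end Spectral

/-! ### Parametrized functional calculus -/

section Parametrized

variable {H : Type*} [NormedAddCommGroup H] [InnerProductSpace ℂ H] [CompleteSpace H]
variable {S : Type*} [MeasurableSpace S]

/-- Strong measurability of operator-valued functions in the strong operator topology. -/
def SOTMeasurable (F : S → H →L[ℂ] H) : Prop := ∀ x, StronglyMeasurable fun s => F s x

theorem SOTMeasurable.const (T : H →L[ℂ] H) : SOTMeasurable fun _ : S => T :=
  fun _ => stronglyMeasurable_const

theorem SOTMeasurable.add {F G : S → H →L[ℂ] H} (hF : SOTMeasurable F) (hG : SOTMeasurable G) :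
    SOTMeasurable fun s => F s + G s :=
  fun x => (hF x).add (hG x)

theorem SOTMeasurable.apply {F : S → H →L[ℂ] H} (hF : SOTMeasurable F) {v : S → H}
    (hv : StronglyMeasurable v) : StronglyMeasurable fun s => F s (v s) := by
  refine stronglyMeasurable_of_tendsto Filter.atTop (f := fun n s => F s (hv.approx n s))
    (fun n => ?_) (tendsto_pi_nhds.2 fun s => ((F s).continuous.tendsto _).comp (hv.tendsto_approx s))
  generalize hv.approx n = g
  classical
  -- On each fibre of the simple function `g` the vector is constant, so only measurability of `F`
  -- at fixed vectors is used.
  have : (fun s => F s (g s)) = fun s => ∑ y ∈ g.range, (g ⁻¹' {y}).indicator (fun s => F s y) s := by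
    ext s
    rw [Finset.sum_eq_single_of_mem (g s) (g.mem_range_self s)]
    · rw [Set.indicator_of_mem (by simp)]
    · intro y _ hy
      exact Set.indicator_of_notMem (fun h => hy (by simpa using Eq.symm h)) _
  rw [this]
  exact Finset.stronglyMeasurable_fun_sum _ fun y _ =>
    (hF y).indicator (g.measurableSet_fiber y)

theorem SOTMeasurable.mul {F G : S → H →L[ℂ] H} (hF : SOTMeasurable F) (hG : SOTMeasurable G) :
    SOTMeasurable fun s => F s * G s :=
  fun x => hF.apply (hG x)

theorem SOTMeasurable.measurable_inner {F : S → H →L[ℂ] H} (hF : SOTMeasurable F) (y x : H) :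
    Measurable fun s => ⟪y, F s x⟫_ℂ :=
  (stronglyMeasurable_const.inner (hF x)).measurable

variable {a : H →L[ℂ] H} (ha : IsSelfAdjoint a)

theorem bddMeas_section {Φ : ℝ → S → ℂ} (hΦ : Measurable (Function.uncurry Φ))
    (hb : ∀ s, ∃ C : ℝ, ∀ x, ‖Φ x s‖ ≤ C) (s : S) : BddMeas fun x => Φ x s :=
  ⟨hΦ.comp measurable_prodMk_right, hb s⟩

include ha

/-- A monotone class argument on `ℝ × S`. For a rectangle `A × B` the family is `1_B(s) 1_A(a)`,
visibly measurable; linear combinations and limits follow by strong continuity of the calculus. -/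
theorem sotMeasurable_bfc {Φ : ℝ → S → ℂ} (hΦ : Measurable (Function.uncurry Φ))
    (hb : ∀ s, ∃ C : ℝ, ∀ x, ‖Φ x s‖ ≤ C) : SOTMeasurable fun s => bfc a fun x => Φ x s := by
  intro v
  have hsec : ∀ {f : ℝ × S → ℂ}, BddMeas f → ∀ s, BddMeas fun x => f (x, s) := by
    intro f hf s
    exact ⟨hf.1.comp measurable_prodMk_right, hf.2.imp fun C hC x => hC _⟩
  -- The bound may depend on `s`: the final truncation is uniformly bounded only on each section.
  have hlim' : ∀ (F : ℕ → ℝ × S → ℂ) (f : ℝ × S → ℂ), (∀ n, Measurable (F n)) → Measurable f →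
      (∀ s, ∃ C : ℝ, ∀ n x, ‖F n (x, s)‖ ≤ C) →
      (∀ p, Filter.Tendsto (fun n => F n p) Filter.atTop (𝓝 (f p))) →
      (∀ n, StronglyMeasurable fun s => bfc a (fun x => F n (x, s)) v) →
      StronglyMeasurable fun s => bfc a (fun x => f (x, s)) v := by
    intro F f hF hf hC hlim ih
    refine stronglyMeasurable_of_tendsto Filter.atTop ih (tendsto_pi_nhds.2 fun s => ?_)
    obtain ⟨C, hC⟩ := hC s
    exact tendsto_bfc_apply ha (fun n => (hF n).comp measurable_prodMk_right)
      (hf.comp measurable_prodMk_right) hC (fun x => hlim (x, s)) v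
  have key : ∀ f : ℝ × S → ℂ, BddMeas f →
      StronglyMeasurable fun s => bfc a (fun x => f (x, s)) v := by
    intro f hf
    have hadd : ∀ f g : ℝ × S → ℂ, BddMeas f → BddMeas g →
        (StronglyMeasurable fun s => bfc a (fun x => f (x, s)) v) →
        (StronglyMeasurable fun s => bfc a (fun x => g (x, s)) v) →
        StronglyMeasurable fun s => bfc a (fun x => (f + g) (x, s)) v := by
      intro f g hf hg ihf ihg
      have := ihf.add ihg
      convert! this using 2 with s
      exact congrArg (fun T => T v) (bfc_add ha (hsec hf s) (hsec hg s))
    have hsmul : ∀ (c : ℂ) (f : ℝ × S → ℂ), BddMeas f →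
        (StronglyMeasurable fun s => bfc a (fun x => f (x, s)) v) →
        StronglyMeasurable fun s => bfc a (fun x => (c • f) (x, s)) v := by
      intro c f hf ih
      have := ih.const_smul c
      convert! this using 2 with s
      exact congrArg (fun T => T v) (bfc_smul ha c (hsec hf s))
    have hone : StronglyMeasurable fun s : S => bfc a (fun x => (1 : ℝ × S → ℂ) (x, s)) v := by
      have : (fun s : S => bfc a (fun x => (1 : ℝ × S → ℂ) (x, s)) v) = fun _ => v := by
        ext s
        exact congrArg (fun T => T v) (bfc_one ha)
      rw [this]
      exact stronglyMeasurable_const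
    refine BddMeas.induction_indicator
      (P := fun f => StronglyMeasurable fun s => bfc a (fun x => f (x, s)) v) ?_ hadd hsmul ?_ hf
    · intro A hA
      induction A, hA using MeasurableSpace.induction_on_inter generateFrom_prod.symm
        isPiSystem_prod with
      | empty =>
        have := hsmul 0 1 (bddMeas_const 1) hone
        convert! this using 4
        simp
      | basic t ht =>
        obtain ⟨A, hA, B, hB, rfl⟩ := ht
        have h1 : StronglyMeasurable
            (B.indicator fun _ => bfc a (A.indicator 1) v) :=
          stronglyMeasurable_const.indicator hB
        convert! h1 using 2 with s
        by_cases hs : s ∈ B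
        · rw [Set.indicator_of_mem hs]
          congr 2
          ext x
          by_cases hx : x ∈ A <;> simp [hx, hs]
        · rw [Set.indicator_of_notMem hs]
          have : (fun x => (A ×ˢ B).indicator (1 : ℝ × S → ℂ) (x, s)) = (0 : ℂ) • fun _ => 1 := by
            ext x
            simp [hs]
          rw [this, bfc_smul ha 0 (bddMeas_const 1)]
          simp
      | compl t ht ih =>
        have := hadd 1 _ (bddMeas_const 1) ((bddMeas_indicator ht).smul (-1)) hone
          (hsmul (-1) _ (bddMeas_indicator ht) ih)
        convert! this using 4 with s
        ext x
        by_cases h : (x, s) ∈ t <;> simp [h]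
      | iUnion f hd hf ih =>
        refine hlim' (fun n x => ∑ i ∈ Finset.range n, (f i).indicator (1 : ℝ × S → ℂ) x) _
          (fun n => ?_) (measurable_one.indicator (MeasurableSet.iUnion hf))
          (fun s => ⟨1, fun n x => norm_sum_indicator_le hd n _⟩)
          (tendsto_indicator_iUnion hd) (fun n => ?_)
        · exact Finset.measurable_sum _ fun i _ => measurable_one.indicator (hf i)
        · have heq : (fun x => ∑ i ∈ Finset.range n, (f i).indicator (1 : ℝ × S → ℂ) x)
              = ∑ i ∈ Finset.range n, (f i).indicator (1 : ℝ × S → ℂ) := by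
            ext x; simp
          suffices BddMeas (∑ i ∈ Finset.range n, (f i).indicator (1 : ℝ × S → ℂ)) ∧
            StronglyMeasurable fun s => bfc a
              (fun x => (∑ i ∈ Finset.range n, (f i).indicator (1 : ℝ × S → ℂ)) (x, s)) v by
            rw [← heq] at this
            exact this.2
          clear heq
          induction n with
          | zero =>
            refine ⟨bddMeas_const 0, ?_⟩
            have := hsmul 0 1 (bddMeas_const 1) hone
            convert! this using 4
            simp
          | succ n ihn =>
            rw [Finset.sum_range_succ]
            exact ⟨ihn.1.add (bddMeas_indicator (hf n)),
              hadd _ _ ihn.1 (bddMeas_indicator (hf n)) ihn.2 (ih n)⟩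
    · intro F f C hF hf hC hlim ih
      exact hlim' F f hF hf (fun s => ⟨C, fun n x => hC n _⟩) hlim ih
  have hset : ∀ n : ℕ, MeasurableSet {p : ℝ × S | ‖Function.uncurry Φ p‖ ≤ n} := fun n =>
    measurableSet_le hΦ.norm measurable_const
  -- `Φ` is bounded for each `s` but not jointly, so it is cut off where its norm exceeds `n`.
  refine hlim' (fun n => {p : ℝ × S | ‖Function.uncurry Φ p‖ ≤ n}.indicator (Function.uncurry Φ))
    (Function.uncurry Φ) (fun n => hΦ.indicator (hset n)) hΦ (fun s => ?_) (fun p => ?_)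
    (fun n => key _ ⟨hΦ.indicator (hset n), n, fun p => ?_⟩)
  · obtain ⟨C, hC⟩ := hb s
    exact ⟨C, fun n x => (norm_indicator_le_norm_self _ _).trans (hC x)⟩
  · refine tendsto_const_nhds.congr' ?_
    filter_upwards [Filter.eventually_ge_atTop ⌈‖Function.uncurry Φ p‖⌉₊] with n hn
    rw [Set.indicator_of_mem]
    exact Nat.ceil_le.1 hn
  · by_cases h : ‖Function.uncurry Φ p‖ ≤ n
    · rw [Set.indicator_of_mem (by exact h)]
      exact h
    · rw [Set.indicator_of_notMem (by exact h)]
      simp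

theorem enorm_bfc_apply_le {φ : ℝ → ℂ} (hφ : BddMeas φ) (x : H) :
    ‖bfc a φ x‖ₑ ≤ (⨆ l, ‖φ l‖ₑ) * ‖x‖ₑ :=
  ((bfc a φ).le_opENorm x).trans (mul_le_mul_left (enorm_bfc_le ha hφ) _)

omit ha in
theorem enorm_inner_le (y x : H) : ‖⟪y, x⟫_ℂ‖ₑ ≤ ‖y‖ₑ * ‖x‖ₑ := by
  rw [← ofReal_norm, ← ofReal_norm, ← ofReal_norm, ← ENNReal.ofReal_mul (norm_nonneg _)]
  exact ENNReal.ofReal_le_ofReal (norm_inner_le_norm _ _)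

theorem enorm_inner_bfc_le {φ : ℝ → ℂ} (hφ : BddMeas φ) (y x : H) :
    ‖⟪y, bfc a φ x⟫_ℂ‖ₑ ≤ (‖y‖ₑ * ‖x‖ₑ) * ⨆ l, ‖φ l‖ₑ := by
  refine (enorm_inner_le _ _).trans ?_
  rw [mul_assoc, mul_comm ‖x‖ₑ]
  exact mul_le_mul_right (enorm_bfc_apply_le ha hφ x) _

omit ha in
theorem bddMeas_integral {ρ : Measure S} [SFinite ρ] {Φ : ℝ → S → ℂ}
    (hΦ : Measurable (Function.uncurry Φ)) (hG : ∫⁻ s, ⨆ x, ‖Φ x s‖ₑ ∂ρ < ∞) :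
    BddMeas fun x => ∫ s, Φ x s ∂ρ := by
  refine ⟨?_, (∫⁻ s, ⨆ x, ‖Φ x s‖ₑ ∂ρ).toReal, fun x => ?_⟩
  · exact (StronglyMeasurable.integral_prod_right' (f := Function.uncurry Φ)
      hΦ.stronglyMeasurable).measurable
  · rw [← toReal_enorm]
    exact ENNReal.toReal_mono hG.ne ((enorm_integral_le_lintegral_enorm _).trans
      (lintegral_mono fun s => le_iSup (fun x => ‖Φ x s‖ₑ) x))

/-- Fubini's theorem for the functional calculus. -/
theorem inner_bfc_integral {ρ : Measure S} [SFinite ρ] {Φ : ℝ → S → ℂ}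
    (hΦ : Measurable (Function.uncurry Φ)) (hb : ∀ s, ∃ C : ℝ, ∀ x, ‖Φ x s‖ ≤ C)
    (hG : ∫⁻ s, ⨆ x, ‖Φ x s‖ₑ ∂ρ < ∞) (y x : H) :
    ⟪y, bfc a (fun l => ∫ s, Φ l s ∂ρ) x⟫_ℂ = ∫ s, ⟪y, bfc a (fun l => Φ l s) x⟫_ℂ ∂ρ := by
  have hint : ∀ z, Integrable (fun s => ⟪z, bfc a (fun l => Φ l s) z⟫_ℂ) ρ := fun z =>
    integrable_of_enorm_le hG (ENNReal.mul_ne_top enorm_ne_top enorm_ne_top)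
      ((sotMeasurable_bfc ha hΦ hb).measurable_inner z z)
      fun s => enorm_inner_bfc_le ha (bddMeas_section hΦ hb s) z z
  have hquad : ∀ z, ⟪z, bfc a (fun l => ∫ s, Φ l s ∂ρ) z⟫_ℂ
      = ∫ s, ⟪z, bfc a (fun l => Φ l s) z⟫_ℂ ∂ρ := by
    intro z
    rw [inner_bfc_self ha (bddMeas_integral hΦ hG)]
    simp_rw [fun s => inner_bfc_self ha (bddMeas_section hΦ hb s) z]
    have hm : Measurable (Function.uncurry fun (l : spectrum ℝ a) s => Φ l s) :=
      hΦ.comp (measurable_subtype_coe.prodMap measurable_id)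
    refine integral_integral_swap ⟨hm.aestronglyMeasurable, ?_⟩
    -- Integrating over the spectrum first only costs the finite mass of the spectral measure times
    -- the supremum, whose lower integral in `s` is finite.
    rw [HasFiniteIntegral, lintegral_prod_symm _ hm.enorm.aemeasurable]
    calc ∫⁻ s, ∫⁻ l : spectrum ℝ a, ‖Φ l s‖ₑ ∂(spectralMeasure a z) ∂ρ
        ≤ ∫⁻ s, (⨆ x, ‖Φ x s‖ₑ) * spectralMeasure a z Set.univ ∂ρ := by
          refine lintegral_mono fun s => ?_
          rw [← lintegral_const]
          exact lintegral_mono fun l => le_iSup (fun x => ‖Φ x s‖ₑ) (l : ℝ)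
      _ < ∞ := by
          rw [lintegral_mul_const' _ _ (measure_ne_top _ _)]
          exact ENNReal.mul_lt_top hG (measure_lt_top _ _)
  rw [inner_polarization (bfc a (fun l => ∫ s, Φ l s ∂ρ)) y x, hquad, hquad, hquad, hquad]
  simp_rw [fun s => inner_polarization (bfc a (fun l => Φ l s)) y x]
  rw [integral_div, integral_sub, integral_add, integral_sub, integral_const_mul,
    integral_const_mul]
  · exact hint _
  · exact hint _
  · exact (hint _).sub (hint _)
  · exact (hint _).const_mul _
  · exact ((hint _).sub (hint _)).add ((hint _).const_mul _)
  · exact (hint _).const_mul _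

end Parametrized

/-! ### Pettis integrals -/

section Pettis

variable {H : Type*} [NormedAddCommGroup H] [InnerProductSpace ℂ H] [CompleteSpace H]
variable {S : Type*} [MeasurableSpace S] {ρ : Measure S}

theorem enorm_inner_apply_le (T : H →L[ℂ] H) (y x : H) :
    ‖⟪y, T x⟫_ℂ‖ₑ ≤ (‖y‖ₑ * ‖x‖ₑ) * ‖T‖ₑ := by
  refine (enorm_inner_le _ _).trans ?_
  rw [mul_assoc, mul_comm ‖x‖ₑ]
  exact mul_le_mul_right (T.le_opENorm x) _

theorem clm_enorm_mul_le (T U : H →L[ℂ] H) : ‖T * U‖ₑ ≤ ‖T‖ₑ * ‖U‖ₑ := by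
  rw [← ofReal_norm, ← ofReal_norm, ← ofReal_norm, ← ENNReal.ofReal_mul (norm_nonneg _)]
  exact ENNReal.ofReal_le_ofReal (norm_mul_le _ _)

theorem SOTMeasurable.integrable_inner {F : S → H →L[ℂ] H} (hF : SOTMeasurable F) {G : S → ℝ≥0∞}
    (hG : ∫⁻ s, G s ∂ρ < ∞) (hFG : ∀ s, ‖F s‖ₑ ≤ G s) (y x : H) :
    Integrable (fun s => ⟪y, F s x⟫_ℂ) ρ :=
  integrable_of_enorm_le hG (ENNReal.mul_ne_top enorm_ne_top enorm_ne_top)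
    (hF.measurable_inner y x)
    fun s => (enorm_inner_apply_le _ _ _).trans (mul_le_mul_right (hFG s) _)

/-- Domination bounds the integrated sesquilinear form by `∫⁻ G`, and a bounded form is given by an
operator. -/
theorem SOTMeasurable.exists_pettis {F : S → H →L[ℂ] H} (hF : SOTMeasurable F) {G : S → ℝ≥0∞}
    (hG : ∫⁻ s, G s ∂ρ < ∞) (hFG : ∀ s, ‖F s‖ₑ ≤ G s) :
    ∃ T, IsPettisIntegral ρ F T := by
  have hint := hF.integrable_inner hG hFG
  obtain ⟨T, hT⟩ := exists_clm_of_sesq (B := fun y x => ∫ s, ⟪y, F s x⟫_ℂ ∂ρ)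
    (C := (∫⁻ s, G s ∂ρ).toReal)
    (fun x x' y => by
      simp_rw [inner_add_left]
      exact integral_add (hint _ _) (hint _ _))
    (fun x x' y => by
      simp_rw [map_add, inner_add_right]
      exact integral_add (hint _ _) (hint _ _))
    (fun c x y => by
      simp_rw [inner_smul_left]
      exact integral_const_mul _ _)
    (fun c x y => by
      simp_rw [map_smul, inner_smul_right]
      exact integral_const_mul _ _)
    (fun y x => by
      have h1 : ‖∫ s, ⟪y, F s x⟫_ℂ ∂ρ‖ₑ ≤ (‖y‖ₑ * ‖x‖ₑ) * ∫⁻ s, G s ∂ρ := by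
        refine (enorm_integral_le_lintegral_enorm _).trans ?_
        rw [← lintegral_const_mul' _ _ (ENNReal.mul_ne_top enorm_ne_top enorm_ne_top)]
        exact lintegral_mono fun s =>
          (enorm_inner_apply_le _ _ _).trans (mul_le_mul_right (hFG s) _)
      have h2 := ENNReal.toReal_mono
        (ENNReal.mul_ne_top (ENNReal.mul_ne_top enorm_ne_top enorm_ne_top) hG.ne) h1
      rw [ENNReal.toReal_mul, ENNReal.toReal_mul, toReal_enorm, toReal_enorm, toReal_enorm] at h2
      exact h2.trans_eq (by ring))
  exact ⟨T, fun x y => ⟨hF.measurable_inner y x, hint y x, hT y x⟩⟩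

theorem isPettisIntegral_pettisIntegral {F : S → H →L[ℂ] H} (h : ∃ T, IsPettisIntegral ρ F T) :
    IsPettisIntegral ρ F (pettisIntegral ρ F) := by
  unfold pettisIntegral
  rw [dif_pos h]
  exact h.choose_spec

end Pettis

/-! ### Independence of the decomposition -/

/-- A pair of parametrized functions whose product can be integrated over the parameter. -/
structure IsDecomp {S : Type*} [MeasurableSpace S] (ρ : Measure S) (Φ Ψ : ℝ → S → ℂ) : Prop where
  meas_left : Measurable (Function.uncurry Φ)
  meas_right : Measurable (Function.uncurry Ψ)
  bdd_left : ∀ s, ∃ C : ℝ, ∀ x, ‖Φ x s‖ ≤ C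
  bdd_right : ∀ s, ∃ C : ℝ, ∀ x, ‖Ψ x s‖ ≤ C
  lintegral_lt : ∫⁻ s, (⨆ x, ‖Φ x s‖ₑ) * (⨆ x, ‖Ψ x s‖ₑ) ∂ρ < ∞

section Independence

variable {H : Type*} [NormedAddCommGroup H] [InnerProductSpace ℂ H] [CompleteSpace H]
variable {a₁ a₂ : H →L[ℂ] H} (h₁ : IsSelfAdjoint a₁) (h₂ : IsSelfAdjoint a₂)

/-- Stands in for separability of the Hilbert space, which is not assumed: only the countably many
directions needed to reach `A` are exhausted. -/
theorem exists_proj_tendsto {A : Set H} (hA : TopologicalSpace.IsSeparable A) :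
    ∃ V : ℕ → Submodule ℂ H, ∃ _ : ∀ n, FiniteDimensional ℂ (V n), ∀ x ∈ A,
      Filter.Tendsto (fun n => (V n).starProjection x) Filter.atTop (𝓝 x) := by
  obtain ⟨c, hc, hAc⟩ := hA
  -- Adding `0` makes the countable set nonempty, hence the range of a sequence.
  obtain ⟨d, hd⟩ := (hc.insert 0).exists_eq_range (Set.insert_nonempty _ _)
  let V : ℕ → Submodule ℂ H := fun n => Submodule.span ℂ (d '' Set.Iio n)
  have hfin : ∀ n, FiniteDimensional ℂ (V n) := fun n =>
    FiniteDimensional.span_of_finite ℂ ((Set.finite_Iio n).image d)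
  have hmono : Monotone V := fun m n hmn =>
    Submodule.span_mono (Set.image_mono (Set.Iio_subset_Iio hmn))
  refine ⟨V, hfin, fun x hx => ?_⟩
  have h := Submodule.starProjection_tendsto_closure_iSup V hmono x
  have hmem : x ∈ (⨆ i, V i).topologicalClosure := by
    refine closure_mono ?_ (hAc hx)
    intro y hy
    obtain ⟨n, rfl⟩ : y ∈ Set.range d := hd ▸ Set.mem_insert_of_mem _ hy
    -- `V n` is spanned by the terms of index below `n`, so `d n` first appears in `V (n + 1)`.
    exact Submodule.mem_iSup_of_mem (n + 1)
      (Submodule.subset_span ⟨n, Nat.lt_succ_self n, rfl⟩)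
  rwa [Submodule.starProjection_eq_self_iff.2 hmem] at h

variable {S : Type*} [MeasurableSpace S] {ρ : Measure S} [SFinite ρ] {Φ Ψ : ℝ → S → ℂ}

include h₁ h₂

/-- The double operator integral against rank one operators is an iterated integral. -/
theorem integral_inner_mul_inner (hD : IsDecomp ρ Φ Ψ) (y x' y' x : H) :
    ∫ s, ⟪y, bfc a₁ (fun l => Φ l s) x'⟫_ℂ * ⟪y', bfc a₂ (fun l => Ψ l s) x⟫_ℂ ∂ρ
      = ⟪y, bfc a₁ (fun l₁ => ⟪y', bfc a₂ (fun l₂ => ∫ s, Φ l₁ s * Ψ l₂ s ∂ρ) x⟫_ℂ) x'⟫_ℂ := by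
  have hc : Measurable fun s => ⟪y', bfc a₂ (fun l => Ψ l s) x⟫_ℂ :=
    (sotMeasurable_bfc h₂ hD.meas_right hD.bdd_right).measurable_inner _ _
  have step1 : ∀ s, ⟪y, bfc a₁ (fun l => Φ l s) x'⟫_ℂ * ⟪y', bfc a₂ (fun l => Ψ l s) x⟫_ℂ
      = ⟪y, bfc a₁ (fun l => ⟪y', bfc a₂ (fun l => Ψ l s) x⟫_ℂ * Φ l s) x'⟫_ℂ := by
    intro s
    have := bfc_smul h₁ ⟪y', bfc a₂ (fun l => Ψ l s) x⟫_ℂ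
      (bddMeas_section hD.meas_left hD.bdd_left s)
    change _ = ⟪y, bfc a₁ (⟪y', bfc a₂ (fun l => Ψ l s) x⟫_ℂ • fun l => Φ l s) x'⟫_ℂ
    rw [this, smul_apply, inner_smul_right, mul_comm]
  -- The second factor is now a scalar inside the symbol of the first, so Fubini applies to `a₁`;
  -- the same device then treats `a₂` for each fixed `l₁`.
  simp_rw [step1]
  rw [← inner_bfc_integral h₁]
  · congr 3
    ext l₁
    obtain hl := fun s => (hD.bdd_left s).imp fun C hC => hC l₁
    have step2 : ∀ s, ⟪y', bfc a₂ (fun l => Ψ l s) x⟫_ℂ * Φ l₁ s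
        = ⟪y', bfc a₂ (fun l => Φ l₁ s * Ψ l s) x⟫_ℂ := by
      intro s
      have := bfc_smul h₂ (Φ l₁ s) (bddMeas_section hD.meas_right hD.bdd_right s)
      change _ = ⟪y', bfc a₂ (Φ l₁ s • fun l => Ψ l s) x⟫_ℂ
      rw [this, smul_apply, inner_smul_right, mul_comm]
    simp_rw [step2]
    rw [← inner_bfc_integral h₂]
    · exact (hD.meas_left.comp (measurable_const.prodMk measurable_snd)).mul hD.meas_right
    · intro s
      obtain ⟨C, hC⟩ := hD.bdd_right s
      refine ⟨‖Φ l₁ s‖ * C, fun l => ?_⟩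
      rw [norm_mul]
      exact mul_le_mul_of_nonneg_left (hC l) (norm_nonneg _)
    · refine (lintegral_mono fun s => iSup_le fun l => ?_).trans_lt hD.lintegral_lt
      rw [enorm_mul]
      exact mul_le_mul' (le_iSup (fun l => ‖Φ l s‖ₑ) l₁) (le_iSup (fun l => ‖Ψ l s‖ₑ) l)
  · exact (hc.comp measurable_snd).mul hD.meas_left
  · intro s
    obtain ⟨C, hC⟩ := hD.bdd_left s
    refine ⟨‖⟪y', bfc a₂ (fun l => Ψ l s) x⟫_ℂ‖ * C, fun l => ?_⟩
    rw [norm_mul]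
    exact mul_le_mul_of_nonneg_left (hC l) (norm_nonneg _)
  · refine (lintegral_mono (g := fun s => (‖y'‖ₑ * ‖x‖ₑ) * ((⨆ x, ‖Φ x s‖ₑ) * (⨆ x, ‖Ψ x s‖ₑ)))
      fun s => iSup_le fun l => ?_).trans_lt ?_
    · rw [enorm_mul]
      change _ ≤ (‖y'‖ₑ * ‖x‖ₑ) * ((⨆ x, ‖Φ x s‖ₑ) * (⨆ x, ‖Ψ x s‖ₑ))
      rw [mul_comm (⨆ x, ‖Φ x s‖ₑ), ← mul_assoc]
      exact mul_le_mul' (enorm_inner_bfc_le h₂ (bddMeas_section hD.meas_right hD.bdd_right s) _ _)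
        (le_iSup (fun l => ‖Φ l s‖ₑ) l)
    · have hne : ‖y'‖ₑ * ‖x‖ₑ ≠ ∞ := ENNReal.mul_ne_top enorm_ne_top enorm_ne_top
      rw [lintegral_const_mul' _ _ hne]
      exact ENNReal.mul_lt_top hne.lt_top hD.lintegral_lt

theorem IsDecomp.sotMeasurable (hD : IsDecomp ρ Φ Ψ) (b : H →L[ℂ] H) :
    SOTMeasurable fun s => bfc a₁ (fun l => Φ l s) * b * bfc a₂ (fun l => Ψ l s) :=
  ((sotMeasurable_bfc h₁ hD.meas_left hD.bdd_left).mul (.const b)).mul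
    (sotMeasurable_bfc h₂ hD.meas_right hD.bdd_right)

theorem IsDecomp.enorm_le (hD : IsDecomp ρ Φ Ψ) (b : H →L[ℂ] H) (s : S) :
    ‖bfc a₁ (fun l => Φ l s) * b * bfc a₂ (fun l => Ψ l s)‖ₑ
      ≤ ‖b‖ₑ * ((⨆ x, ‖Φ x s‖ₑ) * (⨆ x, ‖Ψ x s‖ₑ)) := by
  refine (clm_enorm_mul_le _ _).trans ((mul_le_mul' (clm_enorm_mul_le _ _) le_rfl).trans ?_)
  rw [mul_comm _ ‖b‖ₑ, mul_assoc]
  exact mul_le_mul' le_rfl (mul_le_mul'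
    (enorm_bfc_le h₁ (bddMeas_section hD.meas_left hD.bdd_left s))
    (enorm_bfc_le h₂ (bddMeas_section hD.meas_right hD.bdd_right s)))

/-- Dominated convergence: the projections are contractions, so the bound for `b` dominates every
integrand, and they converge on exactly the vectors `Ψ(a₂, s) x` that occur. -/
theorem IsDecomp.tendsto_proj (hD : IsDecomp ρ Φ Ψ) (b : H →L[ℂ] H) (y x : H)
    {V : ℕ → Submodule ℂ H} [∀ n, FiniteDimensional ℂ (V n)]
    (hV : ∀ s, Filter.Tendsto (fun n => (V n).starProjection (bfc a₂ (fun l => Ψ l s) x))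
      Filter.atTop (𝓝 (bfc a₂ (fun l => Ψ l s) x))) :
    Filter.Tendsto (fun n => ∫ s, ⟪y, (bfc a₁ (fun l => Φ l s) * (b * (V n).starProjection)
      * bfc a₂ (fun l => Ψ l s)) x⟫_ℂ ∂ρ) Filter.atTop
      (𝓝 (∫ s, ⟪y, (bfc a₁ (fun l => Φ l s) * b * bfc a₂ (fun l => Ψ l s)) x⟫_ℂ ∂ρ)) := by
  obtain ⟨g, hg, -, hbound⟩ := exists_integrable_norm_majorant hD.lintegral_lt
  have hne : (‖y‖ₑ * ‖x‖ₑ) * ‖b‖ₑ ≠ ∞ :=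
    ENNReal.mul_ne_top (ENNReal.mul_ne_top enorm_ne_top enorm_ne_top) enorm_ne_top
  refine tendsto_integral_of_dominated_convergence
    (fun s => ((‖y‖ₑ * ‖x‖ₑ) * ‖b‖ₑ).toReal * g s) (fun n => ?_) (hg.const_mul _) (fun n => ?_)
    (ae_of_all _ fun s => ?_)
  · exact ((hD.sotMeasurable h₁ h₂ _).measurable_inner y x).aestronglyMeasurable
  · refine hbound _ _ hne ((hD.sotMeasurable h₁ h₂ _).measurable_inner y x) fun s => ?_
    refine (enorm_inner_apply_le _ _ _).trans ?_
    rw [mul_assoc (‖y‖ₑ * ‖x‖ₑ) ‖b‖ₑ]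
    refine mul_le_mul' le_rfl ((hD.enorm_le h₁ h₂ _ s).trans (mul_le_mul' ?_ le_rfl))
    rw [← ofReal_norm, ← ofReal_norm]
    refine ENNReal.ofReal_le_ofReal ((norm_mul_le _ _).trans ?_)
    exact mul_le_of_le_one_right (norm_nonneg _) (V n).starProjection_norm_le
  · have := (((bfc a₁ (fun l => Φ l s)).continuous.comp b.continuous).tendsto _).comp (hV s)
    exact (tendsto_const_nhds (x := y)).inner this

/-- Expanding the projection in an orthonormal basis reduces to rank one operators. The right side
sees `Φ` and `Ψ` only through `∫ Φ Ψ`, which is what makes the integral independent of the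
decomposition. -/
theorem IsDecomp.integral_finite_rank (hD : IsDecomp ρ Φ Ψ) (b : H →L[ℂ] H) (y x : H)
    (V : Submodule ℂ H) [FiniteDimensional ℂ V] :
    ∫ s, ⟪y, (bfc a₁ (fun l => Φ l s) * (b * V.starProjection) * bfc a₂ (fun l => Ψ l s)) x⟫_ℂ ∂ρ
      = ∑ i, ⟪y, bfc a₁ (fun l₁ => ⟪(stdOrthonormalBasis ℂ V i : H),
          bfc a₂ (fun l₂ => ∫ s, Φ l₁ s * Ψ l₂ s ∂ρ) x⟫_ℂ) (b (stdOrthonormalBasis ℂ V i))⟫_ℂ := by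
  simp_rw [← integral_inner_mul_inner h₁ h₂ hD]
  rw [← integral_finsetSum]
  · congr 1
    ext s
    have := (stdOrthonormalBasis ℂ V).starProjection_eq_sum_rankOne
    simp only [mul_apply_eq_comp, this, sum_apply,
      InnerProductSpace.rankOne_apply, map_sum, map_smul, inner_sum, inner_smul_right]
    exact Finset.sum_congr rfl fun i _ => mul_comm _ _
  · intro i _
    refine integrable_of_enorm_le hD.lintegral_lt
      (C := (‖y‖ₑ * ‖b (stdOrthonormalBasis ℂ V i)‖ₑ) * (‖(stdOrthonormalBasis ℂ V i : H)‖ₑ * ‖x‖ₑ))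
      (ENNReal.mul_ne_top (ENNReal.mul_ne_top enorm_ne_top enorm_ne_top)
        (ENNReal.mul_ne_top enorm_ne_top enorm_ne_top))
      (((sotMeasurable_bfc h₁ hD.meas_left hD.bdd_left).measurable_inner _ _).mul
        ((sotMeasurable_bfc h₂ hD.meas_right hD.bdd_right).measurable_inner _ _)) fun s => ?_
    rw [enorm_mul, mul_mul_mul_comm]
    exact mul_le_mul'
      (enorm_inner_bfc_le h₁ (bddMeas_section hD.meas_left hD.bdd_left s) _ _)
      (enorm_inner_bfc_le h₂ (bddMeas_section hD.meas_right hD.bdd_right s) _ _)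

/-- Double operator integrals do not depend on the decomposition. -/
theorem IsDecomp.integral_eq {S' : Type*} [MeasurableSpace S'] {ρ' : Measure S'} [SFinite ρ']
    {Φ' Ψ' : ℝ → S' → ℂ} (hD : IsDecomp ρ Φ Ψ) (hD' : IsDecomp ρ' Φ' Ψ')
    (heq : ∀ l₁ ∈ spectrum ℝ a₁, ∀ l₂ ∈ spectrum ℝ a₂,
      ∫ s, Φ l₁ s * Ψ l₂ s ∂ρ = ∫ s, Φ' l₁ s * Ψ' l₂ s ∂ρ')
    (b : H →L[ℂ] H) (y x : H) :
    ∫ s, ⟪y, (bfc a₁ (fun l => Φ l s) * b * bfc a₂ (fun l => Ψ l s)) x⟫_ℂ ∂ρ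
      = ∫ s, ⟪y, (bfc a₁ (fun l => Φ' l s) * b * bfc a₂ (fun l => Ψ' l s)) x⟫_ℂ ∂ρ' := by
  -- A single sequence of subspaces serves both decompositions, so the two sides can be compared for
  -- each `n`.
  obtain ⟨V, hV, hlim⟩ := exists_proj_tendsto
    ((sotMeasurable_bfc h₂ hD.meas_right hD.bdd_right x).isSeparable_range.union
      (sotMeasurable_bfc h₂ hD'.meas_right hD'.bdd_right x).isSeparable_range)
  have l1 := hD.tendsto_proj h₁ h₂ b y x (fun s => hlim _ (Or.inl ⟨s, rfl⟩))
  have l2 := hD'.tendsto_proj h₁ h₂ b y x (fun s => hlim _ (Or.inr ⟨s, rfl⟩))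
  refine tendsto_nhds_unique l1 (l2.congr fun n => ?_)
  rw [hD.integral_finite_rank h₁ h₂, hD'.integral_finite_rank h₁ h₂]
  refine Finset.sum_congr rfl fun i _ => ?_
  congr 2
  refine bfc_congr fun l₁ hl₁ => ?_
  have : bfc a₂ (fun l₂ => ∫ s, Φ' l₁ s * Ψ' l₂ s ∂ρ')
      = bfc a₂ (fun l₂ => ∫ s, Φ l₁ s * Ψ l₂ s ∂ρ) :=
    bfc_congr fun l₂ hl₂ => (heq l₁ hl₁ l₂ hl₂).symm
  simp only [this]

end Independence

/-! ### Decompositions on subsets of the real line -/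

namespace IPD

section Extend

variable {n : ℕ} {σ : Fin n → Set ℝ} {φ : (∀ j, σ j) → ℂ} (D : IPD.{w} φ)

open Classical in
/-- The components of a decomposition on subsets of the real line, extended by zero. -/
noncomputable def extend (j : Fin n) (x : ℝ) (s : D.S) : ℂ :=
  if h : x ∈ σ j then D.comp j ⟨x, h⟩ s else 0

theorem extend_coe (j : Fin n) (l : σ j) (s : D.S) : D.extend j l s = D.comp j l s := by
  simp [extend]

theorem measurable_extend (hσ : ∀ j, MeasurableSet (σ j)) (j : Fin n) :
    Measurable (Function.uncurry (D.extend j)) := by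
  have hm : MeasurableSet {p : ℝ × D.S | p.1 ∈ σ j} := measurable_fst (hσ j)
  refine measurable_of_restrict_of_restrict_compl hm ?_ ?_
  · have : ({p : ℝ × D.S | p.1 ∈ σ j}.domRestrict (Function.uncurry (D.extend j)))
        = fun p => Function.uncurry (D.comp j) (⟨p.1.1, p.2⟩, p.1.2) := by
      ext p
      exact dif_pos p.2
    rw [this]
    exact (D.measurable_comp j).comp
      (((measurable_fst.comp measurable_subtype_coe).subtype_mk).prodMk
        (measurable_snd.comp measurable_subtype_coe))
  · have : ({p : ℝ × D.S | p.1 ∈ σ j}ᶜ.domRestrict (Function.uncurry (D.extend j)))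
        = fun _ => 0 := by
      ext p
      exact dif_neg p.2
    rw [this]
    exact measurable_const

theorem bdd_extend (j : Fin n) (s : D.S) : ∃ C : ℝ, ∀ x, ‖D.extend j x s‖ ≤ C := by
  obtain ⟨C, hC⟩ := D.bounded_comp j s
  refine ⟨max C 0, fun x => ?_⟩
  unfold extend
  split_ifs with h
  · exact (hC _).trans (le_max_left _ _)
  · simp

theorem iSup_extend_le (j : Fin n) (s : D.S) :
    ⨆ x, ‖D.extend j x s‖ₑ ≤ ⨆ l, ‖D.comp j l s‖ₑ := by
  refine iSup_le fun x => ?_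
  unfold extend
  split_ifs with h
  · exact le_iSup (fun l => ‖D.comp j l s‖ₑ) _
  · simp

theorem lintegral_extend_lt : ∫⁻ s, ∏ j, (⨆ x, ‖D.extend j x s‖ₑ) ∂D.ρ < ∞ :=
  (lintegral_mono fun s => Finset.prod_le_prod' fun j _ => D.iSup_extend_le j s).trans_lt
    D.lintegral_lt_top

theorem integral_extend (l : ∀ j, σ j) :
    ∫ s, ∏ j, D.extend j (l j) s ∂D.ρ = φ l := by
  simp_rw [extend_coe]
  exact (D.eq_integral l).symm

/-- Restriction of a decomposition to smaller sets. -/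
def restrict {σ' : Fin n → Set ℝ} (h : ∀ j, σ' j ⊆ σ j) (ψ : (∀ j, σ' j) → ℂ)
    (hψ : ∀ l, ψ l = φ fun j => ⟨l j, h j (l j).2⟩) : IPD.{w} ψ where
  S := D.S
  ρ := D.ρ
  comp j l s := D.comp j ⟨l, h j l.2⟩ s
  measurable_comp j := (D.measurable_comp j).comp
    (g := Function.uncurry (D.comp j))
    (f := fun p : σ' j × D.S => ((⟨p.1, h j p.1.2⟩ : σ j), p.2))
    (((measurable_subtype_coe.comp measurable_fst).subtype_mk).prodMk measurable_snd)
  bounded_comp j s := (D.bounded_comp j s).imp fun _ hC _ => hC _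
  lintegral_lt_top := (lintegral_mono fun s => Finset.prod_le_prod' fun j _ =>
    iSup_le fun l => le_iSup (fun l => ‖D.comp j l s‖ₑ) _).trans_lt D.lintegral_lt_top
  eq_integral l := by rw [hψ, D.eq_integral]

end Extend

end IPD

/-- An infimum over an empty family would be `∞`, so finiteness of the tensor norm supplies a
decomposition on a cube `[-r, r]³` large enough to contain the given sets, which is then restricted.
-/
theorem nonempty_ipd_divDiff {f : ℝ → ℂ} (hf : f ∈ SuperC 2) {σ : Fin 3 → Set ℝ}
    (hσ : ∀ j, Bornology.IsBounded (σ j)) :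
    Nonempty (IPD.{0} (Ω := fun j => σ j) fun l => divDiff f 2 fun j => (l j : ℝ)) := by
  have hU : Bornology.IsBounded (⋃ j, σ j) := (Bornology.isBounded_iUnion).2 hσ
  obtain ⟨r, hr, hrU⟩ := hU.subset_ball_lt 0 0
  have hlt : iptpNorm (Ω := fun _ : Fin 3 => Set.Icc (-r) r)
      (fun x => divDiff f 2 (fun i => (x i : ℝ))) < ∞ := by
    refine lt_of_le_of_lt ?_ (hf.2 r hr)
    exact Finset.single_le_sum (f := fun j => divDiffNorm f r j) (fun _ _ => zero_le)
      (Finset.mem_range.2 (by norm_num : 2 < 2 + 1))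
  obtain ⟨D, -⟩ := iInf_lt_iff.1 hlt
  refine ⟨IPD.restrict (σ := fun _ => Set.Icc (-r) r) D (fun j x hx => ?_) _ fun l => rfl⟩
  have := hrU (Set.mem_iUnion_of_mem j hx)
  rw [Metric.mem_ball, dist_zero_right, Real.norm_eq_abs] at this
  exact abs_le.1 this.le

/-! ### Multiple operator integrals -/

section MOI

variable {H : Type*} [NormedAddCommGroup H] [InnerProductSpace ℂ H] [CompleteSpace H]

theorem measurableSet_spectrum (a : H →L[ℂ] H) : MeasurableSet (spectrum ℝ a) :=
  (spectrum.isClosed a).measurableSet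

theorem borelFC_comp_eq {n : ℕ} {a : Fin n → H →L[ℂ] H} {φ : (∀ j, spectrum ℝ (a j)) → ℂ}
    (D : IPD.{w} φ) (j : Fin n) (s : D.S) :
    borelFC (a j) (fun l => D.comp j l s) = bfc (a j) (fun x => D.extend j x s) := by
  unfold bfc
  congr 1
  ext l
  exact (D.extend_coe (σ := fun j => spectrum ℝ (a j)) j l s).symm

variable {S : Type*} [MeasurableSpace S]

theorem SOTMeasurable.list_prod {k : ℕ} {F : Fin k → S → H →L[ℂ] H}
    (hF : ∀ j, SOTMeasurable (F j)) : SOTMeasurable fun s => (List.ofFn fun j => F j s).prod := by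
  induction k with
  | zero => simpa using SOTMeasurable.const 1
  | succ k ih =>
    simp only [List.ofFn_succ, List.prod_cons]
    exact (hF 0).mul (ih fun j => hF j.succ)

theorem enorm_list_prod_le {k : ℕ} (F : Fin k → H →L[ℂ] H) :
    ‖(List.ofFn F).prod‖ₑ ≤ ∏ j, ‖F j‖ₑ := by
  induction k with
  | zero =>
    simp only [List.ofFn_zero, List.prod_nil, Finset.univ_eq_empty, Finset.prod_empty]
    rw [← ofReal_norm]
    -- Only `‖1‖ ≤ 1` holds in general: on the zero space the identity has norm `0`.
    exact (ENNReal.ofReal_le_ofReal ContinuousLinearMap.norm_id_le).trans (by simp)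
  | succ k ih =>
    rw [List.ofFn_succ, List.prod_cons, Fin.prod_univ_succ]
    exact (clm_enorm_mul_le _ _).trans (mul_le_mul' le_rfl (ih _))

variable {k : ℕ} {a : Fin (k + 1) → H →L[ℂ] H} (ha : ∀ j, IsSelfAdjoint (a j))
include ha

theorem exists_pettis_moiIntegrand {φ : (∀ j, spectrum ℝ (a j)) → ℂ} (D : IPD.{w} φ)
    (b : Fin k → H →L[ℂ] H) : ∃ T, IsPettisIntegral D.ρ (moiIntegrand a D b) T := by
  have hm : ∀ j, SOTMeasurable fun s => borelFC (a j) (fun l => D.comp j l s) := by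
    intro j
    simp_rw [borelFC_comp_eq D j]
    exact sotMeasurable_bfc (ha j)
      (D.measurable_extend (σ := fun j => spectrum ℝ (a j)) (fun j => measurableSet_spectrum _) j)
      (D.bdd_extend (σ := fun j => spectrum ℝ (a j)) j)
  have hle : ∀ j s, ‖borelFC (a j) (fun l => D.comp j l s)‖ₑ ≤ ⨆ x, ‖D.extend j x s‖ₑ := by
    intro j s
    rw [borelFC_comp_eq D j]
    exact enorm_bfc_le (ha j) (bddMeas_section
      (D.measurable_extend (σ := fun j => spectrum ℝ (a j)) (fun j => measurableSet_spectrum _) j)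
      (D.bdd_extend (σ := fun j => spectrum ℝ (a j)) j) s)
  refine SOTMeasurable.exists_pettis
    (G := fun s => (∏ j, ‖b j‖ₑ) * ∏ j, (⨆ x, ‖D.extend j x s‖ₑ)) ?_ ?_ fun s => ?_
  · exact (SOTMeasurable.list_prod fun j => (hm _).mul (.const _)).mul (hm _)
  · have hne : (∏ j, ‖b j‖ₑ) ≠ ∞ := ENNReal.prod_ne_top fun j _ => enorm_ne_top
    rw [lintegral_const_mul' _ _ hne]
    exact ENNReal.mul_lt_top hne.lt_top D.lintegral_extend_lt
  · refine (clm_enorm_mul_le _ _).trans ?_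
    rw [Fin.prod_univ_castSucc (n := k), ← mul_assoc]
    refine mul_le_mul' ((enorm_list_prod_le _).trans ?_) (hle _ s)
    rw [← Finset.prod_mul_distrib]
    refine Finset.prod_le_prod' fun j _ => (clm_enorm_mul_le _ _).trans ?_
    rw [mul_comm]
    exact mul_le_mul' le_rfl (hle _ s)

/-- Makes the decomposition chosen inside `moi` explicit, the same one for all `b`. -/
theorem exists_isPettisIntegral_moi {φ : (∀ j, spectrum ℝ (a j)) → ℂ}
    (h : Nonempty (IPD.{0} φ)) : ∃ D : IPD.{0} φ, ∀ b,
      IsPettisIntegral D.ρ (moiIntegrand a D b) (moi a φ b) := by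
  refine ⟨h.some, fun b => ?_⟩
  unfold moi
  rw [dif_pos h]
  exact isPettisIntegral_pettisIntegral (exists_pettis_moiIntegrand ha _ _)

end MOI

/-! ### Functional calculus in a von Neumann algebra -/

section VN

variable {H : Type*} [NormedAddCommGroup H] [InnerProductSpace ℂ H] [CompleteSpace H]
variable {K : Type*} [NormedAddCommGroup K] [InnerProductSpace ℂ K] [CompleteSpace K]

theorem clm_ext_of_dense_span {W : Set K} (hW : Dense (Submodule.span ℂ W : Set K))
    {T U : K →L[ℂ] K} (h : ∀ y ∈ W, ∀ x ∈ W, ⟪y, T x⟫_ℂ = ⟪y, U x⟫_ℂ) : T = U := by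
  have h1 : ∀ x ∈ W, T x = U x := by
    intro x hx
    have : innerSL ℂ (T x) = innerSL ℂ (U x) := by
      refine ContinuousLinearMap.ext_on hW fun y hy => ?_
      rw [innerSL_apply_apply, innerSL_apply_apply, ← inner_conj_symm, h y hy x hx, inner_conj_symm]
    exact (innerSL_inj (𝕜 := ℂ)).1 this
  exact ContinuousLinearMap.ext_on hW h1

/-- Truncation of the real line to `[-r, r]`. -/
noncomputable def clamp (r x : ℝ) : ℝ := max (-r) (min r x)

theorem continuous_clamp (r : ℝ) : Continuous (clamp r) := by
  unfold clamp; fun_prop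

theorem clamp_mem {r : ℝ} (hr : 0 ≤ r) (x : ℝ) : clamp r x ∈ Set.Icc (-r) r :=
  ⟨le_max_left _ _, max_le (by linarith) (min_le_left _ _)⟩

theorem clamp_of_mem {r x : ℝ} (h : x ∈ Set.Icc (-r) r) : clamp r x = x := by
  rw [clamp, min_eq_right h.2, max_eq_right h.1]

theorem mem_Icc_of_mem_spectrum {a : H →L[ℂ] H} {r x : ℝ} (hr : ‖a‖ ≤ r)
    (hx : x ∈ spectrum ℝ a) : x ∈ Set.Icc (-r) r := by
  have h1 : ‖x‖ ≤ ‖a‖ := by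
    have hx' : (x : ℂ) ∈ spectrum ℂ a := by
      rw [← spectrum.algebraMap_mem_iff ℂ] at hx
      exact hx
    have : Nontrivial H := by
      by_contra h
      rw [not_nontrivial_iff_subsingleton] at h
      have : Subsingleton (H →L[ℂ] H) := ⟨fun T U => ContinuousLinearMap.ext fun x =>
        Subsingleton.elim _ _⟩
      rw [spectrum.of_subsingleton] at hx
      exact hx
    simpa using spectrum.norm_le_norm_of_mem hx'
  exact abs_le.1 (h1.trans hr)

theorem bddMeas_comp_clamp {g : ℝ → ℝ} (hg : Continuous g) {r : ℝ} (hr : 0 ≤ r) :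
    ∃ C, ∀ x, |g (clamp r x)| ≤ C := by
  obtain ⟨C, hC⟩ := isCompact_Icc.exists_bound_of_continuousOn (s := Set.Icc (-r) r)
    hg.continuousOn
  exact ⟨C, fun x => hC _ (clamp_mem hr x)⟩

/-- Polynomials are unbounded on `ℝ`; clamping to an interval that contains the spectrum makes them
admissible without changing the operator. -/
theorem bfc_polynomial {a : H →L[ℂ] H} (ha : IsSelfAdjoint a) {r : ℝ} (hr : ‖a‖ ≤ r)
    (p : Polynomial ℝ) :
    bfc a (fun x => ((p.eval (clamp r x) : ℝ) : ℂ)) = Polynomial.aeval a p := by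
  have hr0 : 0 ≤ r := (norm_nonneg _).trans hr
  rw [bfc_ofReal ha (g := fun x => p.eval (clamp r x)) (p.continuous.comp (continuous_clamp r))
    (bddMeas_comp_clamp p.continuous hr0), ← cfc_polynomial p a]
  exact cfc_congr fun x hx => by
    simp only [clamp_of_mem (mem_Icc_of_mem_spectrum hr hx)]

variable {M : VonNeumannAlgebra H}

theorem isSelfAdjoint_coe {m : M} (hm : IsSelfAdjoint m) : IsSelfAdjoint (m : H →L[ℂ] H) :=
  congrArg Subtype.val hm

theorem bfc_mem {m : M} (hm : IsSelfAdjoint m) {φ : ℝ → ℂ} (hφ : BddMeas φ) :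
    bfc (m : H →L[ℂ] H) φ ∈ M := by
  rw [← SetLike.mem_coe, ← M.centralizer_centralizer, Set.mem_centralizer_iff]
  intro y hy
  have hc : Commute (m : H →L[ℂ] H) y := hy m m.2
  exact (commute_bfc (isSelfAdjoint_coe hm) hc hφ).eq.symm

/-- Bounded Borel functional calculus in `M` for functions on the real line. -/
noncomputable def bfcM (m : M) (φ : ℝ → ℂ) : M := borelFCMem m fun l => φ l

theorem coe_bfcM {m : M} (hm : IsSelfAdjoint m) {φ : ℝ → ℂ} (hφ : BddMeas φ) :
    (bfcM m φ : H →L[ℂ] H) = bfc (m : H →L[ℂ] H) φ := by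
  unfold bfcM borelFCMem
  rw [dif_pos (show borelFC (m : H →L[ℂ] H) (fun l => φ l) ∈ M from bfc_mem hm hφ)]
  rfl

theorem bfcM_add {m : M} (hm : IsSelfAdjoint m) {φ ψ : ℝ → ℂ} (hφ : BddMeas φ) (hψ : BddMeas ψ) :
    bfcM m (φ + ψ) = bfcM m φ + bfcM m ψ :=
  Subtype.ext <| by
    change ((bfcM m (φ + ψ) : M) : H →L[ℂ] H) = (bfcM m φ : H →L[ℂ] H) + bfcM m ψ
    rw [coe_bfcM hm (hφ.add hψ), coe_bfcM hm hφ, coe_bfcM hm hψ, bfc_add (isSelfAdjoint_coe hm) hφ hψ]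

theorem bfcM_smul {m : M} (hm : IsSelfAdjoint m) (c : ℂ) {φ : ℝ → ℂ} (hφ : BddMeas φ) :
    bfcM m (c • φ) = c • bfcM m φ :=
  Subtype.ext <| by
    change ((bfcM m (c • φ) : M) : H →L[ℂ] H) = c • (bfcM m φ : H →L[ℂ] H)
    rw [coe_bfcM hm (hφ.smul c), coe_bfcM hm hφ, bfc_smul (isSelfAdjoint_coe hm) c hφ]

theorem bfcM_congr {m : M} {φ ψ : ℝ → ℂ}
    (h : Set.EqOn φ ψ (spectrum ℝ (m : H →L[ℂ] H))) : bfcM m φ = bfcM m ψ := by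
  unfold bfcM
  congr 1
  ext l
  exact h l.2

/-- A linear map that preserves the powers of `m` and is continuous along the bounded Borel
functional calculus of `m` intertwines the functional calculi. -/
theorem map_bfcM {m : M} (hm : IsSelfAdjoint m) (π : M →ₗ[ℂ] (K →L[ℂ] K))
    (hπ : IsSelfAdjoint (π m)) (hpow : ∀ n, π (m ^ n) = π m ^ n)
    {W : Set K} (hW : Dense (Submodule.span ℂ W : Set K))
    (hcont : ∀ (F : ℕ → ℝ → ℂ) (f : ℝ → ℂ) (C : ℝ), (∀ n, Measurable (F n)) → Measurable f →
      (∀ n x, ‖F n x‖ ≤ C) → (∀ x, Filter.Tendsto (fun n => F n x) Filter.atTop (𝓝 (f x))) →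
      ∀ y ∈ W, ∀ x ∈ W, Filter.Tendsto (fun n => ⟪y, π (bfcM m (F n)) x⟫_ℂ) Filter.atTop
        (𝓝 ⟪y, π (bfcM m f) x⟫_ℂ))
    {φ : ℝ → ℂ} (hφ : BddMeas φ) : π (bfcM m φ) = bfc (π m) φ := by
  have ha := isSelfAdjoint_coe hm
  have hlim' : ∀ (F : ℕ → ℝ → ℂ) (f : ℝ → ℂ) (C : ℝ), (∀ n, Measurable (F n)) → Measurable f →
      (∀ n x, ‖F n x‖ ≤ C) → (∀ x, Filter.Tendsto (fun n => F n x) Filter.atTop (𝓝 (f x))) →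
      (∀ n, π (bfcM m (F n)) = bfc (π m) (F n)) → π (bfcM m f) = bfc (π m) f := by
    intro F f C hF hf hC hlim ih
    refine clm_ext_of_dense_span hW fun y hy x hx => ?_
    refine tendsto_nhds_unique (hcont F f C hF hf hC hlim y hy x hx) ?_
    simp_rw [ih]
    exact tendsto_inner_bfc hπ hF hf hC hlim y x
  -- Linearity and powers suffice for polynomials. Multiplicativity of `π` is not assumed, as `b ↦ 1
  -- ⊗ b` into `M ⊗ M^op` reverses products.
  have hpoly : ∀ p : Polynomial ℝ, ∃ q : M, (q : H →L[ℂ] H) = Polynomial.aeval (m : H →L[ℂ] H) p ∧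
      π q = Polynomial.aeval (π m) p := by
    intro p
    induction p using Polynomial.induction_on' with
    | add p q hp hq =>
      obtain ⟨x, hx, hx'⟩ := hp
      obtain ⟨y, hy, hy'⟩ := hq
      exact ⟨x + y, by rw [map_add, ← hx, ← hy]; rfl, by rw [map_add, map_add, hx', hy']⟩
    | monomial n c =>
      refine ⟨(c : ℂ) • m ^ n, ?_, ?_⟩
      · rw [Polynomial.aeval_monomial, ← Algebra.smul_def, ← Complex.coe_smul]
        rfl
      · rw [Polynomial.aeval_monomial, ← Algebra.smul_def, map_smul, hpow, ← Complex.coe_smul]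
  -- One radius for both operators, so that clamping is the identity on both spectra.
  set r := max ‖(m : H →L[ℂ] H)‖ ‖π m‖ with hr
  have hr1 : ‖(m : H →L[ℂ] H)‖ ≤ r := le_max_left _ _
  have hr2 : ‖π m‖ ≤ r := le_max_right _ _
  have hr0 : 0 ≤ r := (norm_nonneg _).trans hr1
  have hp : ∀ p : Polynomial ℝ, π (bfcM m fun x => ((p.eval (clamp r x) : ℝ) : ℂ))
      = bfc (π m) fun x => ((p.eval (clamp r x) : ℝ) : ℂ) := by
    intro p
    obtain ⟨q, hq, hq'⟩ := hpoly p
    have : (bfcM m fun x => ((p.eval (clamp r x) : ℝ) : ℂ)) = q := by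
      refine Subtype.ext ?_
      rw [coe_bfcM hm, bfc_polynomial ha hr1, hq]
      exact bddMeas_ofReal (p.continuous.comp (continuous_clamp r))
        (bddMeas_comp_clamp p.continuous hr0)
    rw [this, hq', bfc_polynomial hπ hr2]
  refine BddMeas.induction_continuous (P := fun φ => π (bfcM m φ) = bfc (π m) φ) ?_ ?_ ?_ hlim' hφ
  · intro g hg hgb
    obtain ⟨C, hC⟩ := hgb
    -- Weierstrass approximation on `[-r, r]` with error `1 / (n + 1) ≤ 1`; this yields the uniform
    -- bound `C + 1` below.
    have hex : ∀ n : ℕ, ∃ p : Polynomial ℝ, ∀ x ∈ Set.Icc (-r) r,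
        |p.eval x - g x| < 1 / ((n : ℝ) + 1) := fun n =>
      exists_polynomial_near_of_continuousOn _ _ g hg.continuousOn _ (by positivity)
    choose p hpn using hex
    have h1 : π (bfcM m fun x => ((g (clamp r x) : ℝ) : ℂ))
        = bfc (π m) fun x => ((g (clamp r x) : ℝ) : ℂ) := by
      refine hlim' (fun n x => (((p n).eval (clamp r x) : ℝ) : ℂ)) _ (C + 1) (fun n => ?_) ?_
        (fun n x => ?_) (fun x => ?_) (fun n => hp _)
      · exact (Complex.continuous_ofReal.comp
          ((p n).continuous.comp (continuous_clamp r))).measurable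
      · exact (Complex.continuous_ofReal.comp (hg.comp (continuous_clamp r))).measurable
      · rw [Complex.norm_real, Real.norm_eq_abs]
        have e1 := hpn n _ (clamp_mem hr0 x)
        have e2 : 1 / ((n : ℝ) + 1) ≤ 1 := by
          rw [div_le_one (by positivity)]
          linarith [n.cast_nonneg (α := ℝ)]
        have e3 := hC (clamp r x)
        have e4 := abs_sub_abs_le_abs_sub ((p n).eval (clamp r x)) (g (clamp r x))
        linarith
      · refine (Complex.continuous_ofReal.tendsto _).comp ?_
        rw [tendsto_iff_norm_sub_tendsto_zero]
        exact squeeze_zero (fun n => norm_nonneg _) (fun n => (hpn n _ (clamp_mem hr0 x)).le)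
          tendsto_one_div_add_atTop_nhds_zero_nat
    have h2 : bfcM m (fun x => (g x : ℂ)) = bfcM m fun x => ((g (clamp r x) : ℝ) : ℂ) :=
      bfcM_congr fun x hx => by simp only [clamp_of_mem (mem_Icc_of_mem_spectrum hr1 hx)]
    have h3 : bfc (π m) (fun x => (g x : ℂ)) = bfc (π m) fun x => ((g (clamp r x) : ℝ) : ℂ) :=
      bfc_congr fun x hx => by simp only [clamp_of_mem (mem_Icc_of_mem_spectrum hr2 hx)]
    rw [h2, h3, h1]
  · intro f g hf hg ihf ihg
    rw [bfcM_add hm hf hg, map_add, ihf, ihg, bfc_add hπ hf hg]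
  · intro c f hf ih
    rw [bfcM_smul hm c hf, map_smul, ih, bfc_smul hπ c hf]

/-- An Urysohn function that vanishes on `s` and equals `1` at `l`; a continuous function of `a` is
zero only if it vanishes on the whole spectrum. -/
theorem exists_separating {a : H →L[ℂ] H} (ha : IsSelfAdjoint a) {l : ℝ} (hl : l ∈ spectrum ℝ a)
    {s : Set ℝ} (hs : IsClosed s) (hls : l ∉ s) :
    ∃ φ : ℝ → ℂ, BddMeas φ ∧ Set.EqOn φ 0 s ∧ bfc a φ ≠ 0 := by
  obtain ⟨g, hg0, hg1, hgI⟩ := exists_continuous_zero_one_of_isClosed hs (isClosed_singleton (x := l))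
    (Set.disjoint_singleton_right.2 hls)
  have hb : ∃ C, ∀ x, |g x| ≤ C := ⟨1, fun x => by
    rw [abs_of_nonneg (hgI x).1]; exact (hgI x).2⟩
  refine ⟨fun x => (g x : ℂ), bddMeas_ofReal g.continuous hb, fun x hx => ?_, fun h => ?_⟩
  · simp [hg0 hx]
  · rw [bfc_ofReal ha g.continuous hb, ← cfc_zero ℝ a,
      cfc_eq_cfc_iff_eqOn (R := ℝ) (p := IsSelfAdjoint) (a := a) ha g.continuous.continuousOn
        continuous_zero.continuousOn] at h
    have h1 := h hl
    rw [hg1 rfl] at h1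
    simp at h1

theorem bfc_eq_zero {a : H →L[ℂ] H} (ha : IsSelfAdjoint a) {φ : ℝ → ℂ}
    (hφ : Set.EqOn φ 0 (spectrum ℝ a)) : bfc a φ = 0 := by
  rw [bfc_congr (ψ := (0 : ℂ) • fun _ => 1) (fun x hx => by simp [hφ hx]),
    bfc_smul ha 0 (bddMeas_const 1), zero_smul]

/-- Injectivity makes the two calculi kill the same functions, whereas a point in just one of the
closed spectra would yield a function killed by only one of them. -/
theorem spectrum_map_eq {m : M} (hm : IsSelfAdjoint m) (π : M →ₗ[ℂ] (K →L[ℂ] K))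
    (hπ : IsSelfAdjoint (π m)) (hinj : ∀ x, π x = 0 → x = 0)
    (h : ∀ φ, BddMeas φ → π (bfcM m φ) = bfc (π m) φ) :
    spectrum ℝ (π m) = spectrum ℝ (m : H →L[ℂ] H) := by
  have hz : ∀ φ : ℝ → ℂ, BddMeas φ → (bfc (π m) φ = 0 ↔ bfc (m : H →L[ℂ] H) φ = 0) := by
    intro φ hφ
    rw [← h φ hφ, ← coe_bfcM hm hφ]
    constructor
    · intro h0
      rw [hinj _ h0]
      rfl
    · intro h0
      have : bfcM m φ = 0 := Subtype.ext h0
      rw [this, map_zero]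
  refine Set.Subset.antisymm (fun l hl => ?_) (fun l hl => ?_)
  · by_contra hls
    obtain ⟨φ, hφ, h0, hne⟩ := exists_separating hπ hl (spectrum.isClosed (m : H →L[ℂ] H)) hls
    exact hne ((hz φ hφ).2 (bfc_eq_zero (isSelfAdjoint_coe hm) h0))
  · by_contra hls
    obtain ⟨φ, hφ, h0, hne⟩ := exists_separating (isSelfAdjoint_coe hm) hl
      (spectrum.isClosed (π m)) hls
    exact hne ((hz φ hφ).1 (bfc_eq_zero hπ h0))

end VN

/-! ### Normality of the trace and the standard representation -/

section Normal

variable {H : Type*} [NormedAddCommGroup H] [InnerProductSpace ℂ H] [CompleteSpace H]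
variable {S : Type*} [MeasurableSpace S] {ρ : Measure S}

theorem IsPettisIntegral.mul_mul {F : S → H →L[ℂ] H} {T : H →L[ℂ] H}
    (h : IsPettisIntegral ρ F T) (a b : H →L[ℂ] H) :
    IsPettisIntegral ρ (fun s => a * F s * b) (a * T * b) := by
  intro x y
  have := h (b x) (ContinuousLinearMap.adjoint a y)
  simp only [ContinuousLinearMap.adjoint_inner_left] at this
  exact this

theorem IsPettisIntegral.unique {F : S → H →L[ℂ] H} {T U : H →L[ℂ] H}
    (h : IsPettisIntegral ρ F T) (h' : IsPettisIntegral ρ F U) : T = U :=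
  ContinuousLinearMap.ext fun x => ext_inner_left ℂ fun y => by
    rw [(h x y).2.2, (h' x y).2.2]

namespace VNTrace

variable {M : VonNeumannAlgebra H} (τ : VNTrace M)

/-- Dominated convergence for the series that expresses normality, with bound `C ‖h n‖ ‖k n‖ ≤ C (‖h
n‖² + ‖k n‖²)`. -/
theorem tendsto_trace {X : ℕ → M} {Y : M} {C : ℝ} (hC : ∀ n, ‖(X n : H →L[ℂ] H)‖ ≤ C)
    (hlim : ∀ y x : H, Filter.Tendsto (fun n => ⟪y, (X n : H →L[ℂ] H) x⟫_ℂ) Filter.atTop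
      (𝓝 ⟪y, (Y : H →L[ℂ] H) x⟫_ℂ)) :
    Filter.Tendsto (fun n => τ.toLinearMap (X n)) Filter.atTop (𝓝 (τ.toLinearMap Y)) := by
  obtain ⟨h, k, hh, hk, hτ⟩ := τ.normal
  have hC0 : 0 ≤ C := (norm_nonneg _).trans (hC 0)
  simp_rw [← fun a => (hτ a).tsum_eq]
  refine tendsto_tsum_of_dominated_convergence
    (bound := fun n => C * (‖h n‖ ^ 2 + ‖k n‖ ^ 2)) ((hh.add hk).mul_left C)
    (fun n => hlim _ _) (Filter.Eventually.of_forall fun i n => ?_)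
  calc ‖⟪k n, (X i : H →L[ℂ] H) (h n)⟫_ℂ‖ ≤ ‖k n‖ * ‖(X i : H →L[ℂ] H) (h n)‖ :=
        norm_inner_le_norm _ _
    _ ≤ ‖k n‖ * (C * ‖h n‖) := by
        gcongr
        exact (ContinuousLinearMap.le_opNorm _ _).trans (by gcongr; exact hC i)
    _ ≤ C * (‖h n‖ ^ 2 + ‖k n‖ ^ 2) := by
        nlinarith [sq_nonneg (‖h n‖ - ‖k n‖), sq_nonneg (‖h n‖), sq_nonneg (‖k n‖)]

/-- Normality: the trace commutes with pointwise Pettis integrals. -/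
theorem trace_pettis {F : S → M} {T : M} {G : S → ℝ≥0∞} (hG : ∫⁻ s, G s ∂ρ < ∞)
    (hFG : ∀ s, ‖(F s : H →L[ℂ] H)‖ₑ ≤ G s)
    (hT : IsPettisIntegral ρ (fun s => (F s : H →L[ℂ] H)) T) :
    τ.toLinearMap T = ∫ s, τ.toLinearMap (F s) ∂ρ := by
  obtain ⟨h, k, hh, hk, hτ⟩ := τ.normal
  obtain ⟨g, hg, hg0, hbound⟩ := exists_integrable_norm_majorant hG
  have hs := hh.add hk
  have h1 : HasSum (fun n => ∫ s, ⟪k n, (F s : H →L[ℂ] H) (h n)⟫_ℂ ∂ρ)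
      (∫ s, τ.toLinearMap (F s) ∂ρ) := by
    -- The series and the integral are exchanged using the product majorant `(‖h n‖² + ‖k n‖²)
    -- g(s)`, summable in `n` and integrable in `s`.
    refine hasSum_integral_of_dominated_convergence
      (fun n s => (‖h n‖ ^ 2 + ‖k n‖ ^ 2) * g s)
      (fun n => (hT _ _).1.aestronglyMeasurable) (fun n => ?_)
      (ae_of_all _ fun s => hs.mul_right _) ?_ (ae_of_all _ fun s => hτ (F s))
    · have := hbound (fun s => ⟪k n, (F s : H →L[ℂ] H) (h n)⟫_ℂ) (‖k n‖ₑ * ‖h n‖ₑ)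
        (ENNReal.mul_ne_top enorm_ne_top enorm_ne_top) (hT _ _).1 fun s =>
          (enorm_inner_apply_le _ _ _).trans (mul_le_mul_right (hFG s) _)
      filter_upwards [this] with s hs
      refine hs.trans (mul_le_mul_of_nonneg_right ?_ (hg0 s))
      rw [ENNReal.toReal_mul, toReal_enorm, toReal_enorm]
      nlinarith [sq_nonneg (‖h n‖ - ‖k n‖), sq_nonneg (‖h n‖), sq_nonneg (‖k n‖)]
    · simp_rw [tsum_mul_right]
      exact hg.const_mul _
  have h2 := hτ T
  simp_rw [fun n => (hT (h n) (k n)).2.2] at h2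
  exact h2.unique h1

/-- The vector of `L²(M, τ)` defined by an element of `M`. -/
noncomputable def hat (a : M) : τ.L2 := (τ.pos.toPreGNS a : τ.pos.PreGNS)

/-- The vector of `L²(M^op, τ^op)` defined by an element of `M`. -/
noncomputable def hatOp (a : M) : τ.L2op := (τ.posOp.toPreGNS (op a) : τ.posOp.PreGNS)

theorem inner_hat (a b : M) : ⟪τ.hat a, τ.hat b⟫_ℂ = τ.toLinearMap (star a * b) := by
  unfold hat
  rw [UniformSpace.Completion.inner_coe]
  rfl

theorem inner_hatOp (a b : M) : ⟪τ.hatOp a, τ.hatOp b⟫_ℂ = τ.toLinearMap (b * star a) := by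
  unfold hatOp
  rw [UniformSpace.Completion.inner_coe]
  rfl

theorem rep_hat (a b : M) : τ.rep a (τ.hat b) = τ.hat (a * b) := by
  change τ.pos.gnsNonUnitalStarAlgHom a (τ.pos.toPreGNS b : τ.pos.PreGNS) = _
  rw [PositiveLinearMap.gnsNonUnitalStarAlgHom_apply_coe]
  rfl

theorem repOp_hatOp (a b : M) : τ.repOp (op a) (τ.hatOp b) = τ.hatOp (b * a) := by
  change τ.posOp.gnsNonUnitalStarAlgHom (op a) (τ.posOp.toPreGNS (op b) : τ.posOp.PreGNS) = _
  rw [PositiveLinearMap.gnsNonUnitalStarAlgHom_apply_coe]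
  rfl

theorem dense_span_hat : Dense (Submodule.span ℂ (Set.range τ.hat) : Set τ.L2) := by
  have h : DenseRange τ.hat := UniformSpace.Completion.denseRange_coe (α := τ.pos.PreGNS)
  exact h.mono Submodule.subset_span

theorem dense_span_hatOp : Dense (Submodule.span ℂ (Set.range τ.hatOp) : Set τ.L2op) := by
  have h : DenseRange τ.hatOp := by
    have := UniformSpace.Completion.denseRange_coe (α := τ.posOp.PreGNS)
    refine this.mono ?_
    rintro _ ⟨x, rfl⟩
    exact ⟨unop (τ.posOp.ofPreGNS x), rfl⟩
  exact h.mono Submodule.subset_span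

/-- By faithfulness of `τ`, the vector of `1` is separating for `M`. -/
theorem rep_injective {x : M} (h : τ.rep x = 0) : x = 0 := by
  have h1 : τ.rep x (τ.hat 1) = 0 := by rw [h]; rfl
  rw [rep_hat, mul_one] at h1
  apply τ.faithful
  rw [← inner_hat, h1, inner_zero_left]

theorem enorm_rep_le (x : M) : ‖τ.rep x‖ₑ ≤ ‖(x : H →L[ℂ] H)‖ₑ := by
  rw [← ofReal_norm, ← ofReal_norm]
  exact ENNReal.ofReal_le_ofReal (NonUnitalStarAlgHom.norm_apply_le (τ.pos.gnsStarAlgHom) x)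

theorem tendsto_trace_bfcM {m : M} (hm : IsSelfAdjoint m) {F : ℕ → ℝ → ℂ} {f : ℝ → ℂ} {C : ℝ}
    (hF : ∀ n, Measurable (F n)) (hf : Measurable f) (hC : ∀ n x, ‖F n x‖ ≤ C)
    (hlim : ∀ x, Filter.Tendsto (fun n => F n x) Filter.atTop (𝓝 (f x))) (a b : M) :
    Filter.Tendsto (fun n => τ.toLinearMap (a * bfcM m (F n) * b)) Filter.atTop
      (𝓝 (τ.toLinearMap (a * bfcM m f * b))) := by
  have ha := isSelfAdjoint_coe hm
  have hf' : BddMeas f := ⟨hf, C, fun x =>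
    le_of_tendsto (hlim x).norm (Filter.Eventually.of_forall fun n => hC n x)⟩
  have hcoe : ∀ φ, BddMeas φ → ((a * bfcM m φ * b : M) : H →L[ℂ] H)
      = a * bfc (m : H →L[ℂ] H) φ * b := by
    intro φ hφ
    rw [← coe_bfcM hm hφ]
    rfl
  refine τ.tendsto_trace (C := ‖(a : H →L[ℂ] H)‖ * C * ‖(b : H →L[ℂ] H)‖) (fun n => ?_)
    (fun y x => ?_)
  · rw [hcoe _ ⟨hF n, C, hC n⟩]
    refine (norm_mul_le _ _).trans (mul_le_mul_of_nonneg_right ((norm_mul_le _ _).trans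
      (mul_le_mul_of_nonneg_left (norm_bfc_le ha (hF n) (hC n)) (norm_nonneg _))) (norm_nonneg _))
  · simp_rw [fun n => hcoe _ ⟨hF n, C, hC n⟩, hcoe _ hf', mul_apply_eq_comp,
      ← ContinuousLinearMap.adjoint_inner_left (a : H →L[ℂ] H)]
    exact tendsto_inner_bfc ha hF hf hC hlim _ _

theorem isSelfAdjoint_rep {m : M} (hm : IsSelfAdjoint m) : IsSelfAdjoint (τ.rep m) :=
  hm.map τ.pos.gnsStarAlgHom

theorem isSelfAdjoint_repOp {m : M} (hm : IsSelfAdjoint m) : IsSelfAdjoint (τ.repOp (op m)) := by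
  have : IsSelfAdjoint (op m) := by
    rw [IsSelfAdjoint, ← op_star, hm.star_eq]
  exact this.map τ.posOp.gnsStarAlgHom

/-- Matrix coefficients between vectors of `M` are traces `τ(a^* φ(m) b)`, so normality gives the
continuity that `map_bfcM` asks for. -/
theorem rep_bfcM {m : M} (hm : IsSelfAdjoint m) {φ : ℝ → ℂ} (hφ : BddMeas φ) :
    τ.rep (bfcM m φ) = bfc (τ.rep m) φ := by
  refine map_bfcM hm (τ.pos.gnsStarAlgHom : M →⋆ₐ[ℂ] _).toAlgHom.toLinearMap
    (τ.isSelfAdjoint_rep hm) (fun n => map_pow (τ.pos.gnsStarAlgHom) m n) τ.dense_span_hat ?_ hφ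
  rintro F f C hF hf hC hlim _ ⟨a, rfl⟩ _ ⟨b, rfl⟩
  change Filter.Tendsto (fun n => ⟪τ.hat a, τ.rep (bfcM m (F n)) (τ.hat b)⟫_ℂ) Filter.atTop
    (𝓝 ⟪τ.hat a, τ.rep (bfcM m f) (τ.hat b)⟫_ℂ)
  simp_rw [rep_hat, inner_hat, ← mul_assoc]
  exact τ.tendsto_trace_bfcM hm hF hf hC hlim _ _

theorem repOp_bfcM {m : M} (hm : IsSelfAdjoint m) {φ : ℝ → ℂ} (hφ : BddMeas φ) :
    τ.repOp (op (bfcM m φ)) = bfc (τ.repOp (op m)) φ := by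
  refine map_bfcM hm ((τ.posOp.gnsStarAlgHom : (M)ᵐᵒᵖ →⋆ₐ[ℂ] _).toAlgHom.toLinearMap ∘ₗ
    (opLinearEquiv ℂ).toLinearMap) (τ.isSelfAdjoint_repOp hm)
    (fun n => map_pow (τ.posOp.gnsStarAlgHom) (op m) n) τ.dense_span_hatOp ?_ hφ
  rintro F f C hF hf hC hlim _ ⟨a, rfl⟩ _ ⟨b, rfl⟩
  change Filter.Tendsto (fun n => ⟪τ.hatOp a, τ.repOp (op (bfcM m (F n))) (τ.hatOp b)⟫_ℂ)
    Filter.atTop (𝓝 ⟪τ.hatOp a, τ.repOp (op (bfcM m f)) (τ.hatOp b)⟫_ℂ)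
  simp_rw [repOp_hatOp, inner_hatOp]
  exact τ.tendsto_trace_bfcM hm hF hf hC hlim _ _

theorem spectrum_rep {m : M} (hm : IsSelfAdjoint m) :
    spectrum ℝ (τ.rep m) = spectrum ℝ (m : H →L[ℂ] H) :=
  spectrum_map_eq hm (τ.pos.gnsStarAlgHom : M →⋆ₐ[ℂ] _).toAlgHom.toLinearMap
    (τ.isSelfAdjoint_rep hm) (fun _ h => τ.rep_injective h) fun _ hφ => τ.rep_bfcM hm hφ

/-- Weak integrals over `H` do not transfer to `L²(M, τ)` formally. Domination gives some Pettis
integral there, and normality identifies its coefficients `τ(a^* T b)` on a dense set. -/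
theorem isPettisIntegral_rep {F : S → M} {T : M} {G : S → ℝ≥0∞} (hG : ∫⁻ s, G s ∂ρ < ∞)
    (hFG : ∀ s, ‖(F s : H →L[ℂ] H)‖ₑ ≤ G s) (hF : SOTMeasurable fun s => τ.rep (F s))
    (hT : IsPettisIntegral ρ (fun s => (F s : H →L[ℂ] H)) T) :
    IsPettisIntegral ρ (fun s => τ.rep (F s)) (τ.rep T) := by
  obtain ⟨U, hU⟩ := hF.exists_pettis hG fun s => (τ.enorm_rep_le _).trans (hFG s)
  suffices τ.rep T = U by rwa [this]
  refine clm_ext_of_dense_span τ.dense_span_hat ?_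
  rintro _ ⟨a, rfl⟩ _ ⟨b, rfl⟩
  rw [(hU _ _).2.2]
  simp_rw [rep_hat, inner_hat, ← mul_assoc]
  have hne : ‖((star a : M) : H →L[ℂ] H)‖ₑ * ‖(b : H →L[ℂ] H)‖ₑ ≠ ∞ :=
    ENNReal.mul_ne_top enorm_ne_top enorm_ne_top
  refine τ.trace_pettis (F := fun s => star a * F s * b) (T := star a * T * b)
    (G := fun s => (‖((star a : M) : H →L[ℂ] H)‖ₑ * ‖(b : H →L[ℂ] H)‖ₑ) * G s) ?_ (fun s => ?_)
    (hT.mul_mul _ _)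
  · rw [lintegral_const_mul' _ _ hne]
    exact ENNReal.mul_lt_top hne.lt_top hG
  · change ‖((star a : M) : H →L[ℂ] H) * F s * b‖ₑ ≤ _
    refine (clm_enorm_mul_le _ _).trans ((mul_le_mul' (clm_enorm_mul_le _ _) le_rfl).trans ?_)
    rw [mul_right_comm]
    exact mul_le_mul' le_rfl (hFG s)

/-- Pettis integrals of `M`-valued functions belong to `M`. -/
theorem _root_.FreeIto.IsPettisIntegral.mem {F : S → M} {T : H →L[ℂ] H}
    (hT : IsPettisIntegral ρ (fun s => (F s : H →L[ℂ] H)) T) : T ∈ M := by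
  rw [← SetLike.mem_coe, ← M.centralizer_centralizer, Set.mem_centralizer_iff]
  intro y hy
  have hc : ∀ s, y * (F s : H →L[ℂ] H) = F s * y := fun s => (hy _ (F s).2).symm
  have h1 := hT.mul_mul y 1
  have h2 := hT.mul_mul 1 y
  simp only [one_mul, mul_one] at h1 h2
  simp_rw [hc] at h1
  exact h1.unique h2

end VNTrace

end Normal

/-! ### Algebra of `A ⊗ A^op` -/

section Algebraic

variable {A B : Type*} [Ring A] [Algebra ℂ A] [Ring B] [Algebra ℂ B]

instance instLeftDistribClassTriTensor : LeftDistribClass (TriTensor A) :=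
  ⟨fun x y z => map_add (Algebra.TensorProduct.mul x) y z⟩

instance instRightDistribClassTriTensor : RightDistribClass (TriTensor A) :=
  ⟨fun x y z => LinearMap.congr_fun (map_add Algebra.TensorProduct.mul x y) z⟩

theorem triTensor_mul_zero (x : TriTensor A) : x * 0 = 0 :=
  map_zero (Algebra.TensorProduct.mul x)

theorem triTensor_zero_mul (x : TriTensor A) : 0 * x = 0 :=
  LinearMap.congr_fun (map_zero Algebra.TensorProduct.mul) x

theorem trMulSymm_add_left (τ : A →ₗ[ℂ] ℂ) (u u' v : BiTensor A) (x y z : A) :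
    trMulSymm τ (u + u') v x y z = trMulSymm τ u v x y z + trMulSymm τ u' v x y z := by
  simp only [trMulSymm, map_add, mul_add, add_mul]
  abel

theorem trMulSymm_comm (τ : A →ₗ[ℂ] ℂ) (u v : BiTensor A) (x y z : A) :
    trMulSymm τ u v x y z = trMulSymm τ v u x y z := by
  simp only [trMulSymm, add_comm]

theorem trMulSymm_add_right (τ : A →ₗ[ℂ] ℂ) (u v v' : BiTensor A) (x y z : A) :
    trMulSymm τ u (v + v') x y z = trMulSymm τ u v x y z + trMulSymm τ u v' x y z := by
  rw [trMulSymm_comm, trMulSymm_add_left, trMulSymm_comm, trMulSymm_comm τ v']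

theorem trMulSymm_zero_left (τ : A →ₗ[ℂ] ℂ) (v : BiTensor A) (x y z : A) :
    trMulSymm τ 0 v x y z = 0 := by
  simp [trMulSymm, triTensor_mul_zero, triTensor_zero_mul]

theorem trMulSymm_zero_right (τ : A →ₗ[ℂ] ℂ) (u : BiTensor A) (x y z : A) :
    trMulSymm τ u 0 x y z = 0 := by
  simp [trMulSymm, triTensor_mul_zero, triTensor_zero_mul]

theorem map_mul_of_tmul (R : BiTensor A →ₗ[ℂ] B)
    (h : ∀ a a' b b', R (a ⊗ₜ b) * R (a' ⊗ₜ b') = R ((a * a') ⊗ₜ (b * b'))) (x y : BiTensor A) :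
    R (x * y) = R x * R y := by
  induction x using TensorProduct.induction_on with
  | zero => simp
  | add x x' hx hx' => rw [add_mul, map_add, hx, hx', map_add, add_mul]
  | tmul a b =>
    induction y using TensorProduct.induction_on with
    | zero => simp
    | add y y' hy hy' => rw [mul_add, map_add, hy, hy', map_add, mul_add]
    | tmul a' b' => rw [Algebra.TensorProduct.tmul_mul_tmul, h]

theorem map_pow_pureTensor_left (R : BiTensor A →ₗ[ℂ] B) (h1 : R 1 = 1)
    (hmul : ∀ x y, R (x * y) = R x * R y) (a : A) (n : ℕ) :
    R (pureTensor (a ^ n) 1) = R (pureTensor a 1) ^ n := by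
  induction n with
  | zero => rw [pow_zero, pow_zero, ← h1]; rfl
  | succ n ih =>
    rw [pow_succ, pow_succ, ← ih, ← hmul, pureTensor, pureTensor, pureTensor,
      Algebra.TensorProduct.tmul_mul_tmul, op_one, one_mul]

theorem map_pow_pureTensor_right (R : BiTensor A →ₗ[ℂ] B) (h1 : R 1 = 1)
    (hmul : ∀ x y, R (x * y) = R x * R y) (a : A) (n : ℕ) :
    R (pureTensor 1 (a ^ n)) = R (pureTensor 1 a) ^ n := by
  induction n with
  | zero => rw [pow_zero, pow_zero, ← h1]; rfl
  | succ n ih =>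
    rw [pow_succ', pow_succ, ← ih, ← hmul, pureTensor, pureTensor, pureTensor,
      Algebra.TensorProduct.tmul_mul_tmul, op_mul, one_mul]

/-- Supplies injectivity of `x ↦ R(x ⊗ 1)` once `τ` is faithful: the functional `t` recovers `τ(x^*
x)` from `R(x^* x ⊗ 1)`. -/
theorem trace_star_mul_self_eq_zero_left [Star A] (τ : A →ₗ[ℂ] ℂ) (hτ : τ 1 = 1)
    (R : BiTensor A →ₗ[ℂ] B) (hmul : ∀ x y, R (x * y) = R x * R y) (t : B →ₗ[ℂ] ℂ)
    (ht : ∀ a b, t (R (pureTensor a b)) = τ a * τ b) {x : A} (h : R (pureTensor x 1) = 0) :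
    τ (star x * x) = 0 := by
  have h1 := ht (star x * x) 1
  rw [hτ, mul_one] at h1
  have h2 : pureTensor (star x * x) 1 = pureTensor (star x) 1 * pureTensor x 1 := by
    rw [pureTensor, pureTensor, pureTensor, Algebra.TensorProduct.tmul_mul_tmul, op_one, one_mul]
  rw [← h1, h2, hmul, h, mul_zero, map_zero]

theorem trace_star_mul_self_eq_zero_right [Star A] (τ : A →ₗ[ℂ] ℂ) (hτ : τ 1 = 1)
    (R : BiTensor A →ₗ[ℂ] B) (hmul : ∀ x y, R (x * y) = R x * R y) (t : B →ₗ[ℂ] ℂ)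
    (ht : ∀ a b, t (R (pureTensor a b)) = τ a * τ b) {x : A} (h : R (pureTensor 1 x) = 0) :
    τ (star x * x) = 0 := by
  have h1 := ht 1 (star x * x)
  rw [hτ, one_mul] at h1
  -- The factors appear in reverse order because the second leg is multiplied in the opposite
  -- algebra.
  have h2 : pureTensor 1 (star x * x) = pureTensor 1 x * pureTensor 1 (star x) := by
    rw [pureTensor, pureTensor, pureTensor, Algebra.TensorProduct.tmul_mul_tmul, op_mul, one_mul]
  rw [← h1, h2, hmul, h, zero_mul, map_zero]

/-- For elementary tensors the second leg multiplies out in the opposite order to `τ(y γ β)`, and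
traciality turns it into the weight `τ(β y γ)` of `ℳ_τ`. The general case is bilinear. -/
theorem trace_integrand (τ : A →ₗ[ℂ] ℂ) (hτ : ∀ a b, τ (a * b) = τ (b * a))
    (R : BiTensor A →ₗ[ℂ] B) (hmul : ∀ x y, R (x * y) = R x * R y) (t : B →ₗ[ℂ] ℂ)
    (ht : ∀ a b, t (R (pureTensor a b)) = τ a * τ b) (a : A) (u v : BiTensor A) (x y z : A) :
    t (R (pureTensor a 1) * (R (pureTensor x 1) * R (u * flip v + v * flip u)
      * (R (pureTensor 1 y) * R (pureTensor 1 1)) * R (pureTensor z 1)))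
      = τ (a * trMulSymm τ u v x y z) := by
  simp only [← hmul]
  induction u using TensorProduct.induction_on with
  | zero => simp [trMulSymm_zero_left]
  | add u u' hu hu' =>
    rw [trMulSymm_add_left, mul_add a, map_add τ, ← hu, ← hu', ← map_add t, ← map_add R]
    congr 2
    simp only [map_add, mul_add, add_mul]
    abel
  | tmul α β =>
    induction v using TensorProduct.induction_on with
    | zero => simp [trMulSymm_zero_right]
    | add v v' hv hv' =>
      rw [trMulSymm_add_right, mul_add a, map_add τ, ← hv, ← hv', ← map_add t, ← map_add R]
      congr 2
      simp only [map_add, mul_add, add_mul]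
      abel
    | tmul γ δ =>
      obtain ⟨β, rfl⟩ := op_surjective β
      obtain ⟨δ, rfl⟩ := op_surjective δ
      change _ = τ (a * trMulSymm τ (pureTensor α β) (pureTensor γ δ) x y z)
      rw [trMulSymm_pureTensor]
      have hf1 : flip (γ ⊗ₜ[ℂ] op δ : BiTensor A) = δ ⊗ₜ op γ := rfl
      have hf2 : flip (α ⊗ₜ[ℂ] op β : BiTensor A) = β ⊗ₜ op α := rfl
      have ht' : ∀ a b, t (R (a ⊗ₜ op b)) = τ a * τ b := ht
      rw [hf1, hf2]
      simp only [pureTensor, mul_add, add_mul, Algebra.TensorProduct.tmul_mul_tmul, map_add]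
      simp only [← op_mul, ht', one_mul, mul_one]
      simp only [mul_smul_comm, map_smul, smul_eq_mul, mul_assoc]
      rw [hτ β (y * γ), hτ δ (y * α)]
      simp only [mul_assoc]
      ring

end Algebraic

/-! ### The representation of `M ⊗ M^op` -/

namespace VNTrace

variable {H : Type*} [NormedAddCommGroup H] [InnerProductSpace ℂ H] [CompleteSpace H]
variable {M : VonNeumannAlgebra H} (τ : VNTrace M)

/-- Elementary tensors in `L²(M, τ) ⊗₂ L²(M^op, τ^op)`. -/
noncomputable def tmulVec (h : τ.L2) (k : τ.L2op) : τ.L2tensor := (h ⊗ₜ[ℂ] k : τ.L2 ⊗[ℂ] τ.L2op)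

theorem inner_tmulVec (h h' : τ.L2) (k k' : τ.L2op) :
    ⟪τ.tmulVec h k, τ.tmulVec h' k'⟫_ℂ = ⟪h, h'⟫_ℂ * ⟪k, k'⟫_ℂ := by
  unfold tmulVec
  rw [UniformSpace.Completion.inner_coe, TensorProduct.inner_tmul]

theorem opTensor_tmulVec (a : M) (b : (M)ᵐᵒᵖ) (h : τ.L2) (k : τ.L2op) :
    τ.opTensor a b (τ.tmulVec h k) = τ.tmulVec (τ.rep a h) (τ.repOp b k) := by
  unfold tmulVec
  rw [opTensor_coe]
  rfl

theorem dense_span_tmulVec :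
    Dense (Submodule.span ℂ {x | ∃ h k, τ.tmulVec h k = x} : Set τ.L2tensor) := by
  have h : DenseRange ((↑) : τ.L2 ⊗[ℂ] τ.L2op → τ.L2tensor) :=
    UniformSpace.Completion.denseRange_coe
  refine h.mono ?_
  rintro _ ⟨x, rfl⟩
  induction x using TensorProduct.induction_on with
  | zero =>
    rw [UniformSpace.Completion.coe_zero]
    exact Submodule.zero_mem _
  | tmul h k => exact Submodule.subset_span ⟨h, k, rfl⟩
  | add x y hx hy =>
    rw [UniformSpace.Completion.coe_add]
    exact Submodule.add_mem _ hx hy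

theorem clm_ext_tmulVec {X Y : τ.L2tensor →L[ℂ] τ.L2tensor}
    (h : ∀ k l, X (τ.tmulVec k l) = Y (τ.tmulVec k l)) : X = Y :=
  ContinuousLinearMap.ext_on τ.dense_span_tmulVec (by rintro _ ⟨k, l, rfl⟩; exact h k l)

theorem opTensor_mul (a a' : M) (b b' : (M)ᵐᵒᵖ) :
    τ.opTensor a b * τ.opTensor a' b' = τ.opTensor (a * a') (b * b') := by
  refine τ.clm_ext_tmulVec fun k l => ?_
  rw [mul_apply_eq_comp, opTensor_tmulVec, opTensor_tmulVec, opTensor_tmulVec]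
  simp only [rep, repOp, map_mul, mul_apply_eq_comp]

theorem rep_one : τ.rep 1 = 1 := _root_.map_one τ.pos.gnsStarAlgHom

theorem repOp_one : τ.repOp 1 = 1 := _root_.map_one τ.posOp.gnsStarAlgHom

theorem opTensor_one_eq_id : τ.opTensor 1 1 = ContinuousLinearMap.id ℂ τ.L2tensor := by
  refine τ.clm_ext_tmulVec fun k l => ?_
  rw [opTensor_tmulVec, rep_one, repOp_one]
  rfl

theorem opTensor_one : τ.opTensor 1 1 = 1 := τ.opTensor_one_eq_id

theorem isSelfAdjoint_opTensor {a : M} {b : (M)ᵐᵒᵖ} (ha : IsSelfAdjoint (τ.rep a))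
    (hb : IsSelfAdjoint (τ.repOp b)) : IsSelfAdjoint (τ.opTensor a b) := by
  rw [IsSelfAdjoint, ContinuousLinearMap.star_eq_adjoint]
  refine clm_ext_of_dense_span τ.dense_span_tmulVec ?_
  rintro _ ⟨h, k, rfl⟩ _ ⟨h', k', rfl⟩
  rw [ContinuousLinearMap.adjoint_inner_right, opTensor_tmulVec, opTensor_tmulVec, inner_tmulVec,
    inner_tmulVec, ← ContinuousLinearMap.adjoint_inner_right, ha.adjoint_eq,
    ← ContinuousLinearMap.adjoint_inner_right, hb.adjoint_eq]

theorem tensorRep_one : τ.tensorRep 1 = 1 := τ.opTensor_one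

theorem tensorRep_mul (x y : BiTensor M) :
    τ.tensorRep (x * y) = τ.tensorRep x * τ.tensorRep y :=
  map_mul_of_tmul τ.tensorRep (fun a a' b b' => τ.opTensor_mul a a' b b') x y

theorem tensorTrace_eq (X : τ.L2tensor →L[ℂ] τ.L2tensor) :
    τ.tensorTrace X = ⟪τ.tmulVec (τ.hat 1) (τ.hatOp 1), X (τ.tmulVec (τ.hat 1) (τ.hatOp 1))⟫_ℂ :=
  rfl

theorem tensorTrace_opTensor (a b : M) :
    τ.tensorTrace (τ.opTensor a (op b)) = τ.toLinearMap a * τ.toLinearMap b := by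
  rw [tensorTrace_eq, opTensor_tmulVec, inner_tmulVec, rep_hat, repOp_hatOp, inner_hat, inner_hatOp]
  simp

/-- The embedding `a ↦ a ⊗ 1` as operators. -/
noncomputable def leftAmp : M →ₗ[ℂ] (τ.L2tensor →L[ℂ] τ.L2tensor) :=
  τ.tensorRep ∘ₗ (TensorProduct.mk ℂ M (M)ᵐᵒᵖ).flip 1

/-- The embedding `b ↦ 1 ⊗ b` as operators. -/
noncomputable def rightAmp : M →ₗ[ℂ] (τ.L2tensor →L[ℂ] τ.L2tensor) :=
  τ.tensorRep ∘ₗ (TensorProduct.mk ℂ M (M)ᵐᵒᵖ) 1 ∘ₗ (opLinearEquiv ℂ).toLinearMap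

theorem leftAmp_apply (a : M) : τ.leftAmp a = τ.opTensor a 1 := rfl

theorem rightAmp_apply (a : M) : τ.rightAmp a = τ.opTensor 1 (op a) := rfl

theorem isSelfAdjoint_leftAmp {m : M} (hm : IsSelfAdjoint m) : IsSelfAdjoint (τ.leftAmp m) :=
  τ.isSelfAdjoint_opTensor (τ.isSelfAdjoint_rep hm) (τ.isSelfAdjoint_repOp (.one M))

theorem isSelfAdjoint_rightAmp {m : M} (hm : IsSelfAdjoint m) : IsSelfAdjoint (τ.rightAmp m) :=
  τ.isSelfAdjoint_opTensor (τ.isSelfAdjoint_rep (.one M)) (τ.isSelfAdjoint_repOp hm)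

theorem leftAmp_pow (m : M) (n : ℕ) : τ.leftAmp (m ^ n) = τ.leftAmp m ^ n :=
  map_pow_pureTensor_left τ.tensorRep τ.tensorRep_one τ.tensorRep_mul m n

theorem rightAmp_pow (m : M) (n : ℕ) : τ.rightAmp (m ^ n) = τ.rightAmp m ^ n :=
  map_pow_pureTensor_right τ.tensorRep τ.tensorRep_one τ.tensorRep_mul m n

theorem leftAmp_bfcM {m : M} (hm : IsSelfAdjoint m) {φ : ℝ → ℂ} (hφ : BddMeas φ) :
    τ.leftAmp (bfcM m φ) = bfc (τ.leftAmp m) φ := by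
  refine map_bfcM hm τ.leftAmp (τ.isSelfAdjoint_leftAmp hm) (τ.leftAmp_pow m)
    τ.dense_span_tmulVec ?_ hφ
  rintro F f C hF hf hC hlim _ ⟨h, k, rfl⟩ _ ⟨h', k', rfl⟩
  have hf' : BddMeas f := ⟨hf, C, fun x =>
    le_of_tendsto (hlim x).norm (Filter.Eventually.of_forall fun n => hC n x)⟩
  simp_rw [leftAmp_apply, opTensor_tmulVec, inner_tmulVec,
    fun n => τ.rep_bfcM hm ⟨hF n, C, hC n⟩, τ.rep_bfcM hm hf']
  exact (tendsto_inner_bfc (τ.isSelfAdjoint_rep hm) hF hf hC hlim _ _).mul_const _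

theorem rightAmp_bfcM {m : M} (hm : IsSelfAdjoint m) {φ : ℝ → ℂ} (hφ : BddMeas φ) :
    τ.rightAmp (bfcM m φ) = bfc (τ.rightAmp m) φ := by
  refine map_bfcM hm τ.rightAmp (τ.isSelfAdjoint_rightAmp hm) (τ.rightAmp_pow m)
    τ.dense_span_tmulVec ?_ hφ
  rintro F f C hF hf hC hlim _ ⟨h, k, rfl⟩ _ ⟨h', k', rfl⟩
  have hf' : BddMeas f := ⟨hf, C, fun x =>
    le_of_tendsto (hlim x).norm (Filter.Eventually.of_forall fun n => hC n x)⟩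
  simp_rw [rightAmp_apply, opTensor_tmulVec, inner_tmulVec,
    fun n => τ.repOp_bfcM hm ⟨hF n, C, hC n⟩, τ.repOp_bfcM hm hf']
  exact (tendsto_inner_bfc (τ.isSelfAdjoint_repOp hm) hF hf hC hlim _ _).const_mul _

end VNTrace

/-! ### Parametrized triples of functions -/

/-- A triple of parametrized functions whose product can be integrated over the parameter. -/
structure IsTriple {S : Type*} [MeasurableSpace S] (ρ : Measure S) (Φ : Fin 3 → ℝ → S → ℂ) :
    Prop where
  meas : ∀ j, Measurable (Function.uncurry (Φ j))
  bdd : ∀ j s, ∃ C : ℝ, ∀ x, ‖Φ j x s‖ ≤ C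
  lintegral_lt : ∫⁻ s, ∏ j, (⨆ x, ‖Φ j x s‖ₑ) ∂ρ < ∞

theorem IPD.isTriple {σ : Fin 3 → Set ℝ} (hσ : ∀ j, MeasurableSet (σ j)) {φ : (∀ j, σ j) → ℂ}
    (D : IPD.{w} φ) : IsTriple D.ρ D.extend :=
  ⟨D.measurable_extend hσ, D.bdd_extend, D.lintegral_extend_lt⟩

section Triple

variable {S : Type*} [MeasurableSpace S] {ρ : Measure S} {Φ : Fin 3 → ℝ → S → ℂ}
variable {K : Type*} [NormedAddCommGroup K] [InnerProductSpace ℂ K] [CompleteSpace K]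

theorem IsTriple.bddMeas (h : IsTriple ρ Φ) (j : Fin 3) (s : S) : BddMeas fun l => Φ j l s :=
  bddMeas_section (h.meas j) (h.bdd j) s

variable {a : K →L[ℂ] K} (ha : IsSelfAdjoint a)
include ha

theorem IsTriple.iSup_weight_le (h : IsTriple ρ Φ) (y x : K) (s : S) :
    ⨆ l, ‖⟪y, bfc a (fun l => Φ 1 l s) x⟫_ℂ * Φ 2 l s‖ₑ
      ≤ (‖y‖ₑ * ‖x‖ₑ) * ((⨆ l, ‖Φ 1 l s‖ₑ) * ⨆ l, ‖Φ 2 l s‖ₑ) := by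
  refine iSup_le fun l => ?_
  rw [enorm_mul, ← mul_assoc]
  exact mul_le_mul' (enorm_inner_bfc_le ha (h.bddMeas 1 s) y x) (le_iSup (fun l => ‖Φ 2 l s‖ₑ) l)

theorem IsTriple.prod_weight_le (h : IsTriple ρ Φ) (y x : K) (s : S) :
    (⨆ l, ‖Φ 0 l s‖ₑ) * (⨆ l, ‖⟪y, bfc a (fun l => Φ 1 l s) x⟫_ℂ * Φ 2 l s‖ₑ)
      ≤ (‖y‖ₑ * ‖x‖ₑ) * ∏ j, (⨆ l, ‖Φ j l s‖ₑ) := by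
  refine (mul_le_mul' le_rfl (h.iSup_weight_le ha y x s)).trans_eq ?_
  rw [Fin.prod_univ_three]
  ring

/-- Pairing the middle calculus with two vectors makes it a scalar function of `s`; absorbed into
the third component, it turns a triple into a pair, for which independence of the decomposition is
known. -/
theorem IsTriple.isDecomp (h : IsTriple ρ Φ) (y x : K) :
    IsDecomp ρ (Φ 0) (fun l s => ⟪y, bfc a (fun l => Φ 1 l s) x⟫_ℂ * Φ 2 l s) where
  meas_left := h.meas 0
  meas_right := (((sotMeasurable_bfc ha (h.meas 1) (h.bdd 1)).measurable_inner y x).comp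
    measurable_snd).mul (h.meas 2)
  bdd_left := h.bdd 0
  bdd_right s := by
    obtain ⟨C, hC⟩ := h.bdd 2 s
    refine ⟨‖⟪y, bfc a (fun l => Φ 1 l s) x⟫_ℂ‖ * C, fun l => ?_⟩
    rw [norm_mul]
    exact mul_le_mul_of_nonneg_left (hC l) (norm_nonneg _)
  lintegral_lt := by
    have hne : ‖y‖ₑ * ‖x‖ₑ ≠ ∞ := ENNReal.mul_ne_top enorm_ne_top enorm_ne_top
    refine (lintegral_mono fun s => h.prod_weight_le ha y x s).trans_lt ?_
    rw [lintegral_const_mul' _ _ hne]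
    exact ENNReal.mul_lt_top hne.lt_top h.lintegral_lt

/-- Fubini moves the integral over `s` inside the middle calculus, so the symbol of the reduced pair
depends only on the function that the triple represents. -/
theorem IsTriple.integral_weight [SFinite ρ] (h : IsTriple ρ Φ) (y x : K) (l₁ l₃ : ℝ) :
    ∫ s, Φ 0 l₁ s * (⟪y, bfc a (fun l => Φ 1 l s) x⟫_ℂ * Φ 2 l₃ s) ∂ρ
      = ⟪y, bfc a (fun l => ∫ s, ∏ j, Φ j (![l₁, l, l₃] j) s ∂ρ) x⟫_ℂ := by
  have h1 : (fun l => ∫ s, ∏ j, Φ j (![l₁, l, l₃] j) s ∂ρ)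
      = fun l => ∫ s, (Φ 0 l₁ s * Φ 2 l₃ s) * Φ 1 l s ∂ρ := by
    ext l
    congr 1
    ext s
    rw [Fin.prod_univ_three]
    change Φ 0 l₁ s * Φ 1 l s * Φ 2 l₃ s = _
    ring
  rw [h1, inner_bfc_integral ha]
  · congr 1
    ext s
    have := bfc_smul ha (Φ 0 l₁ s * Φ 2 l₃ s) (h.bddMeas 1 s)
    change _ = ⟪y, bfc a ((Φ 0 l₁ s * Φ 2 l₃ s) • fun l => Φ 1 l s) x⟫_ℂ
    rw [this, smul_apply, inner_smul_right]
    ring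
  · exact (((h.meas 0).comp (measurable_const.prodMk measurable_snd)).mul
      ((h.meas 2).comp (measurable_const.prodMk measurable_snd))).mul (h.meas 1)
  · intro s
    obtain ⟨C, hC⟩ := h.bdd 1 s
    refine ⟨‖Φ 0 l₁ s * Φ 2 l₃ s‖ * C, fun l => ?_⟩
    rw [norm_mul]
    exact mul_le_mul_of_nonneg_left (hC l) (norm_nonneg _)
  · refine (lintegral_mono fun s => iSup_le fun l => ?_).trans_lt h.lintegral_lt
    rw [enorm_mul, enorm_mul, Fin.prod_univ_three, mul_right_comm]
    exact mul_le_mul' (mul_le_mul' (le_iSup (fun l => ‖Φ 0 l s‖ₑ) l₁)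
      (le_iSup (fun l => ‖Φ 1 l s‖ₑ) l)) (le_iSup (fun l => ‖Φ 2 l s‖ₑ) l₃)

end Triple

/-! ### The integrand -/

namespace VNTrace

variable {H : Type*} [NormedAddCommGroup H] [InnerProductSpace ℂ H] [CompleteSpace H]
variable {M : VonNeumannAlgebra H} (τ : VNTrace M)
variable {S : Type*} [MeasurableSpace S] {ρ : Measure S} {Φ : Fin 3 → ℝ → S → ℂ}

/-- The integrand of `Δ_{u,v} f(m)`. -/
noncomputable def tripleIntegrand (m : M) (Φ : Fin 3 → ℝ → S → ℂ) (u v : BiTensor M) (s : S) : M :=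
  trMulSymm τ.toLinearMap u v (bfcM m fun l => Φ 0 l s) (bfcM m fun l => Φ 1 l s)
    (bfcM m fun l => Φ 2 l s)

/-- One of the two summands of the integrand for elementary tensors. -/
noncomputable def elemIntegrand (m : M) (Φ : Fin 3 → ℝ → S → ℂ) (b c p : M) (s : S) : M :=
  τ.toLinearMap (b * (bfcM m fun l => Φ 1 l s) * c) •
    ((bfcM m fun l => Φ 0 l s) * p * (bfcM m fun l => Φ 2 l s))

theorem tripleIntegrand_pureTensor (m : M) (Φ : Fin 3 → ℝ → S → ℂ) (a b c d : M) (s : S) :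
    τ.tripleIntegrand m Φ (pureTensor a b) (pureTensor c d) s
      = τ.elemIntegrand m Φ b c (a * d) s + τ.elemIntegrand m Φ d a (c * b) s := by
  unfold tripleIntegrand elemIntegrand
  rw [trMulSymm_pureTensor]
  simp only [mul_assoc]

theorem tripleIntegrand_tmul (m : M) (Φ : Fin 3 → ℝ → S → ℂ) (a c : M) (b d : (M)ᵐᵒᵖ) :
    τ.tripleIntegrand m Φ (a ⊗ₜ[ℂ] b) (c ⊗ₜ[ℂ] d) = fun s =>
      τ.elemIntegrand m Φ (unop b) c (a * unop d) s
        + τ.elemIntegrand m Φ (unop d) a (c * unop b) s :=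
  funext fun s => τ.tripleIntegrand_pureTensor m Φ a (unop b) c (unop d) s

theorem tripleIntegrand_add_left (m : M) (Φ : Fin 3 → ℝ → S → ℂ) (u u' v : BiTensor M) (s : S) :
    τ.tripleIntegrand m Φ (u + u') v s
      = τ.tripleIntegrand m Φ u v s + τ.tripleIntegrand m Φ u' v s :=
  trMulSymm_add_left _ _ _ _ _ _ _

theorem tripleIntegrand_add_right (m : M) (Φ : Fin 3 → ℝ → S → ℂ) (u v v' : BiTensor M) (s : S) :
    τ.tripleIntegrand m Φ u (v + v') s
      = τ.tripleIntegrand m Φ u v s + τ.tripleIntegrand m Φ u v' s :=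
  trMulSymm_add_right _ _ _ _ _ _ _

/-- Measurability and boundedness requirements for integrands. -/
structure IsDominated (τ : VNTrace M) (G : S → ℝ≥0∞) (F : S → M) : Prop where
  sot : SOTMeasurable fun s => (F s : H →L[ℂ] H)
  sot_rep : SOTMeasurable fun s => τ.rep (F s)
  bound : ∃ C : ℝ≥0∞, C ≠ ∞ ∧ ∀ s, ‖(F s : H →L[ℂ] H)‖ₑ ≤ C * G s

variable {τ} in
theorem IsDominated.add {G : S → ℝ≥0∞} {F F' : S → M} (h : τ.IsDominated G F)
    (h' : τ.IsDominated G F') : τ.IsDominated G fun s => F s + F' s where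
  sot := h.sot.add h'.sot
  sot_rep := by
    have := h.sot_rep.add h'.sot_rep
    convert! this using 2 with s
    exact map_add τ.pos.gnsStarAlgHom (F s) (F' s)
  bound := by
    obtain ⟨C, hC, h⟩ := h.bound
    obtain ⟨C', hC', h'⟩ := h'.bound
    refine ⟨C + C', ENNReal.add_ne_top.2 ⟨hC, hC'⟩, fun s => ?_⟩
    rw [add_mul]
    exact (enorm_add_le _ _).trans (add_le_add (h s) (h' s))

theorem tripleIntegrand_zero_left (m : M) (Φ : Fin 3 → ℝ → S → ℂ) (v : BiTensor M) :
    τ.tripleIntegrand m Φ 0 v = fun _ => 0 :=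
  funext fun _ => trMulSymm_zero_left τ.toLinearMap v _ _ _

theorem tripleIntegrand_zero_right (m : M) (Φ : Fin 3 → ℝ → S → ℂ) (u : BiTensor M) :
    τ.tripleIntegrand m Φ u 0 = fun _ => 0 :=
  funext fun _ => trMulSymm_zero_right τ.toLinearMap u _ _ _

theorem IsDominated.integral_add {τ : VNTrace M} {G : S → ℝ≥0∞} {F F' : S → M}
    (h : τ.IsDominated G F) (h' : τ.IsDominated G F') (hG : ∫⁻ s, G s ∂ρ < ∞) (y x : H) :
    ∫ s, ⟪y, ((F s + F' s : M) : H →L[ℂ] H) x⟫_ℂ ∂ρ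
      = ∫ s, ⟪y, (F s : H →L[ℂ] H) x⟫_ℂ ∂ρ + ∫ s, ⟪y, (F' s : H →L[ℂ] H) x⟫_ℂ ∂ρ := by
  have hi : ∀ {F : S → M}, τ.IsDominated G F →
      Integrable (fun s => ⟪y, (F s : H →L[ℂ] H) x⟫_ℂ) ρ := by
    intro F h
    obtain ⟨C, hC, hb⟩ := h.bound
    refine h.sot.integrable_inner (G := fun s => C * G s) ?_ hb y x
    rw [lintegral_const_mul' _ _ hC]
    exact ENNReal.mul_lt_top hC.lt_top hG
  rw [← MeasureTheory.integral_add (hi h) (hi h')]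
  congr 1
  ext s
  change ⟪y, ((F s : H →L[ℂ] H) + (F' s : H →L[ℂ] H)) x⟫_ℂ = _
  rw [add_apply, inner_add_right]

theorem isDominated_zero (G : S → ℝ≥0∞) : τ.IsDominated G fun _ => 0 where
  sot := SOTMeasurable.const 0
  sot_rep := SOTMeasurable.const _
  bound := ⟨0, ENNReal.zero_ne_top, fun s => by
    change ‖(0 : H →L[ℂ] H)‖ₑ ≤ _
    simp⟩

variable {m : M} (hm : IsSelfAdjoint m)
include hm

theorem trace_bfcM {φ : ℝ → ℂ} (hφ : BddMeas φ) (b c : M) :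
    τ.toLinearMap (b * bfcM m φ * c) = ⟪τ.hat (star b), bfc (τ.rep m) φ (τ.hat c)⟫_ℂ := by
  rw [← τ.rep_bfcM hm hφ, rep_hat, inner_hat, star_star, mul_assoc]

/-- Here the weight `τ(b φ₂(m) c)` is a matrix coefficient on `L²(M, τ)`, while the outer factors
act on `H`; this is the form to which `IsTriple.isDecomp` applies. -/
theorem coe_elemIntegrand (hΦ : IsTriple ρ Φ) (b c p : M) (s : S) :
    (τ.elemIntegrand m Φ b c p s : H →L[ℂ] H)
      = bfc (m : H →L[ℂ] H) (fun l => Φ 0 l s) * p * bfc (m : H →L[ℂ] H)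
        (fun l => ⟪τ.hat (star b), bfc (τ.rep m) (fun l => Φ 1 l s) (τ.hat c)⟫_ℂ * Φ 2 l s) := by
  have h2 := bfc_smul (isSelfAdjoint_coe hm)
    ⟪τ.hat (star b), bfc (τ.rep m) (fun l => Φ 1 l s) (τ.hat c)⟫_ℂ (hΦ.bddMeas 2 s)
  change _ = _ * bfc (m : H →L[ℂ] H)
    (⟪τ.hat (star b), bfc (τ.rep m) (fun l => Φ 1 l s) (τ.hat c)⟫_ℂ • fun l => Φ 2 l s)
  rw [h2, mul_smul_comm, ← coe_bfcM hm (hΦ.bddMeas 0 s), ← coe_bfcM hm (hΦ.bddMeas 2 s),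
    ← τ.trace_bfcM hm (hΦ.bddMeas 1 s)]
  rfl

theorem rep_elemIntegrand (hΦ : IsTriple ρ Φ) (b c p : M) (s : S) :
    τ.rep (τ.elemIntegrand m Φ b c p s)
      = bfc (τ.rep m) (fun l => Φ 0 l s) * τ.rep p * bfc (τ.rep m)
        (fun l => ⟪τ.hat (star b), bfc (τ.rep m) (fun l => Φ 1 l s) (τ.hat c)⟫_ℂ * Φ 2 l s) := by
  have h2 := bfc_smul (τ.isSelfAdjoint_rep hm)
    ⟪τ.hat (star b), bfc (τ.rep m) (fun l => Φ 1 l s) (τ.hat c)⟫_ℂ (hΦ.bddMeas 2 s)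
  change _ = _ * bfc (τ.rep m)
    (⟪τ.hat (star b), bfc (τ.rep m) (fun l => Φ 1 l s) (τ.hat c)⟫_ℂ • fun l => Φ 2 l s)
  rw [h2, mul_smul_comm, ← τ.rep_bfcM hm (hΦ.bddMeas 0 s), ← τ.rep_bfcM hm (hΦ.bddMeas 2 s),
    ← τ.trace_bfcM hm (hΦ.bddMeas 1 s)]
  unfold elemIntegrand rep
  rw [map_smul τ.pos.gnsStarAlgHom, map_mul τ.pos.gnsStarAlgHom, map_mul τ.pos.gnsStarAlgHom]

theorem isDominated_elemIntegrand [SFinite ρ] (hΦ : IsTriple ρ Φ) (b c p : M) :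
    τ.IsDominated (fun s => ∏ j, (⨆ l, ‖Φ j l s‖ₑ)) (τ.elemIntegrand m Φ b c p) where
  sot := by
    simp_rw [τ.coe_elemIntegrand hm hΦ]
    exact (hΦ.isDecomp (τ.isSelfAdjoint_rep hm) _ _).sotMeasurable (isSelfAdjoint_coe hm)
      (isSelfAdjoint_coe hm) p
  sot_rep := by
    simp_rw [τ.rep_elemIntegrand hm hΦ]
    exact (hΦ.isDecomp (τ.isSelfAdjoint_rep hm) _ _).sotMeasurable (τ.isSelfAdjoint_rep hm)
      (τ.isSelfAdjoint_rep hm) (τ.rep p)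
  bound := by
    refine ⟨‖(p : H →L[ℂ] H)‖ₑ * (‖τ.hat (star b)‖ₑ * ‖τ.hat c‖ₑ),
      ENNReal.mul_ne_top enorm_ne_top (ENNReal.mul_ne_top enorm_ne_top enorm_ne_top), fun s => ?_⟩
    rw [τ.coe_elemIntegrand hm hΦ, mul_assoc ‖(p : H →L[ℂ] H)‖ₑ]
    exact ((hΦ.isDecomp (τ.isSelfAdjoint_rep hm) _ _).enorm_le (isSelfAdjoint_coe hm)
      (isSelfAdjoint_coe hm) p s).trans
      (mul_le_mul' le_rfl (hΦ.prod_weight_le (τ.isSelfAdjoint_rep hm) _ _ s))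

theorem isDominated_tripleIntegrand [SFinite ρ] (hΦ : IsTriple ρ Φ) (u v : BiTensor M) :
    τ.IsDominated (fun s => ∏ j, (⨆ l, ‖Φ j l s‖ₑ)) (τ.tripleIntegrand m Φ u v) := by
  induction u using TensorProduct.induction_on with
  | zero =>
    rw [tripleIntegrand_zero_left]
    exact τ.isDominated_zero _
  | add u u' hu hu' =>
    rw [funext fun s => τ.tripleIntegrand_add_left m Φ u u' v s]
    exact hu.add hu'
  | tmul α β =>
    induction v using TensorProduct.induction_on with
    | zero =>
      rw [tripleIntegrand_zero_right]
      exact τ.isDominated_zero _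
    | add v v' hv hv' =>
      rw [funext fun s => τ.tripleIntegrand_add_right m Φ (α ⊗ₜ[ℂ] β) v v' s]
      exact hv.add hv'
    | tmul γ δ =>
      rw [tripleIntegrand_tmul]
      exact (τ.isDominated_elemIntegrand hm hΦ _ _ _).add (τ.isDominated_elemIntegrand hm hΦ _ _ _)

/-- The integrals of the integrand do not depend on the decomposition. -/
theorem integral_tripleIntegrand_eq [SFinite ρ] {S' : Type*} [MeasurableSpace S']
    {ρ' : Measure S'} [SFinite ρ'] {Φ' : Fin 3 → ℝ → S' → ℂ} (hΦ : IsTriple ρ Φ)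
    (hΦ' : IsTriple ρ' Φ')
    (heq : ∀ l : Fin 3 → ℝ, (∀ j, l j ∈ spectrum ℝ (m : H →L[ℂ] H)) →
      ∫ s, ∏ j, Φ j (l j) s ∂ρ = ∫ s, ∏ j, Φ' j (l j) s ∂ρ')
    (u v : BiTensor M) (y x : H) :
    ∫ s, ⟪y, (τ.tripleIntegrand m Φ u v s : H →L[ℂ] H) x⟫_ℂ ∂ρ
      = ∫ s, ⟪y, (τ.tripleIntegrand m Φ' u v s : H →L[ℂ] H) x⟫_ℂ ∂ρ' := by
  have ha := isSelfAdjoint_coe hm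
  have hr := τ.isSelfAdjoint_rep hm
  have key : ∀ b c p, ∫ s, ⟪y, (τ.elemIntegrand m Φ b c p s : H →L[ℂ] H) x⟫_ℂ ∂ρ
      = ∫ s, ⟪y, (τ.elemIntegrand m Φ' b c p s : H →L[ℂ] H) x⟫_ℂ ∂ρ' := by
    intro b c p
    simp_rw [τ.coe_elemIntegrand hm hΦ, τ.coe_elemIntegrand hm hΦ']
    refine (hΦ.isDecomp hr _ _).integral_eq ha ha (hΦ'.isDecomp hr _ _) (fun l₁ hl₁ l₃ hl₃ => ?_)
      _ _ _
    rw [hΦ.integral_weight hr, hΦ'.integral_weight hr]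
    congr 2
    refine bfc_congr fun l hl => heq _ fun j => ?_
    -- The middle variable ranges over the spectrum of the represented operator, which must be
    -- matched with `σ(m)` before the two symbols can be compared.
    rw [τ.spectrum_rep hm] at hl
    fin_cases j
    · exact hl₁
    · exact hl
    · exact hl₃
  have hG := hΦ.lintegral_lt
  have hG' := hΦ'.lintegral_lt
  induction u using TensorProduct.induction_on with
  | zero => simp_rw [tripleIntegrand_zero_left]; simp
  | add u u' hu hu' =>
    simp_rw [tripleIntegrand_add_left]
    rw [(τ.isDominated_tripleIntegrand hm hΦ u v).integral_add
      (τ.isDominated_tripleIntegrand hm hΦ u' v) hG,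
      (τ.isDominated_tripleIntegrand hm hΦ' u v).integral_add
      (τ.isDominated_tripleIntegrand hm hΦ' u' v) hG', hu, hu']
  | tmul α β =>
    induction v using TensorProduct.induction_on with
    | zero => simp_rw [tripleIntegrand_zero_right]; simp
    | add v v' hv hv' =>
      simp_rw [tripleIntegrand_add_right]
      rw [(τ.isDominated_tripleIntegrand hm hΦ _ v).integral_add
        (τ.isDominated_tripleIntegrand hm hΦ _ v') hG,
        (τ.isDominated_tripleIntegrand hm hΦ' _ v).integral_add
        (τ.isDominated_tripleIntegrand hm hΦ' _ v') hG', hv, hv']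
    | tmul γ δ =>
      rw [tripleIntegrand_tmul, tripleIntegrand_tmul,
        (τ.isDominated_elemIntegrand hm hΦ _ _ _).integral_add
          (τ.isDominated_elemIntegrand hm hΦ _ _ _) hG,
        (τ.isDominated_elemIntegrand hm hΦ' _ _ _).integral_add
          (τ.isDominated_elemIntegrand hm hΦ' _ _ _) hG', key, key]

end VNTrace

namespace VNTrace

variable {H : Type*} [NormedAddCommGroup H] [InnerProductSpace ℂ H] [CompleteSpace H]
variable {M : VonNeumannAlgebra H} (τ : VNTrace M)
variable {S : Type*} [MeasurableSpace S] {ρ : Measure S} {Φ : Fin 3 → ℝ → S → ℂ}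

/-! ### Pettis integrals in the von Neumann algebra -/

/-- A single `T` in `M` integrates `F` on `H`, on `L²(M, τ)` and under the trace: the double
commutant theorem gives membership and normality the other two. -/
theorem IsDominated.exists_pettis {τ : VNTrace M} {G : S → ℝ≥0∞} {F : S → M}
    (hF : τ.IsDominated G F) (hG : ∫⁻ s, G s ∂ρ < ∞) :
    ∃ T : M, IsPettisIntegral ρ (fun s => (F s : H →L[ℂ] H)) T ∧
      IsPettisIntegral ρ (fun s => τ.rep (F s)) (τ.rep T) ∧
      ∀ a, τ.toLinearMap (a * T) = ∫ s, τ.toLinearMap (a * F s) ∂ρ := by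
  obtain ⟨C, hC, hb⟩ := hF.bound
  have hG' : ∫⁻ s, C * G s ∂ρ < ∞ := by
    rw [lintegral_const_mul' _ _ hC]
    exact ENNReal.mul_lt_top hC.lt_top hG
  obtain ⟨T, hT⟩ := hF.sot.exists_pettis hG' hb
  refine ⟨⟨T, hT.mem⟩, hT, τ.isPettisIntegral_rep hG' hb hF.sot_rep hT, fun a => ?_⟩
  refine τ.trace_pettis (G := fun s => ‖(a : H →L[ℂ] H)‖ₑ * (C * G s)) ?_ (fun s => ?_) ?_
  · rw [lintegral_const_mul' _ _ enorm_ne_top]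
    exact ENNReal.mul_lt_top enorm_lt_top hG'
  · exact (clm_enorm_mul_le _ _).trans (mul_le_mul' le_rfl (hb s))
  · have h := hT.mul_mul (a : H →L[ℂ] H) 1
    simp only [mul_one] at h
    exact h

/-- Faithfulness, tested on `a = (X - Y)^*`; this is the uniqueness of `Δ`. -/
theorem eq_of_trace_mul_eq {X Y : M} (h : ∀ a, τ.toLinearMap (a * X) = τ.toLinearMap (a * Y)) :
    X = Y := by
  refine sub_eq_zero.1 (τ.faithful _ ?_)
  rw [mul_sub, map_sub, h, sub_self]

theorem delta_eq {f : ℝ → ℂ} {m : M} {u v : BiTensor M} {X : M} (h : τ.IsDelta f m u v X) :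
    τ.delta f m u v = X := by
  have hex : ∃ X, τ.IsDelta f m u v X := ⟨X, h⟩
  unfold delta
  rw [dif_pos hex]
  exact τ.eq_of_trace_mul_eq fun a => (hex.choose_spec a).trans (h a).symm

end VNTrace

/-! ### The determining equation -/

theorem moiIntegrand_two {K : Type*} [NormedAddCommGroup K] [InnerProductSpace ℂ K]
    [CompleteSpace K] (a : Fin 3 → K →L[ℂ] K) {φ : (∀ j, spectrum ℝ (a j)) → ℂ} (D : IPD.{w} φ)
    (b : Fin 2 → K →L[ℂ] K) (s : D.S) :
    moiIntegrand a D b s = bfc (a 0) (fun x => D.extend 0 x s) * b 0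
      * (bfc (a 1) (fun x => D.extend 1 x s) * b 1) * bfc (a 2) (fun x => D.extend 2 x s) := by
  rw [← borelFC_comp_eq D 0, ← borelFC_comp_eq D 1, ← borelFC_comp_eq D 2]
  unfold moiIntegrand
  rw [List.ofFn_succ, List.ofFn_succ, List.ofFn_zero, List.prod_cons, List.prod_cons,
    List.prod_nil, mul_one]
  rfl

theorem moiIntegrand_one {K : Type*} [NormedAddCommGroup K] [InnerProductSpace ℂ K]
    [CompleteSpace K] (a : Fin 2 → K →L[ℂ] K) {φ : (∀ j, spectrum ℝ (a j)) → ℂ} (D : IPD.{w} φ)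
    (b : Fin 1 → K →L[ℂ] K) (s : D.S) :
    moiIntegrand a D b s = bfc (a 0) (fun x => D.extend 0 x s) * b 0
      * bfc (a 1) (fun x => D.extend 1 x s) := by
  rw [← borelFC_comp_eq D 0, ← borelFC_comp_eq D 1]
  unfold moiIntegrand
  rw [List.ofFn_succ, List.ofFn_zero, List.prod_cons, List.prod_nil, mul_one]
  rfl

section Generic

variable {H : Type*} [NormedAddCommGroup H] [InnerProductSpace ℂ H] [CompleteSpace H]
variable {M : VonNeumannAlgebra H} (τ : VNTrace M)
variable {K : Type*} [NormedAddCommGroup K] [InnerProductSpace ℂ K] [CompleteSpace K]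

/-- Stated for any multiplicative `R` whose vector state at `e` is `τ ⊗ τ^op` and which intertwines
the calculi: the determining equation uses nothing else. The decomposition hidden in the operator
integral is exposed as a triple over `σ(m)³`. -/
theorem exists_inner_moi_eq_integral {f : ℝ → ℂ} (hf : f ∈ SuperC 2) {m : M}
    (hm : IsSelfAdjoint m) (R : BiTensor M →ₗ[ℂ] (K →L[ℂ] K))
    (hmul : ∀ x y, R (x * y) = R x * R y) (e : K)
    (he : ∀ a b, ⟪e, R (pureTensor a b) e⟫_ℂ = τ.toLinearMap a * τ.toLinearMap b)
    (hl : IsSelfAdjoint (R (pureTensor m 1))) (hr : IsSelfAdjoint (R (pureTensor 1 m)))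
    (hbl : ∀ φ, BddMeas φ → R (pureTensor (bfcM m φ) 1) = bfc (R (pureTensor m 1)) φ)
    (hbr : ∀ φ, BddMeas φ → R (pureTensor 1 (bfcM m φ)) = bfc (R (pureTensor 1 m)) φ) :
    ∃ (S : Type) (_ : MeasurableSpace S) (ρ : Measure S) (Φ : Fin 3 → ℝ → S → ℂ),
      SigmaFinite ρ ∧ IsTriple ρ Φ ∧
      (∀ l : Fin 3 → ℝ, (∀ j, l j ∈ spectrum ℝ (m : H →L[ℂ] H)) →
        ∫ s, ∏ j, Φ j (l j) s ∂ρ = divDiff f 2 l) ∧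
      ∀ (a : M) (u v : BiTensor M),
        ⟪e, (R (pureTensor a 1) * moi ![R (pureTensor m 1), R (pureTensor 1 m), R (pureTensor m 1)]
          (fun l => divDiff f 2 (fun j => (l j : ℝ)))
          ![R (u * flip v + v * flip u), R (pureTensor 1 1)]) e⟫_ℂ
        = ∫ s, τ.toLinearMap (a * τ.tripleIntegrand m Φ u v s) ∂ρ := by
  let t : (K →L[ℂ] K) →ₗ[ℂ] ℂ :=
    (innerSL ℂ e).toLinearMap ∘ₗ (ContinuousLinearMap.apply ℂ K e).toLinearMap
  have ht : ∀ X, t X = ⟪e, X e⟫_ℂ := fun _ => rfl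
  have ht' : ∀ a b, t (R (pureTensor a b)) = τ.toLinearMap a * τ.toLinearMap b := he
  have hsl : spectrum ℝ (R (pureTensor m 1)) = spectrum ℝ (m : H →L[ℂ] H) :=
    spectrum_map_eq hm (R ∘ₗ (TensorProduct.mk ℂ M (M)ᵐᵒᵖ).flip 1) hl
      (fun x hx => τ.faithful x (trace_star_mul_self_eq_zero_left τ.toLinearMap τ.map_one R hmul t
        ht' hx)) hbl
  have hsr : spectrum ℝ (R (pureTensor 1 m)) = spectrum ℝ (m : H →L[ℂ] H) :=
    spectrum_map_eq hm (R ∘ₗ (TensorProduct.mk ℂ M (M)ᵐᵒᵖ) 1 ∘ₗ (opLinearEquiv ℂ).toLinearMap) hr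
      (fun x hx => τ.faithful x (trace_star_mul_self_eq_zero_right τ.toLinearMap τ.map_one R hmul t
        ht' hx)) hbr
  set aa : Fin 3 → K →L[ℂ] K :=
    ![R (pureTensor m 1), R (pureTensor 1 m), R (pureTensor m 1)] with haa
  have hsa : ∀ j, IsSelfAdjoint (aa j) := by
    intro j
    fin_cases j
    exacts [hl, hr, hl]
  -- Without this the chosen decomposition would represent `f^[2]` only on the spectra of the
  -- amplified operators, not on `σ(m)³`.
  have hs : ∀ j, spectrum ℝ (aa j) = spectrum ℝ (m : H →L[ℂ] H) := by
    intro j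
    fin_cases j
    exacts [hsl, hsr, hsl]
  obtain ⟨D, hD⟩ := exists_isPettisIntegral_moi hsa
    (nonempty_ipd_divDiff hf (σ := fun j => spectrum ℝ (aa j)) fun j => spectrum.isBounded _)
  have hT : IsTriple D.ρ D.extend :=
    D.isTriple (σ := fun j => spectrum ℝ (aa j)) fun j => measurableSet_spectrum _
  refine ⟨D.S, D.mS, D.ρ, D.extend, D.sigmaFinite, hT, fun l hl => ?_, fun a u v => ?_⟩
  · exact D.integral_extend (σ := fun j => spectrum ℝ (aa j))
      fun j => ⟨l j, (hs j).symm ▸ hl j⟩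
  · have := ((hD ![R (u * flip v + v * flip u), R (pureTensor 1 1)]).mul_mul
      (R (pureTensor a 1)) 1 e e).2.2
    rw [mul_one] at this
    rw [this]
    congr 1
    ext s
    beta_reduce
    rw [mul_one, moiIntegrand_two, ← ht]
    change t (_ * (bfc (R (pureTensor m 1)) _ * R (u * flip v + v * flip u)
      * (bfc (R (pureTensor 1 m)) _ * R (pureTensor 1 1)) * bfc (R (pureTensor m 1)) _)) = _
    rw [← hbl _ (hT.bddMeas 0 s), ← hbr _ (hT.bddMeas 1 s), ← hbl _ (hT.bddMeas 2 s)]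
    exact trace_integrand τ.toLinearMap τ.map_mul_comm R hmul t ht' a u v _ _ _

end Generic

/-! ### Formula (1): `Δ` as a Pettis integral for every decomposition -/

namespace VNTrace

variable {H : Type*} [NormedAddCommGroup H] [InnerProductSpace ℂ H] [CompleteSpace H]
variable {M : VonNeumannAlgebra H} (τ : VNTrace M)
variable {S : Type*} [MeasurableSpace S] {ρ : Measure S} {Φ : Fin 3 → ℝ → S → ℂ}

/-- `Δ_{u,v} f(m)` is the Pettis integral of the integrand built from any triple of functions that
represents the second divided difference. -/
theorem isPettisIntegral_delta [SFinite ρ] {f : ℝ → ℂ} (hf : f ∈ SuperC 2) {m : M}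
    (hm : IsSelfAdjoint m) (hΦ : IsTriple ρ Φ)
    (heq : ∀ l : Fin 3 → ℝ, (∀ j, l j ∈ spectrum ℝ (m : H →L[ℂ] H)) →
      ∫ s, ∏ j, Φ j (l j) s ∂ρ = divDiff f 2 l) (u v : BiTensor M) :
    IsPettisIntegral ρ (fun s => τ.rep (τ.tripleIntegrand m Φ u v s))
      (τ.rep (τ.delta f m u v)) := by
  obtain ⟨S', _, ρ', Φ', _, hΦ', heq', hdelta⟩ := exists_inner_moi_eq_integral τ hf hm τ.tensorRep
    τ.tensorRep_mul (τ.tmulVec (τ.hat 1) (τ.hatOp 1)) τ.tensorTrace_opTensor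
    (τ.isSelfAdjoint_leftAmp hm) (τ.isSelfAdjoint_rightAmp hm)
    (fun φ hφ => τ.leftAmp_bfcM hm hφ) (fun φ hφ => τ.rightAmp_bfcM hm hφ)
  obtain ⟨T, hT, hT', -⟩ :=
    (τ.isDominated_tripleIntegrand hm hΦ u v).exists_pettis hΦ.lintegral_lt
  obtain ⟨U, hU, -, hU'⟩ :=
    (τ.isDominated_tripleIntegrand hm hΦ' u v).exists_pettis hΦ'.lintegral_lt
  -- `U` comes from the decomposition inside the operator integral, `T` from the given one; they are
  -- compared by coefficients on `H`.
  have hTU : T = U := by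
    refine Subtype.ext (ContinuousLinearMap.ext fun x => ext_inner_left ℂ fun y => ?_)
    rw [(hT x y).2.2, (hU x y).2.2]
    exact τ.integral_tripleIntegrand_eq hm hΦ hΦ' (fun l hl => (heq l hl).trans (heq' l hl).symm)
      u v y x
  have hd : τ.delta f m u v = U := τ.delta_eq fun a => (hU' a).trans (hdelta a u v).symm
  rwa [hd, ← hTU]

theorem borelFCMem_comp_eq {m : M} {φ : (Fin 3 → spectrum ℝ (m : H →L[ℂ] H)) → ℂ}
    (D : IPD.{w} (Ω := fun _ : Fin 3 => spectrum ℝ (m : H →L[ℂ] H)) φ) (j : Fin 3) (s : D.S) :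
    borelFCMem m (fun l => D.comp j l s) = bfcM m (fun x => D.extend j x s) := by
  unfold bfcM
  congr 1
  ext l
  exact (D.extend_coe (σ := fun _ => spectrum ℝ (m : H →L[ℂ] H)) j l s).symm

theorem isPettisIntegral_delta_of_ipd {f : ℝ → ℂ} (hf : f ∈ SuperC 2) {m : M}
    (hm : IsSelfAdjoint m) (D : IPD.{w} (Ω := fun _ : Fin 3 => spectrum ℝ (m : H →L[ℂ] H))
      (fun l => divDiff f 2 (fun j => (l j : ℝ)))) (u v : BiTensor M) :
    IsPettisIntegral D.ρ
      (fun s => τ.rep (trMulSymm τ.toLinearMap u v (borelFCMem m (fun l => D.comp 0 l s))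
        (borelFCMem m (fun l => D.comp 1 l s)) (borelFCMem m (fun l => D.comp 2 l s))))
      (τ.rep (τ.delta f m u v)) := by
  simp_rw [borelFCMem_comp_eq D]
  refine τ.isPettisIntegral_delta hf hm (D.isTriple fun _ => measurableSet_spectrum _)
    (fun l hl => ?_) u v
  exact D.integral_extend (σ := fun _ => spectrum ℝ (m : H →L[ℂ] H)) fun j => ⟨l j, hl j⟩

end VNTrace

/-! ### Complex measures -/

/-- The variation is at most the sum of those of the real and imaginary parts, which are finite by
Jordan decomposition. Bounded measurable functions are thereby integrable against `μ`. -/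
instance isFiniteMeasure_variation {X : Type*} [MeasurableSpace X] (μ : ComplexMeasure X) :
    IsFiniteMeasure μ.variation := by
  have h : ∀ ν : SignedMeasure X, IsFiniteMeasure ν.variation := fun ν => by
    rw [← SignedMeasure.totalVariation_eq_variation, SignedMeasure.totalVariation]
    infer_instance
  have h1 := h (ComplexMeasure.re μ)
  have h2 := h (ComplexMeasure.im μ)
  refine isFiniteMeasure_of_le
    ((ComplexMeasure.re μ).variation + (ComplexMeasure.im μ).variation)
    (VectorMeasure.variation_le_of_forall_enorm_le fun E hE => ?_)
  rw [Measure.add_apply]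
  refine le_trans ?_ (add_le_add (VectorMeasure.enorm_measure_le_variation _ E)
    (VectorMeasure.enorm_measure_le_variation _ E))
  calc ‖μ E‖ₑ = ‖((μ E).re : ℂ) + (μ E).im * Complex.I‖ₑ := by rw [Complex.re_add_im]
    _ ≤ ‖((μ E).re : ℂ)‖ₑ + ‖((μ E).im : ℂ) * Complex.I‖ₑ := enorm_add_le _ _
    _ = _ := by
      rw [enorm_mul, ← ofReal_norm Complex.I, Complex.norm_I, ENNReal.ofReal_one, mul_one,
        ← ofReal_norm, ← ofReal_norm ((μ E).im : ℂ), Complex.norm_real, Complex.norm_real,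
        ofReal_norm, ofReal_norm]
      rfl

theorem BddMeas.integrable_complexMeasure {X : Type*} [MeasurableSpace X] (μ : ComplexMeasure X)
    {φ : X → ℂ} (hφ : BddMeas φ) : μ.Integrable φ :=
  hφ.integrable _

/-! ### The complex measures `τ(b P^m(dλ) c)` -/

namespace VNTrace

variable {H : Type*} [NormedAddCommGroup H] [InnerProductSpace ℂ H] [CompleteSpace H]
variable {M : VonNeumannAlgebra H} (τ : VNTrace M)

theorem specProj_eq (m : M) (B : Set (spectrum ℝ (m : H →L[ℂ] H))) :
    specProj m B = bfcM m ((Subtype.val '' B).indicator 1) := by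
  unfold specProj bfcM
  congr 1
  ext l
  by_cases hl : l ∈ B
  · rw [Set.indicator_of_mem hl, Set.indicator_of_mem (Set.mem_image_of_mem _ hl)]; rfl
  · rw [Set.indicator_of_notMem hl, Set.indicator_of_notMem]
    rintro ⟨l', hl', h⟩
    exact hl (Subtype.ext h ▸ hl')

variable {m : M} (hm : IsSelfAdjoint m)
include hm

theorem trace_bfcM_add (b c : M) {φ ψ : ℝ → ℂ} (hφ : BddMeas φ) (hψ : BddMeas ψ) :
    τ.toLinearMap (b * bfcM m (φ + ψ) * c)
      = τ.toLinearMap (b * bfcM m φ * c) + τ.toLinearMap (b * bfcM m ψ * c) := by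
  rw [bfcM_add hm hφ hψ, mul_add, add_mul, map_add]

theorem trace_bfcM_zero (b c : M) : τ.toLinearMap (b * bfcM m 0 * c) = 0 := by
  have h := bfcM_smul hm 0 (bddMeas_const (1 : ℂ))
  rw [zero_smul, zero_smul] at h
  rw [h, mul_zero, zero_mul, map_zero]

theorem trace_bfcM_finset_biUnion (b c : M) {A : ℕ → Set ℝ} (hA : ∀ i, MeasurableSet (A i))
    (hd : Pairwise (Function.onFun Disjoint A)) (s : Finset ℕ) :
    τ.toLinearMap (b * bfcM m ((⋃ i ∈ s, A i).indicator 1) * c)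
      = ∑ i ∈ s, τ.toLinearMap (b * bfcM m ((A i).indicator 1) * c) := by
  induction s using Finset.induction_on with
  | empty =>
    rw [Finset.sum_empty]
    simp only [Finset.notMem_empty, Set.iUnion_false, Set.iUnion_empty, Set.indicator_empty]
    exact τ.trace_bfcM_zero hm b c
  | insert i s hi ih =>
    rw [Finset.sum_insert hi, ← ih, ← τ.trace_bfcM_add hm b c (bddMeas_indicator (hA i))
      (bddMeas_indicator (s.measurableSet_biUnion fun j _ => hA j)), Finset.set_biUnion_insert,
      Set.indicator_union_of_disjoint]
    · rfl
    · refine Set.disjoint_iUnion₂_right.2 fun j hj => hd ?_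
      rintro rfl
      exact hi hj

theorem hasSum_trace_bfcM (b c : M) {A : ℕ → Set ℝ} (hA : ∀ i, MeasurableSet (A i))
    (hd : Pairwise (Function.onFun Disjoint A)) :
    HasSum (fun i => τ.toLinearMap (b * bfcM m ((A i).indicator 1) * c))
      (τ.toLinearMap (b * bfcM m ((⋃ i, A i).indicator 1) * c)) := by
  -- Unconditional summability is tested along sequences of finite sets, where the indicators of the
  -- partial unions converge boundedly and normality applies.
  refine Filter.tendsto_of_seq_tendsto fun s hs => ?_
  simp_rw [Function.comp_def, ← τ.trace_bfcM_finset_biUnion hm b c hA hd]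
  refine τ.tendsto_trace_bfcM hm (C := 1)
    (fun n => (bddMeas_indicator ((s n).measurableSet_biUnion fun j _ => hA j)).1)
    (bddMeas_indicator (MeasurableSet.iUnion hA)).1 (fun n x => ?_) (fun x => ?_) b c
  · by_cases h : x ∈ ⋃ i ∈ s n, A i
    · simp [Set.indicator_of_mem h]
    · simp [Set.indicator_of_notMem h]
  · refine tendsto_const_nhds.congr' ?_
    by_cases h : x ∈ ⋃ i, A i
    · obtain ⟨i, hi⟩ := Set.mem_iUnion.1 h
      filter_upwards [hs.eventually (Filter.eventually_ge_atTop {i})] with n hn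
      rw [Set.indicator_of_mem h, Set.indicator_of_mem]
      exact Set.mem_biUnion (hn (Finset.mem_singleton_self i)) hi
    · refine Filter.Eventually.of_forall fun n => ?_
      beta_reduce
      rw [Set.indicator_of_notMem h, Set.indicator_of_notMem]
      exact fun h' => h (Set.iUnion₂_subset_iUnion _ _ h')

/-- The complex measure `λ ↦ τ(b P^m(dλ) c)`. -/
theorem exists_complexMeasure (b c : M) :
    ∃ μ : ComplexMeasure (spectrum ℝ (m : H →L[ℂ] H)),
      ∀ B, MeasurableSet B → μ B = τ.toLinearMap (b * specProj m B * c) := by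
  classical
  have hemb : MeasurableEmbedding (Subtype.val : spectrum ℝ (m : H →L[ℂ] H) → ℝ) :=
    .subtype_coe (measurableSet_spectrum _)
  refine ⟨{
    measureOf' := fun B => if MeasurableSet B then τ.toLinearMap (b * specProj m B * c) else 0
    empty' := ?_
    not_measurable' := fun B hB => if_neg hB
    m_iUnion' := fun A hA hd => ?_ }, fun B hB => if_pos hB⟩
  · rw [if_pos .empty, specProj_eq, Set.image_empty, Set.indicator_empty]
    exact τ.trace_bfcM_zero hm b c
  · simp only [if_pos (hA _), if_pos (MeasurableSet.iUnion hA), specProj_eq, Set.image_iUnion]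
    exact τ.hasSum_trace_bfcM hm b c (fun i => hemb.measurableSet_image.2 (hA i))
      fun i j hij => (Set.disjoint_image_iff Subtype.val_injective).2 (hd hij)

/-- True for indicators by definition of `μ`; both sides are linear and continuous under bounded
pointwise limits, the right one by normality. -/
theorem integral_eq_trace_bfcM {b c : M} {μ : ComplexMeasure (spectrum ℝ (m : H →L[ℂ] H))}
    (hμ : ∀ B, MeasurableSet B → μ B = τ.toLinearMap (b * specProj m B * c)) {φ : ℝ → ℂ}
    (hφ : BddMeas φ) :
    μ.integral (fun l => φ l) (ContinuousLinearMap.mul ℝ ℂ)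
      = τ.toLinearMap (b * bfcM m φ * c) := by
  have hcomp : ∀ {φ : ℝ → ℂ}, BddMeas φ → ∀ z : ℂ,
      μ.Integrable (fun l : spectrum ℝ (m : H →L[ℂ] H) => z * φ l) := fun hφ z =>
    BddMeas.integrable_complexMeasure μ (hφ.comp_val.smul z)
  -- Carrying a scalar `z` through the induction lets the scalar multiplication step merely replace
  -- `z` by `z * z'`.
  suffices ∀ z : ℂ, μ.integral (fun l => z * φ l) (ContinuousLinearMap.mul ℝ ℂ)
      = z * τ.toLinearMap (b * bfcM m φ * c) by simpa using this 1
  refine BddMeas.induction_indicator (P := fun φ : ℝ → ℂ => ∀ z : ℂ,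
    μ.integral (fun l => z * φ l) (ContinuousLinearMap.mul ℝ ℂ)
      = z * τ.toLinearMap (b * bfcM m φ * c)) ?_ ?_ ?_ ?_ hφ
  · intro s hs z
    have h1 : (fun l : spectrum ℝ (m : H →L[ℂ] H) => z * s.indicator 1 (l : ℝ))
        = fun l => (Subtype.val ⁻¹' s : Set (spectrum ℝ (m : H →L[ℂ] H))).indicator
          (fun _ => z) l := by
      ext l
      by_cases hl : (l : ℝ) ∈ s
      · rw [Set.indicator_of_mem hl, Set.indicator_of_mem (show l ∈ Subtype.val ⁻¹' s from hl)]
        simp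
      · rw [Set.indicator_of_notMem hl,
          Set.indicator_of_notMem (show l ∉ Subtype.val ⁻¹' s from hl), mul_zero]
    have hs' := measurable_subtype_coe (p := (· ∈ spectrum ℝ (m : H →L[ℂ] H))) hs
    rw [h1, VectorMeasure.integral_indicator_const z hs', hμ _ hs']
    rfl
  · intro f g hf hg ihf ihg z
    have h1 : (fun l : spectrum ℝ (m : H →L[ℂ] H) => z * (f + g) l)
        = fun l : spectrum ℝ (m : H →L[ℂ] H) => z * f l + z * g l := by
      ext l; exact mul_add _ _ _
    rw [h1, VectorMeasure.integral_fun_add (hcomp hf z) (hcomp hg z), ihf, ihg,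
      τ.trace_bfcM_add hm b c hf hg, mul_add]
  · intro z' f hf ih z
    have h1 : (fun l : spectrum ℝ (m : H →L[ℂ] H) => z * (z' • f) l)
        = fun l : spectrum ℝ (m : H →L[ℂ] H) => z * z' * f l := by
      ext l; exact (mul_assoc _ _ _).symm
    rw [h1, ih, bfcM_smul hm z' hf, mul_smul_comm, smul_mul_assoc, map_smul, smul_eq_mul,
      mul_assoc]
  · intro F f C hF hf hC hlim ih z
    refine tendsto_nhds_unique ?_ ((τ.tendsto_trace_bfcM hm hF hf hC hlim b c).const_mul z)
    simp_rw [← fun n => ih n z]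
    refine VectorMeasure.tendsto_integral_filter_of_norm_le_const
      (Filter.Eventually.of_forall fun n =>
        (((hF n).comp measurable_subtype_coe).const_mul z).aestronglyMeasurable)
      ⟨‖z‖ * C, Filter.Eventually.of_forall fun n => Filter.Eventually.of_forall fun l => ?_⟩
      (Filter.Eventually.of_forall fun l => (hlim l).const_mul z)
    rw [norm_mul]
    exact mul_le_mul_of_nonneg_left (hC n l) (norm_nonneg _)

end VNTrace

/-! ### Triple operator integrals with a scalar measure in the middle slot -/

section MOI

variable {K : Type*} [NormedAddCommGroup K] [InnerProductSpace ℂ K] [CompleteSpace K]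

/-- A decomposition of a function of two variables from a pair of parametrized functions. -/
def IsDecomp.ipd {S : Type w} [MeasurableSpace S] {ρ : Measure S} [SigmaFinite ρ]
    {Φ Ψ : ℝ → S → ℂ} (hD : IsDecomp ρ Φ Ψ) (σ : Fin 2 → Set ℝ) (φ : (∀ j, σ j) → ℂ)
    (hφ : ∀ x, φ x = ∫ s, Φ (x 0) s * Ψ (x 1) s ∂ρ) : IPD.{w} φ where
  S := S
  ρ := ρ
  comp j l s := ![Φ, Ψ] j l s
  measurable_comp j := by
    have h : Measurable (Function.uncurry (![Φ, Ψ] j)) := by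
      fin_cases j
      exacts [hD.meas_left, hD.meas_right]
    exact h.comp ((measurable_subtype_coe.comp measurable_fst).prodMk measurable_snd)
  bounded_comp j s := by
    have h : ∃ C : ℝ, ∀ x, ‖![Φ, Ψ] j x s‖ ≤ C := by
      fin_cases j
      exacts [hD.bdd_left s, hD.bdd_right s]
    exact h.imp fun _ hC l => hC l
  lintegral_lt_top := by
    refine (lintegral_mono fun s => ?_).trans_lt hD.lintegral_lt
    rw [Fin.prod_univ_two]
    exact mul_le_mul' (iSup_le fun l => le_iSup (fun x => ‖Φ x s‖ₑ) (l : ℝ))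
      (iSup_le fun l => le_iSup (fun x => ‖Ψ x s‖ₑ) (l : ℝ))
  eq_integral x := by
    rw [hφ]
    simp_rw [Fin.prod_univ_two]
    rfl

theorem IPD.isDecomp {σ : Fin 2 → Set ℝ} (hσ : ∀ j, MeasurableSet (σ j)) {φ : (∀ j, σ j) → ℂ}
    (D : IPD.{w} φ) : IsDecomp D.ρ (D.extend 0) (D.extend 1) where
  meas_left := D.measurable_extend hσ 0
  meas_right := D.measurable_extend hσ 1
  bdd_left := D.bdd_extend 0
  bdd_right := D.bdd_extend 1
  lintegral_lt := by simpa only [Fin.prod_univ_two] using D.lintegral_extend_lt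

/-- `moi` uses a decomposition of its own choice; the given pair shows that one exists and, by
independence, computes the same integral. -/
theorem inner_moi_two {a₁ a₂ : K →L[ℂ] K} (h₁ : IsSelfAdjoint a₁) (h₂ : IsSelfAdjoint a₂)
    {S : Type} [MeasurableSpace S] {ρ : Measure S} [SigmaFinite ρ] {Φ Ψ : ℝ → S → ℂ}
    (hD : IsDecomp ρ Φ Ψ) (φ : (∀ j, spectrum ℝ (![a₁, a₂] j)) → ℂ)
    (hφ : ∀ x, φ x = ∫ s, Φ (x 0) s * Ψ (x 1) s ∂ρ) (b : K →L[ℂ] K) (y x : K) :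
    ⟪y, moi ![a₁, a₂] φ ![b] x⟫_ℂ
      = ∫ s, ⟪y, (bfc a₁ (fun l => Φ l s) * b * bfc a₂ (fun l => Ψ l s)) x⟫_ℂ ∂ρ := by
  have ha : ∀ j, IsSelfAdjoint (![a₁, a₂] j) := by
    intro j
    fin_cases j
    exacts [h₁, h₂]
  obtain ⟨D, hmoi⟩ := exists_isPettisIntegral_moi ha
    ⟨hD.ipd (fun j => spectrum ℝ (![a₁, a₂] j)) φ hφ⟩
  have hD' : IsDecomp D.ρ (D.extend 0) (D.extend 1) :=
    D.isDecomp (σ := fun j => spectrum ℝ (![a₁, a₂] j)) fun j => measurableSet_spectrum _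
  rw [(hmoi ![b] x y).2.2]
  simp_rw [moiIntegrand_one]
  refine hD'.integral_eq h₁ h₂ hD (fun l₁ hl₁ l₂ hl₂ => ?_) b y x
  let l : ∀ j, spectrum ℝ (![a₁, a₂] j) := Fin.cons ⟨l₁, hl₁⟩ (Fin.cons ⟨l₂, hl₂⟩ finZeroElim)
  have h := D.integral_extend (σ := fun j => spectrum ℝ (![a₁, a₂] j)) l
  simp_rw [Fin.prod_univ_two] at h
  exact h.trans (hφ l)

theorem IsTriple.bddMeas_integral_mid {S : Type*} [MeasurableSpace S] {ρ : Measure S} [SFinite ρ]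
    {Φ : Fin 3 → ℝ → S → ℂ} (hΦ : IsTriple ρ Φ) (l₁ l₃ : ℝ) :
    BddMeas fun l => ∫ s, ∏ j, Φ j (![l₁, l, l₃] j) s ∂ρ := by
  refine bddMeas_integral (Φ := fun l s => ∏ j, Φ j (![l₁, l, l₃] j) s) ?_ ?_
  · simp_rw [Fin.prod_univ_three]
    exact (((hΦ.meas 0).comp (measurable_const.prodMk measurable_snd)).mul (hΦ.meas 1)).mul
      ((hΦ.meas 2).comp (measurable_const.prodMk measurable_snd))
  · refine (lintegral_mono fun s => iSup_le fun l => ?_).trans_lt hΦ.lintegral_lt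
    rw [Fin.prod_univ_three, Fin.prod_univ_three, enorm_mul, enorm_mul]
    exact mul_le_mul' (mul_le_mul' (le_iSup (fun l => ‖Φ 0 l s‖ₑ) l₁)
      (le_iSup (fun l => ‖Φ 1 l s‖ₑ) l)) (le_iSup (fun l => ‖Φ 2 l s‖ₑ) l₃)

end MOI

/-! ### Formula (2): triple operator integrals -/

namespace VNTrace

variable {H : Type*} [NormedAddCommGroup H] [InnerProductSpace ℂ H] [CompleteSpace H]
variable {M : VonNeumannAlgebra H} (τ : VNTrace M)
variable {m : M} (hm : IsSelfAdjoint m)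
variable {S : Type} [MeasurableSpace S] {ρ : Measure S} [SigmaFinite ρ] {Φ : Fin 3 → ℝ → S → ℂ}
include hm

/-- Integrating `f^[2]` against `μ` in the middle variable is the trace `τ(b ψ(m) c)` of its middle
section, hence the symbol of the weighted pair. The operator integral with this symbol therefore has
the elementary integrand. -/
theorem inner_tripleMOI {f : ℝ → ℂ} (hΦ : IsTriple ρ Φ)
    (heq : ∀ l : Fin 3 → ℝ, (∀ j, l j ∈ spectrum ℝ (m : H →L[ℂ] H)) →
      ∫ s, ∏ j, Φ j (l j) s ∂ρ = divDiff f 2 l) {b c : M}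
    {μ : ComplexMeasure (spectrum ℝ (m : H →L[ℂ] H))}
    (hμ : ∀ B, MeasurableSet B → μ B = τ.toLinearMap (b * specProj m B * c)) (p q : M)
    (y x : τ.L2) :
    ⟪y, tripleMOI (τ.rep m) (τ.rep m) (fun l₁ (l₂ : spectrum ℝ (m : H →L[ℂ] H)) l₃ =>
        divDiff f 2 ![(l₁ : ℝ), (l₂ : ℝ), (l₃ : ℝ)]) (τ.rep p) μ (τ.rep q) x⟫_ℂ
      = ∫ s, ⟪y, τ.rep (τ.elemIntegrand m Φ b c (p * q) s) x⟫_ℂ ∂ρ := by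
  have hr := τ.isSelfAdjoint_rep hm
  unfold tripleMOI
  rw [inner_moi_two hr hr (hΦ.isDecomp hr (τ.hat (star b)) (τ.hat c)) _ (fun z => ?_)]
  · simp_rw [τ.rep_elemIntegrand hm hΦ]
    rw [show τ.rep (p * q) = τ.rep p * τ.rep q from map_mul τ.pos.gnsStarAlgHom p q]
  -- The outer variables lie in the spectrum of the represented operator, whereas the symbol is
  -- known on `σ(m)`; the two spectra agree.
  · have hz : ∀ j, ∃ l : spectrum ℝ (m : H →L[ℂ] H), (l : ℝ) = z j := by
      intro j
      have h := (z j).2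
      fin_cases j
      · exact ⟨⟨_, (τ.spectrum_rep hm) ▸ h⟩, rfl⟩
      · exact ⟨⟨_, (τ.spectrum_rep hm) ▸ h⟩, rfl⟩
    obtain ⟨l₁, hl₁⟩ := hz 0
    obtain ⟨l₃, hl₃⟩ := hz 1
    rw [hΦ.integral_weight hr, ← τ.trace_bfcM hm (hΦ.bddMeas_integral_mid _ _),
      ← τ.integral_eq_trace_bfcM hm hμ (hΦ.bddMeas_integral_mid _ _)]
    congr 1
    ext l
    refine (heq _ fun j => ?_).symm
    fin_cases j
    · exact hl₁ ▸ l₁.2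
    · exact l.2
    · exact hl₃ ▸ l₃.2

/-- Formula (1) for any one decomposition, with its integrand split into two elementary summands;
each integrates to a triple operator integral. -/
theorem rep_delta_pureTensor {f : ℝ → ℂ} (hf : f ∈ SuperC 2) {a b c d : M}
    {μ ν : ComplexMeasure (spectrum ℝ (m : H →L[ℂ] H))}
    (hμ : ∀ B, MeasurableSet B → μ B = τ.toLinearMap (b * specProj m B * c))
    (hν : ∀ B, MeasurableSet B → ν B = τ.toLinearMap (d * specProj m B * a)) :
    τ.rep (τ.delta f m (pureTensor a b) (pureTensor c d)) =
      tripleMOI (τ.rep m) (τ.rep m) (fun l₁ (l₂ : spectrum ℝ (m : H →L[ℂ] H)) l₃ =>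
        divDiff f 2 ![(l₁ : ℝ), (l₂ : ℝ), (l₃ : ℝ)]) (τ.rep a) μ (τ.rep d)
      + tripleMOI (τ.rep m) (τ.rep m) (fun l₁ (l₂ : spectrum ℝ (m : H →L[ℂ] H)) l₃ =>
        divDiff f 2 ![(l₁ : ℝ), (l₂ : ℝ), (l₃ : ℝ)]) (τ.rep c) ν (τ.rep b) := by
  have hr := τ.isSelfAdjoint_rep hm
  obtain ⟨D⟩ := nonempty_ipd_divDiff hf (σ := fun _ => spectrum ℝ (m : H →L[ℂ] H))
    fun _ => spectrum.isBounded _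
  have hΦ := D.isTriple fun _ => measurableSet_spectrum _
  have heq : ∀ l : Fin 3 → ℝ, (∀ j, l j ∈ spectrum ℝ (m : H →L[ℂ] H)) →
      ∫ s, ∏ j, D.extend j (l j) s ∂D.ρ = divDiff f 2 l := fun l hl =>
    D.integral_extend (σ := fun _ => spectrum ℝ (m : H →L[ℂ] H)) fun j => ⟨l j, hl j⟩
  have hint : ∀ b c p : M, ∀ y x : τ.L2,
      Integrable (fun s => ⟪y, τ.rep (τ.elemIntegrand m D.extend b c p s) x⟫_ℂ) D.ρ := by
    intro b c p y x
    obtain ⟨T, -, hT, -⟩ :=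
      (τ.isDominated_elemIntegrand hm hΦ b c p).exists_pettis hΦ.lintegral_lt
    exact (hT x y).2.1
  refine ContinuousLinearMap.ext fun x => ext_inner_left ℂ fun y => ?_
  rw [add_apply, inner_add_right, τ.inner_tripleMOI hm hΦ heq hμ,
    τ.inner_tripleMOI hm hΦ heq hν, ← integral_add (hint _ _ _ _ _) (hint _ _ _ _ _),
    (τ.isPettisIntegral_delta hf hm hΦ heq _ _ x y).2.2]
  congr 1
  ext s
  beta_reduce
  rw [tripleIntegrand_pureTensor, rep, map_add τ.pos.gnsStarAlgHom, add_apply, inner_add_right]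

end VNTrace

end FreeIto

theorem proposition4p11 {H : Type u} [NormedAddCommGroup H] [InnerProductSpace ℂ H]
    [CompleteSpace H] (M : VonNeumannAlgebra H) (τ : FreeIto.VNTrace M)
    (f : ℝ → ℂ) (hf : f ∈ FreeIto.SuperC 2) (m : M) (hm : IsSelfAdjoint m) :
    (∀ (D : FreeIto.IPD.{w} (Ω := fun _ : Fin 3 => spectrum ℝ (m : H →L[ℂ] H))
          (fun l => FreeIto.divDiff f 2 (fun j => (l j : ℝ))))
        (u v : FreeIto.BiTensor M),
      FreeIto.IsPettisIntegral D.ρ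
        (fun s => τ.rep (FreeIto.trMulSymm τ.toLinearMap u v
          (FreeIto.borelFCMem m (fun l => D.comp 0 l s))
          (FreeIto.borelFCMem m (fun l => D.comp 1 l s))
          (FreeIto.borelFCMem m (fun l => D.comp 2 l s))))
        (τ.rep (τ.delta f m u v))) ∧
    (∀ a b c d : M,
      ∃ μ ν : ComplexMeasure (spectrum ℝ (m : H →L[ℂ] H)),
        (∀ B, MeasurableSet B → μ B = τ.toLinearMap (b * FreeIto.specProj m B * c)) ∧
        (∀ B, MeasurableSet B → ν B = τ.toLinearMap (d * FreeIto.specProj m B * a)) ∧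
        τ.rep (τ.delta f m (FreeIto.pureTensor a b) (FreeIto.pureTensor c d)) =
          FreeIto.tripleMOI (τ.rep m) (τ.rep m)
              (fun l₁ (l₂ : spectrum ℝ (m : H →L[ℂ] H)) l₃ => FreeIto.divDiff f 2 ![(l₁ : ℝ), (l₂ : ℝ), (l₃ : ℝ)])
              (τ.rep a) μ (τ.rep d)
            + FreeIto.tripleMOI (τ.rep m) (τ.rep m)
              (fun l₁ (l₂ : spectrum ℝ (m : H →L[ℂ] H)) l₃ => FreeIto.divDiff f 2 ![(l₁ : ℝ), (l₂ : ℝ), (l₃ : ℝ)])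
              (τ.rep c) ν (τ.rep b)) := by
  refine ⟨fun D u v => τ.isPettisIntegral_delta_of_ipd hf hm D u v, fun a b c d => ?_⟩
  obtain ⟨μ, hμ⟩ := τ.exists_complexMeasure hm b c
  obtain ⟨ν, hν⟩ := τ.exists_complexMeasure hm d a
  exact ⟨μ, ν, hμ, hν, τ.rep_delta_pureTensor hm hf hμ hν⟩
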